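/- Let $M$ be a smooth (Hausdorff, second countable) manifold without boundary of dimension $d=d_u+d_s$, $d_u,d_s\ge 0$, let $N\ge 1$, let $\varphi:M\to M$ be a $C^{N+1}$ diffeomorphism, and let $K\subset M$ be compact with $\varphi(K)=K$. Assume that $\varphi$ is hyperbolic on $K$: for each $x\in K$ there is a splitting $T_xM=E_u(x)\oplus E_s(x)$ into subspaces of dimensions $d_u,d_s$ with $d\varphi(x)E_u(x)=E_u(\varphi(x))$ and $d\varphi(x)E_s(x)=E_s(\varphi(x))$, and there are constants $C>0$, $0<\lambda<1$ and a Riemannian metric $|\cdot|$ on $M$ such that for all $x\in K$ and $n\ge 0$ $$|d\varphi^{-n}(x)v|\le C\lambda^n|v|\ \ (v\in E_u(x)),\qquad |d\varphi^{n}(x)v|\le C\lambda^n|v|\ \ (v\in E_s(x)).$$ Let $\mathscr G_u,\mathscr G_s$ be the bundles over $M$ of $d_u$-dimensional, respectively $d_s$-dimensional, subspaces of the tangent spaces of $M$. Fix smooth Riemannian metrics on $M$, $\mathscr G_u$, $\mathscr G_s$. Then there is $\gamma>0$ such that the maps $E_u:K\to\mathscr G_u$, $x\mapsto (x,E_u(x))$,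 and $E_s:K\to\mathscr G_s$, $x\mapsto (x,E_s(x))$, are Hölder continuous with exponent $\gamma$ for the Riemannian distances. Moreover, let $\overline TM$ be the fiber-radial compactification of $TM$: a manifold with boundary, whose fiber over $x$ is the set of rays $[t,v]$ of $\mathbb R\oplus T_xM$ with $t\ge0$, where $v\in T_xM$ is identified with $[1,v]$. Let $\Phi,\Phi^{-1}$ be the actions of $d\varphi,d\varphi^{-1}$ on $\overline TM$, $\Phi(x,[t,v])=(\varphi(x),[t,d\varphi(x)v])$, and fix a Riemannian metric on $\overline TM$, smooth up to the boundary. Then there is $\Lambda\ge 1$ which is a Lipschitz constant of both $\Phi$ and $\Phi^{-1}$ on the part of $\overline TM$ over $K$. If $\Lambda\ge1$ is any Lipschitz constant of $\Phi$ on the part of $\overline TM$ over $K$, then $E_s$ is Hölder continuous with exponent $$\gamma=-\frac{2\log\lambda}{\log(\Lambda/\lambda)}>0,$$ and if $\Lambda\ge 1$ is any Lipschitz constant of $\Phi^{-1}$ there, then $E_u$ is Hölder continuous with the exponent $\gamma$ given by the same formula. -/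

import Mathlib

open Set Function Bundle
open scoped Manifold ContDiff ENNReal NNReal

noncomputable section

namespace HyperbolicHolder

section Associated

/-- A smooth manifold `F` (with model `J`, given by a family of injective parametrizations
`param a : HF → F`) on which the linear group of `E` acts smoothly.  The action map
`(g, y) ↦ g • (param a y)`, read in the parametrization `b`, is defined on the trace of an open set
`dom a b` and is there the restriction of the smooth map `trans a b`. -/
structure LinearFibre (E F ι HF EF : Type*) [NormedAddCommGroup E] [NormedSpace ℝ E]
    [TopologicalSpace HF] [NormedAddCommGroup EF] [NormedSpace ℝ EF]
    (J : ModelWithCorners ℝ EF HF) where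
  act : (E ≃L[ℝ] E) → F → F
  act_refl : ∀ f, act (ContinuousLinearEquiv.refl ℝ E) f = f
  act_trans : ∀ g h f, act (g.trans h) f = act h (act g f)
  param : ι → HF → F
  injective : ∀ a, Injective (param a)
  covers : ∀ f, ∃ a y, param a y = f
  dom : ι → ι → Set ((E →L[ℝ] E) × EF)
  isOpen_dom : ∀ a b, IsOpen (dom a b)
  trans : ι → ι → (E →L[ℝ] E) × EF → EF
  contDiffOn_trans : ∀ a b, ContDiffOn ℝ ∞ (trans a b) (dom a b)
  mem_dom : ∀ a b (g : E ≃L[ℝ] E) y,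
    (∃ y', act g (param a y) = param b y') ↔ ((g : E →L[ℝ] E), J y) ∈ dom a b
  trans_eq : ∀ a b (g : E ≃L[ℝ] E) y y',
    act g (param a y) = param b y' → J y' = trans a b ((g : E →L[ℝ] E), J y)

variable {E H M : Type*} [NormedAddCommGroup E] [NormedSpace ℝ E] [TopologicalSpace H]
  (I : ModelWithCorners ℝ E H) [TopologicalSpace M] [ChartedSpace H M] [IsManifold I ∞ M]

/-- The differential at `x` of the chart centred at `x₀`, as a linear automorphism of `E`; here
`TangentSpace I x` is the copy of `E` given by the chart centred at `x`. -/
def frameChange (x₀ x : M) : E ≃L[ℝ] E :=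
  (trivializationAt E (TangentSpace I : M → Type _) x).coordChangeL ℝ
    (trivializationAt E (TangentSpace I : M → Type _) x₀) x

theorem frameChange_symm_trans (x₀ x₁ x : M) (h₀ : x ∈ (chartAt H x₀).source)
    (h₁ : x ∈ (chartAt H x₁).source) :
    (frameChange I x₀ x).symm.trans (frameChange I x₁ x) =
      (trivializationAt E (TangentSpace I : M → Type _) x₀).coordChangeL ℝ
        (trivializationAt E (TangentSpace I : M → Type _) x₁) x := by
  have hx := mem_chart_source H x
  have e : ∀ y : M, (trivializationAt E (TangentSpace I : M → Type _) y).baseSet =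
      (chartAt H y).source := fun y => rfl
  ext v
  unfold frameChange
  rw [ContinuousLinearEquiv.trans_apply]
  rw [Trivialization.symm_coordChangeL _ _ (by rw [e, e]; exact ⟨h₀, hx⟩)]
  rw [Trivialization.coe_coordChangeL _ _ (by rw [e, e]; exact ⟨hx, h₁⟩),
    Trivialization.coe_coordChangeL _ _ (by rw [e, e]; exact ⟨h₀, hx⟩),
    Trivialization.coe_coordChangeL _ _ (by rw [e, e]; exact ⟨h₀, h₁⟩)]
  simp only [LinearEquiv.trans_apply]
  rw [LinearEquiv.symm_apply_apply]

variable {F ι HF EF : Type*} [TopologicalSpace HF]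
  [NormedAddCommGroup EF] [NormedSpace ℝ EF] {J : ModelWithCorners ℝ EF HF}
  (D : LinearFibre E F ι HF EF J)

namespace LinearFibre

theorem act_symm_act (g : E ≃L[ℝ] E) (f : F) : D.act g.symm (D.act g f) = f := by
  rw [← D.act_trans, ContinuousLinearEquiv.self_trans_symm, D.act_refl]

theorem act_act_symm (g : E ≃L[ℝ] E) (f : F) : D.act g (D.act g.symm f) = f := by
  rw [← D.act_trans, ContinuousLinearEquiv.symm_trans_self, D.act_refl]

variable [Nonempty HF]

/-- The bundle chart given by the chart of `M` centred at `x₀` and the parametrization `a` of the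
fibre. -/
def bundleChart (x₀ : M) (a : ι) : PartialEquiv (Σ _ : M, F) (ModelProd H HF) where
  toFun p := (chartAt H x₀ p.1, Function.invFun (D.param a) (D.act (frameChange I x₀ p.1) p.2))
  invFun q := ⟨(chartAt H x₀).symm q.1,
    D.act (frameChange I x₀ ((chartAt H x₀).symm q.1)).symm (D.param a q.2)⟩
  source := {p | p.1 ∈ (chartAt H x₀).source ∧ D.act (frameChange I x₀ p.1) p.2 ∈ range (D.param a)}
  target := {q | q.1 ∈ (chartAt H x₀).target}
  map_source' p hp := (chartAt H x₀).map_source hp.1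
  map_target' q hq := ⟨(chartAt H x₀).map_target hq, by simp [D.act_act_symm]⟩
  left_inv' := by
    rintro ⟨x, f⟩ ⟨hx, y, hy⟩
    dsimp only at hx hy ⊢
    rw [← hy, Function.leftInverse_invFun (D.injective a), hy, (chartAt H x₀).left_inv hx,
      D.act_symm_act]
  right_inv' := by
    rintro ⟨z, y⟩ hz
    simp only [D.act_act_symm, Function.leftInverse_invFun (D.injective a) y]
    rw [(chartAt H x₀).right_inv hz]

theorem bundleChart_trans_source (x₀ x₁ : M) (a b : ι) :
    ((D.bundleChart I x₀ a).symm.trans (D.bundleChart I x₁ b)).source =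
      {q : ModelProd H HF | q.1 ∈ ((chartAt H x₀).symm.trans (chartAt H x₁)).source ∧
        ((((trivializationAt E (TangentSpace I : M → Type _) x₀).coordChangeL ℝ
          (trivializationAt E (TangentSpace I : M → Type _) x₁)
          ((chartAt H x₀).symm q.1) : E ≃L[ℝ] E) : E →L[ℝ] E), J q.2) ∈ D.dom a b} := by
  ext ⟨z, y⟩
  simp only [PartialEquiv.trans_source, PartialEquiv.symm_source, bundleChart, mem_inter_iff,
    mem_preimage, OpenPartialHomeomorph.trans_source, OpenPartialHomeomorph.symm_source,
    PartialEquiv.coe_symm_mk, mem_ofPred_eq, and_assoc]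
  refine and_congr_right fun hz => and_congr_right fun hx => ?_
  rw [← D.mem_dom, ← D.act_trans, frameChange_symm_trans I x₀ x₁ _ ((chartAt H x₀).map_target hz) hx]
  simp only [mem_range, eq_comm]

theorem bundleChart_trans_apply (x₀ x₁ : M) (a b : ι) (q : ModelProd H HF)
    (hq : q ∈ ((D.bundleChart I x₀ a).symm.trans (D.bundleChart I x₁ b)).source) :
    (((D.bundleChart I x₀ a).symm.trans (D.bundleChart I x₁ b)) q).1 =
        chartAt H x₁ ((chartAt H x₀).symm q.1) ∧
      J (((D.bundleChart I x₀ a).symm.trans (D.bundleChart I x₁ b)) q).2 =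
        D.trans a b ((((trivializationAt E (TangentSpace I : M → Type _) x₀).coordChangeL ℝ
          (trivializationAt E (TangentSpace I : M → Type _) x₁)
          ((chartAt H x₀).symm q.1) : E ≃L[ℝ] E) : E →L[ℝ] E), J q.2) := by
  refine ⟨rfl, ?_⟩
  have hq' := hq
  rw [bundleChart_trans_source] at hq'
  obtain ⟨⟨hz, hx⟩, hd⟩ := hq'
  rw [← D.mem_dom] at hd
  obtain ⟨y', hy'⟩ := hd
  rw [← D.trans_eq a b _ _ y' hy']
  rw [← frameChange_symm_trans I x₀ x₁ _ ((chartAt H x₀).map_target hz) hx, D.act_trans] at hy'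
  congr 1
  change Function.invFun (D.param b) (D.act (frameChange I x₁ ((chartAt H x₀).symm q.1))
    (D.act (frameChange I x₀ ((chartAt H x₀).symm q.1)).symm (D.param a q.2))) = y'
  rw [hy', Function.leftInverse_invFun (D.injective b)]

/-- In the coordinates of the chart centred at `x₀`, the change of frame is smooth. -/
theorem contDiffOn_frame (x₀ x₁ : M) :
    ContDiffOn ℝ ∞ (fun z : E => (((trivializationAt E (TangentSpace I : M → Type _) x₀).coordChangeL ℝ
          (trivializationAt E (TangentSpace I : M → Type _) x₁)
          ((chartAt H x₀).symm (I.symm z)) : E ≃L[ℝ] E) : E →L[ℝ] E))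
      (I.symm ⁻¹' ((chartAt H x₀).symm.trans (chartAt H x₁)).source ∩ range I) := by
  have h1 := contMDiffOn_coordChangeL (n := ∞) (IB := I)
    (e := trivializationAt E (TangentSpace I : M → Type _) x₀)
    (e' := trivializationAt E (TangentSpace I : M → Type _) x₁)
  have h2 := contMDiffOn_extChartAt_symm (I := I) (n := ∞) x₀
  rw [← contMDiffOn_iff_contDiffOn]
  refine h1.comp (h2.mono ?_) ?_
  · rintro z ⟨⟨hz, -⟩, hr⟩
    rw [extChartAt_target]
    exact ⟨hz, hr⟩
  · rintro z ⟨⟨hz, hx⟩, hr⟩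
    exact ⟨(chartAt H x₀).map_target hz, hx⟩

theorem continuousOn_frame (x₀ x₁ : M) :
    ContinuousOn (fun z : H => (((trivializationAt E (TangentSpace I : M → Type _) x₀).coordChangeL ℝ
          (trivializationAt E (TangentSpace I : M → Type _) x₁)
          ((chartAt H x₀).symm z) : E ≃L[ℝ] E) : E →L[ℝ] E))
      ((chartAt H x₀).symm.trans (chartAt H x₁)).source := by
  have h := ((contDiffOn_frame I x₀ x₁).continuousOn).comp (t := _)
    (s := ((chartAt H x₀).symm.trans (chartAt H x₁)).source) I.continuous.continuousOn
    (fun z hz => ⟨by simpa using hz, mem_range_self z⟩)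
  simpa [Function.comp_def] using h

/-- The bundle over `M` with fibre `F` associated with the tangent bundle, as a set glued from its
bundle charts. -/
def core : ChartedSpaceCore (ModelProd H HF) (Σ _ : M, F) where
  atlas := {e | ∃ (x₀ : M) (a : ι), e = D.bundleChart I x₀ a}
  chartAt p := D.bundleChart I p.1 (D.covers (D.act (frameChange I p.1 p.1) p.2)).choose
  mem_chart_source p := ⟨mem_chart_source H p.1,
    (D.covers (D.act (frameChange I p.1 p.1) p.2)).choose_spec⟩
  chart_mem_atlas p := ⟨_, _, rfl⟩
  open_source := by
    rintro _ _ ⟨x₀, a, rfl⟩ ⟨x₁, b, rfl⟩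
    rw [bundleChart_trans_source]
    have hc := (continuousOn_frame I x₀ x₁)
    have h1 : ContinuousOn (fun q : H × HF => ((((trivializationAt E (TangentSpace I : M → Type _) x₀).coordChangeL ℝ
          (trivializationAt E (TangentSpace I : M → Type _) x₁)
          ((chartAt H x₀).symm q.1) : E ≃L[ℝ] E) : E →L[ℝ] E), J q.2))
          {q | q.1 ∈ ((chartAt H x₀).symm.trans (chartAt H x₁)).source} :=
      (hc.comp continuousOn_fst fun q hq => hq).prodMk
        (J.continuous.comp continuous_snd).continuousOn
    exact h1.isOpen_inter_preimage
      (((chartAt H x₀).symm.trans (chartAt H x₁)).open_source.preimage continuous_fst)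
      (D.isOpen_dom a b)
  continuousOn_toFun := by
    rintro _ _ ⟨x₀, a, rfl⟩ ⟨x₁, b, rfl⟩
    have hs := bundleChart_trans_source I D x₀ x₁ a b
    have h1 : ContinuousOn (fun q : H × HF => ((((trivializationAt E (TangentSpace I : M → Type _) x₀).coordChangeL ℝ
          (trivializationAt E (TangentSpace I : M → Type _) x₁)
          ((chartAt H x₀).symm q.1) : E ≃L[ℝ] E) : E →L[ℝ] E), J q.2))
          ((D.bundleChart I x₀ a).symm.trans (D.bundleChart I x₁ b)).source :=
      ((continuousOn_frame I x₀ x₁).comp continuousOn_fst fun q hq => by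
        rw [hs] at hq; exact hq.1).prodMk
        (J.continuous.comp continuous_snd).continuousOn
    have h2 := (D.contDiffOn_trans a b).continuousOn.comp h1 (fun q hq => by
      rw [hs] at hq; exact hq.2)
    have h3 := J.continuous_symm.comp_continuousOn h2
    have h4 : ContinuousOn (fun q : H × HF => chartAt H x₁ ((chartAt H x₀).symm q.1))
        ((D.bundleChart I x₀ a).symm.trans (D.bundleChart I x₁ b)).source :=
      ((chartAt H x₀).symm.trans (chartAt H x₁)).continuousOn.comp continuousOn_fst
        (fun q hq => by rw [hs] at hq; exact hq.1)
    refine (h4.prodMk h3).congr fun q hq => ?_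
    obtain ⟨e1, e2⟩ := bundleChart_trans_apply I D x₀ x₁ a b q hq
    refine Prod.ext e1 ?_
    simp only [Function.comp_apply]
    rw [← e2, J.left_inv]

theorem isManifold_core :
    letI := (D.core I (M := M)).toTopologicalSpace
    letI := (D.core I (M := M)).toChartedSpace
    IsManifold (I.prod J) ∞ (Σ _ : M, F) := by
  let _ := (D.core I (M := M)).toTopologicalSpace
  let _ := (D.core I (M := M)).toChartedSpace
  refine isManifold_of_contDiffOn _ _ _ ?_
  rintro e e' he he'
  obtain ⟨e, ⟨x₀, a, rfl⟩, rfl⟩ : ∃ e₀ : PartialEquiv (Σ _ : M, F) (ModelProd H HF),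
    ∃ h : e₀ ∈ (D.core I (M := M)).atlas, (D.core I).openPartialHomeomorph e₀ h = e := by
    simpa [atlas, ChartedSpace.atlas, ChartedSpaceCore.toChartedSpace, eq_comm] using he
  obtain ⟨e', ⟨x₁, b, rfl⟩, rfl⟩ : ∃ e₀ : PartialEquiv (Σ _ : M, F) (ModelProd H HF),
    ∃ h : e₀ ∈ (D.core I (M := M)).atlas, (D.core I).openPartialHomeomorph e₀ h = e' := by
    simpa [atlas, ChartedSpace.atlas, ChartedSpaceCore.toChartedSpace, eq_comm] using he'
  have hs := bundleChart_trans_source I D x₀ x₁ a b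
  set S := ((D.bundleChart I x₀ a).symm.trans (D.bundleChart I x₁ b)).source with hS
  change ContDiffOn ℝ ∞ (fun w : E × EF => (I.prod J)
      (((D.bundleChart I x₀ a).symm.trans (D.bundleChart I x₁ b)) ((I.prod J).symm w)))
    ((I.prod J).symm ⁻¹' S ∩ range (I.prod J))
  have hr : ∀ w ∈ (I.prod J).symm ⁻¹' S ∩ range (I.prod J),
      w.1 ∈ I.symm ⁻¹' ((chartAt H x₀).symm.trans (chartAt H x₁)).source ∩ range I := by
    rintro w ⟨hw, ⟨q, rfl⟩⟩
    rw [mem_preimage, hs] at hw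
    exact ⟨hw.1, ⟨q.1, rfl⟩⟩
  have hr2 : ∀ w ∈ (I.prod J).symm ⁻¹' S ∩ range (I.prod J), J (J.symm w.2) = w.2 := by
    rintro w ⟨hw, ⟨q, rfl⟩⟩
    exact J.right_inv ⟨q.2, rfl⟩
  have hg := (contDiffOn_frame I x₀ x₁).comp (contDiff_fst (E := E) (F := EF)).contDiffOn hr
  have h1 := (D.contDiffOn_trans a b).comp (hg.prodMk contDiff_snd.contDiffOn) (fun w hw => by
    have h := hw.1
    rw [mem_preimage, hs] at h
    have h' := h.2
    change (_, J (J.symm w.2)) ∈ _ at h'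
    rw [hr2 w hw] at h'
    exact h')
  have hI : ContDiffOn ℝ ∞ (I ∘ ((chartAt H x₀).symm.trans (chartAt H x₁)) ∘ I.symm)
      (I.symm ⁻¹' ((chartAt H x₀).symm.trans (chartAt H x₁)).source ∩ range I) :=
    ((contDiffGroupoid ∞ I).compatible (chart_mem_atlas H x₀) (chart_mem_atlas H x₁)).1
  have h2 := hI.comp (contDiff_fst (E := E) (F := EF)).contDiffOn hr
  refine (h2.prodMk h1).congr fun w hw => ?_
  obtain ⟨e1, e2⟩ := bundleChart_trans_apply I D x₀ x₁ a b _ hw.1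
  refine Prod.ext ?_ ?_
  · exact congrArg I e1
  · refine e2.trans ?_
    change D.trans a b (_, J (J.symm w.2)) = _
    rw [hr2 w hw]
    rfl

end LinearFibre
end Associated

section Grassmann

/-- Euclidean space `ℝⁿ`. -/
abbrev Euc (n : ℕ) := EuclideanSpace ℝ (Fin n)

/-- The Grassmannian of `k`-dimensional subspaces of a real vector space. -/
@[ext]
structure Gr (k : ℕ) (V : Type*) [AddCommGroup V] [Module ℝ V] where
  space : Submodule ℝ V
  finrank_space : Module.finrank ℝ space = k

/-- The bijection of Grassmannians induced by a linear isomorphism. -/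
def Gr.map {k : ℕ} {V W : Type*} [AddCommGroup V] [Module ℝ V] [AddCommGroup W] [Module ℝ W]
    (e : V ≃ₗ[ℝ] W) (S : Gr k V) : Gr k W :=
  ⟨S.space.map (e : V →ₗ[ℝ] W), (LinearEquiv.finrank_map_eq e S.1).trans S.2⟩

variable {k d : ℕ}

/-- For a linear isomorphism `A : ℝᵏ × ℝᵈ⁻ᵏ → ℝᵈ`, the image under `A` of the graph of `L`. -/
def planeOfGraph (A : (Euc k × Euc (d - k)) ≃L[ℝ] Euc d) (L : Euc k →L[ℝ] Euc (d - k)) :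
    Gr k (Euc d) :=
  ⟨LinearMap.range ((A : (Euc k × Euc (d - k)) →L[ℝ] Euc d) ∘L
      ((ContinuousLinearMap.id ℝ (Euc k)).prod L)).toLinearMap, by
    rw [LinearMap.finrank_range_of_inj]
    · simp
    · intro u v h
      simpa using congrArg Prod.fst (A.injective h)⟩

/-- The map `u ↦ B⁻¹ g A (u, L u)`, as a function of `(g, L)`. -/
def graphTransition (A B : (Euc k × Euc (d - k)) ≃L[ℝ] Euc d)
    (p : (Euc d →L[ℝ] Euc d) × (Euc k →L[ℝ] Euc (d - k))) :
    Euc k →L[ℝ] Euc k × Euc (d - k) :=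
  (B.symm : Euc d →L[ℝ] (Euc k × Euc (d - k))) ∘L p.1 ∘L
    (A : (Euc k × Euc (d - k)) →L[ℝ] Euc d) ∘L ((ContinuousLinearMap.id ℝ (Euc k)).prod p.2)

theorem contDiff_graphTransition (A B : (Euc k × Euc (d - k)) ≃L[ℝ] Euc d) :
    ContDiff ℝ ∞ (graphTransition A B) := by
  have h : ∀ L : Euc k →L[ℝ] Euc (d - k), (ContinuousLinearMap.id ℝ (Euc k)).prod L =
      ContinuousLinearMap.inl ℝ _ _ + ContinuousLinearMap.inr ℝ (Euc k) (Euc (d - k)) ∘L L := by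
    intro L; ext u <;> simp
  unfold graphTransition
  simp only [h]
  exact contDiff_const.clm_comp (contDiff_fst.clm_comp (contDiff_const.clm_comp
    (contDiff_const.add (contDiff_const.clm_comp contDiff_snd))))

theorem map_planeOfGraph_eq_iff (A B : (Euc k × Euc (d - k)) ≃L[ℝ] Euc d)
    (g : Euc d ≃L[ℝ] Euc d) (L L' : Euc k →L[ℝ] Euc (d - k)) :
    Gr.map g.toLinearEquiv (planeOfGraph A L) = planeOfGraph B L' ↔
      ∀ u, (graphTransition A B ((g : Euc d →L[ℝ] Euc d), L) u).2 =
        L' (graphTransition A B ((g : Euc d →L[ℝ] Euc d), L) u).1 := by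
  constructor
  · intro h u
    have h1 : g (A (u, L u)) ∈ (planeOfGraph B L').1 := by
      rw [← h]
      exact ⟨A (u, L u), ⟨u, rfl⟩, rfl⟩
    obtain ⟨w, hw⟩ := h1
    have h2 : graphTransition A B ((g : Euc d →L[ℝ] Euc d), L) u = (w, L' w) := by
      change B.symm (g (A (u, L u))) = _
      rw [← hw]
      exact B.symm_apply_apply _
    rw [h2]
  · intro h
    apply Gr.ext
    refine Submodule.eq_of_le_of_finrank_eq ?_ ?_
    · rintro _ ⟨_, ⟨u, rfl⟩, rfl⟩
      refine ⟨(graphTransition A B ((g : Euc d →L[ℝ] Euc d), L) u).1, ?_⟩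
      change B ((graphTransition A B ((g : Euc d →L[ℝ] Euc d), L) u).1,
        L' (graphTransition A B ((g : Euc d →L[ℝ] Euc d), L) u).1) = g (A (u, L u))
      rw [← h u]
      exact B.apply_symm_apply _
    · exact (Gr.map g.toLinearEquiv (planeOfGraph A L)).2.trans (planeOfGraph B L').2.symm

theorem isUnit_of_map_planeOfGraph_eq (A B : (Euc k × Euc (d - k)) ≃L[ℝ] Euc d)
    (g : Euc d ≃L[ℝ] Euc d) (L L' : Euc k →L[ℝ] Euc (d - k))
    (h : Gr.map g.toLinearEquiv (planeOfGraph A L) = planeOfGraph B L') :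
    IsUnit (ContinuousLinearMap.fst ℝ _ _ ∘L
      graphTransition A B ((g : Euc d →L[ℝ] Euc d), L)) := by
  rw [map_planeOfGraph_eq_iff] at h
  have hinj : Injective (ContinuousLinearMap.fst ℝ _ _ ∘L
      graphTransition A B ((g : Euc d →L[ℝ] Euc d), L)) := by
    rw [injective_iff_map_eq_zero]
    intro u hu
    have h1 := h u
    change (graphTransition A B ((g : Euc d →L[ℝ] Euc d), L) u).1 = 0 at hu
    rw [hu, map_zero] at h1
    have h2 : B.symm (g (A (u, L u))) = 0 := Prod.ext hu h1
    have h3 : ((u, L u) : Euc k × Euc (d - k)) = 0 := by simpa using h2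
    exact congrArg Prod.fst h3
  exact ContinuousLinearMap.isUnit_iff_bijective.2
    ⟨hinj, (LinearMap.injective_iff_surjective (f := (ContinuousLinearMap.fst ℝ _ _ ∘L
      graphTransition A B ((g : Euc d →L[ℝ] Euc d), L)).toLinearMap)).1 hinj⟩

theorem exists_planeOfGraph (S : Gr k (Euc d)) :
    ∃ (A : (Euc k × Euc (d - k)) ≃L[ℝ] Euc d) (L : Euc k →L[ℝ] Euc (d - k)),
      planeOfGraph A L = S := by
  obtain ⟨S, hS⟩ := S
  obtain ⟨Q, hQ⟩ := Submodule.exists_isCompl S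
  have hd := Submodule.finrank_add_eq_of_isCompl hQ
  rw [finrank_euclideanSpace_fin] at hd
  have e1 : Euc k ≃ₗ[ℝ] S := LinearEquiv.ofFinrankEq _ _ (by simp [hS])
  have e2 : Euc (d - k) ≃ₗ[ℝ] Q := LinearEquiv.ofFinrankEq _ _ (by
    rw [finrank_euclideanSpace_fin]; omega)
  let A := ((e1.prodCongr e2).trans (Submodule.prodEquivOfIsCompl S Q hQ)).toContinuousLinearEquiv
  refine ⟨A, 0, Gr.ext (Submodule.eq_of_le_of_finrank_eq ?_ ?_)⟩
  · rintro _ ⟨u, rfl⟩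
    have : A (u, 0) = (e1 u : Euc d) := by
      simp [A]
    change A (u, 0) ∈ S
    rw [this]
    exact (e1 u).2
  · exact (planeOfGraph A 0).2.trans hS.symm

/-- The Grassmannian of `ℝᵈ` with its standard smooth structure and action of `GL(d)`. -/
def grassmannFibre (k d : ℕ) :
    LinearFibre (Euc d) (Gr k (Euc d)) ((Euc k × Euc (d - k)) ≃L[ℝ] Euc d)
      (Euc k →L[ℝ] Euc (d - k)) (Euc k →L[ℝ] Euc (d - k)) 𝓘(ℝ, Euc k →L[ℝ] Euc (d - k)) where
  act g := Gr.map g.toLinearEquiv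
  act_refl S := Gr.ext (Submodule.map_id S.1)
  act_trans g h S := Gr.ext (Submodule.map_comp _ _ S.1)
  param := planeOfGraph
  injective A L L' h := by
    have h1 := (map_planeOfGraph_eq_iff A A (ContinuousLinearEquiv.refl ℝ _) L L').1
      ((Gr.ext (Submodule.map_id _)).trans h)
    ext1 u
    have h2 : graphTransition A A
        (((ContinuousLinearEquiv.refl ℝ (Euc d)) : Euc d →L[ℝ] Euc d), L) u = (u, L u) :=
      A.symm_apply_apply _
    have h3 := h1 u
    rwa [h2] at h3
  covers := exists_planeOfGraph
  dom A B := {p | IsUnit (ContinuousLinearMap.fst ℝ _ _ ∘L graphTransition A B p)}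
  isOpen_dom A B := by
    have hP : ContDiff ℝ ∞ fun p => ContinuousLinearMap.fst ℝ (Euc k) (Euc (d - k)) ∘L
        graphTransition A B p := contDiff_const.clm_comp (contDiff_graphTransition A B)
    exact (Units.isOpen (R := Euc k →L[ℝ] Euc k)).preimage hP.continuous
  trans A B p := (ContinuousLinearMap.snd ℝ _ _ ∘L graphTransition A B p) ∘L
    Ring.inverse (ContinuousLinearMap.fst ℝ _ _ ∘L graphTransition A B p)
  contDiffOn_trans A B := by
    intro p hp
    have hP : ContDiff ℝ ∞ fun p => ContinuousLinearMap.fst ℝ (Euc k) (Euc (d - k)) ∘L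
        graphTransition A B p := contDiff_const.clm_comp (contDiff_graphTransition A B)
    have hQ : ContDiff ℝ ∞ fun p => ContinuousLinearMap.snd ℝ (Euc k) (Euc (d - k)) ∘L
        graphTransition A B p := contDiff_const.clm_comp (contDiff_graphTransition A B)
    obtain ⟨w, hw⟩ := hp
    have hi := contDiffAt_ringInverse (n := ∞) ℝ w
    rw [hw] at hi
    exact (hQ.contDiffAt.clm_comp (hi.comp p hP.contDiffAt)).contDiffWithinAt
  mem_dom A B g L := by
    constructor
    · rintro ⟨L', h⟩
      exact isUnit_of_map_planeOfGraph_eq A B g L L' h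
    · intro h
      refine ⟨(ContinuousLinearMap.snd ℝ _ _ ∘L graphTransition A B ((g : Euc d →L[ℝ] Euc d), L)) ∘L
        Ring.inverse (ContinuousLinearMap.fst ℝ _ _ ∘L
          graphTransition A B ((g : Euc d →L[ℝ] Euc d), L)), ?_⟩
      rw [map_planeOfGraph_eq_iff]
      intro u
      have h1 := DFunLike.congr_fun (Ring.inverse_mul_cancel _ h) u
      change Ring.inverse (ContinuousLinearMap.fst ℝ _ _ ∘L
          graphTransition A B ((g : Euc d →L[ℝ] Euc d), L))
          (graphTransition A B ((g : Euc d →L[ℝ] Euc d), L) u).1 = u at h1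
      rw [ContinuousLinearMap.comp_apply, h1]
      rfl
  trans_eq A B g L L' h := by
    have hd := isUnit_of_map_planeOfGraph_eq A B g L L' h
    rw [map_planeOfGraph_eq_iff] at h
    have h2 : ContinuousLinearMap.snd ℝ _ _ ∘L graphTransition A B ((g : Euc d →L[ℝ] Euc d), L) =
        L' ∘L (ContinuousLinearMap.fst ℝ _ _ ∘L
          graphTransition A B ((g : Euc d →L[ℝ] Euc d), L)) := by
      ext1 u; exact h u
    change L' = (ContinuousLinearMap.snd ℝ _ _ ∘L
      graphTransition A B ((g : Euc d →L[ℝ] Euc d), L)) ∘L _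
    rw [h2, ContinuousLinearMap.comp_assoc]
    have h3 := Ring.mul_inverse_cancel _ hd
    ext1 u
    exact (congrArg L' (DFunLike.congr_fun h3 u)).symm

end Grassmann

section Rays

/-- The half-space `{y ∈ ℝᵈ | y₀ ≥ 0}` (a point when `d = 0`). -/
def halfSet (d : ℕ) : Set (Euc d) := {y | ∀ i : Fin d, (i : ℕ) = 0 → 0 ≤ y i}

/-- The half-space as a model space for manifolds with boundary. -/
abbrev HalfSpace (d : ℕ) := halfSet d

instance (d : ℕ) : Nonempty (HalfSpace d) := ⟨⟨0, fun _ _ => le_rfl⟩⟩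

/-- The inclusion of the half-space in `ℝᵈ`, as a model with corners. -/
def halfModel (d : ℕ) : ModelWithCorners ℝ (Euc d) (HalfSpace d) where
  toFun := Subtype.val
  invFun y := ⟨WithLp.toLp 2 fun i => if (i : ℕ) = 0 then max (y i) 0 else y i, by
    intro i hi; simp [hi]⟩
  source := univ
  target := halfSet d
  map_source' y _ := y.2
  map_target' _ _ := mem_univ _
  left_inv' y _ := by
    apply Subtype.ext
    ext i
    by_cases hi : (i : ℕ) = 0
    · simp [hi, y.2 i hi]
    · simp [hi]
  right_inv' y hy := by
    ext i
    by_cases hi : (i : ℕ) = 0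
    · simp [hi, hy i hi]
    · simp [hi]
  source_eq := rfl
  convex_range' := by
    simp only [instIsRCLikeNormedField, ↓reduceDIte]
    apply Convex.convex_isRCLikeNormedField
    change Convex ℝ (range (Subtype.val : halfSet d → Euc d))
    rw [Subtype.range_val]
    intro x hx y hy a b ha hb _ i hi
    have h1 := hx i hi
    have h2 := hy i hi
    simp only [PiLp.add_apply, PiLp.smul_apply, smul_eq_mul]
    positivity
  nonempty_interior' := by
    change (interior (range (Subtype.val : halfSet d → Euc d))).Nonempty
    rw [Subtype.range_val]
    refine ⟨WithLp.toLp 2 fun _ => 1, mem_interior.2 ⟨{y | ∀ i : Fin d, 0 < y i}, ?_, ?_, ?_⟩⟩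
    · exact fun y hy i _ => (hy i).le
    · simp only [ofPred_forall]
      exact isOpen_iInter_of_finite fun i => isOpen_lt continuous_const (by fun_prop)
    · intro i; simp
  continuous_toFun := continuous_subtype_val
  continuous_invFun := by
    refine Continuous.subtype_mk ((PiLp.continuous_toLp 2 _).comp (continuous_pi fun i => ?_)) _
    split_ifs
    · exact (PiLp.continuous_apply 2 _ i).max continuous_const
    · exact PiLp.continuous_apply 2 _ i

/-- The radial compactification of a real vector space `V`: the rays `[t, v]` of `ℝ × V` with
`t ≥ 0`.  A vector `v` of `V` is the ray `[1, v]`, and the rays `[0, v]` are the points at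
infinity. -/
@[ext]
structure HalfRay (V : Type*) [AddCommGroup V] [Module ℝ V] where
  ray : Module.Ray ℝ (ℝ × V)
  nonneg : ∃ (w : ℝ × V) (hw : w ≠ 0), rayOfNeZero ℝ w hw = ray ∧ 0 ≤ w.1

/-- The extension `[t, v] ↦ [t, e v]` of a linear isomorphism `e` to the radial
compactifications. -/
def HalfRay.map {V W : Type*} [AddCommGroup V] [Module ℝ V] [AddCommGroup W] [Module ℝ W]
    (e : V ≃ₗ[ℝ] W) (r : HalfRay V) : HalfRay W :=
  ⟨Module.Ray.map ((LinearEquiv.refl ℝ ℝ).prodCongr e) r.ray, by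
    obtain ⟨w, hw, hr, ht⟩ := r.2
    exact ⟨((LinearEquiv.refl ℝ ℝ).prodCongr e) w,
      ((LinearEquiv.refl ℝ ℝ).prodCongr e).map_ne_zero_iff.2 hw, by rw [← hr]; rfl, ht⟩⟩

variable {d : ℕ}

/-- The index set of the projective charts of the radial compactification: linear automorphisms
`w ↦ (ℓ(w), z(w))` of `ℝ × ℝᵈ` such that on `{ℓ > 0}` the condition `t(w) ≥ 0` is equivalent
to `z(w)/ℓ(w)` being in the half-space. -/
structure RayChart (d : ℕ) where
  equiv : (ℝ × Euc d) ≃L[ℝ] (ℝ × Euc d)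
  nonneg_iff : ∀ w, 0 < (equiv w).1 → (0 ≤ w.1 ↔ (equiv w).1⁻¹ • (equiv w).2 ∈ halfSet d)

theorem RayChart.ne_zero (B : RayChart d) (y : Euc d) : B.equiv.symm (1, y) ≠ 0 := by
  intro h
  have h' : ((1, y) : ℝ × Euc d) = 0 := (map_eq_zero_iff _ B.equiv.symm.injective).1 h
  exact one_ne_zero (congrArg Prod.fst h')

/-- The ray with projective coordinates `y`. -/
def rayParam (B : RayChart d) (y : HalfSpace d) : HalfRay (Euc d) :=
  ⟨rayOfNeZero ℝ (B.equiv.symm (1, y.1)) (B.ne_zero y.1), _, _, rfl, by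
    rw [B.nonneg_iff _ (by simp)]; simp⟩

/-- The vector `B' (1 ⊕ g) B⁻¹ (1, y)`, as a function of `(g, y)`. -/
def rayTransition (B B' : RayChart d) (p : (Euc d →L[ℝ] Euc d) × Euc d) : ℝ × Euc d :=
  B'.equiv ((B.equiv.symm (1, p.2)).1, p.1 (B.equiv.symm (1, p.2)).2)

theorem contDiff_rayTransition (B B' : RayChart d) : ContDiff ℝ ∞ (rayTransition B B') := by
  unfold rayTransition
  have h : ContDiff ℝ ∞ fun p : (Euc d →L[ℝ] Euc d) × Euc d => B.equiv.symm (1, p.2) :=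
    B.equiv.symm.contDiff.comp (contDiff_const.prodMk contDiff_snd)
  exact B'.equiv.contDiff.comp (h.fst.prodMk (contDiff_fst.clm_apply h.snd))

theorem map_rayParam_eq_iff (B B' : RayChart d) (g : Euc d ≃L[ℝ] Euc d) (y y' : HalfSpace d) :
    HalfRay.map g.toLinearEquiv (rayParam B y) = rayParam B' y' ↔
      0 < (rayTransition B B' ((g : Euc d →L[ℝ] Euc d), y.1)).1 ∧
        y'.1 = (rayTransition B B' ((g : Euc d →L[ℝ] Euc d), y.1)).1⁻¹ •
          (rayTransition B B' ((g : Euc d →L[ℝ] Euc d), y.1)).2 := by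
  set w := rayTransition B B' ((g : Euc d →L[ℝ] Euc d), y.1) with hw
  have key : HalfRay.map g.toLinearEquiv (rayParam B y) = rayParam B' y' ↔
      SameRay ℝ w (1, y'.1) := by
    rw [HalfRay.ext_iff]
    change Module.Ray.map _ (rayOfNeZero ℝ _ _) = rayOfNeZero ℝ _ _ ↔ _
    rw [Module.Ray.map_apply, ray_eq_iff, ← B'.equiv.toLinearEquiv.injective.sameRay_map_iff]
    have : B'.equiv.toLinearEquiv (B'.equiv.symm (1, y'.1)) = (1, y'.1) := B'.equiv.apply_symm_apply _
    rw [this]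
    rfl
  rw [key]
  constructor
  · intro h
    have h0 : w ≠ 0 := by
      intro h0
      have h1 : B'.equiv ((B.equiv.symm (1, y.1)).1, g (B.equiv.symm (1, y.1)).2) = 0 := h0
      rw [map_eq_zero_iff _ B'.equiv.injective] at h1
      have h2 := congrArg Prod.fst h1
      have h3 := congrArg Prod.snd h1
      simp only [Prod.fst_zero, Prod.snd_zero, map_eq_zero_iff _ g.injective] at h2 h3
      exact B.ne_zero y.1 (Prod.ext h2 h3)
    have h1 : ((1, y'.1) : ℝ × Euc d) ≠ 0 := fun h => one_ne_zero (congrArg Prod.fst h)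
    obtain ⟨c, hc, hcw⟩ := h.symm.exists_pos_left h1 h0
    have e1 : c = w.1 := by simpa using congrArg Prod.fst hcw
    have e2 : c • y'.1 = w.2 := congrArg Prod.snd hcw
    rw [← e1, ← e2, smul_smul, inv_mul_cancel₀ hc.ne', one_smul]
    exact ⟨hc, rfl⟩
  · rintro ⟨h1, h2⟩
    have : w = w.1 • ((1, y'.1) : ℝ × Euc d) := by
      refine Prod.ext (by simp) ?_
      rw [h2]
      simp [smul_smul, mul_inv_cancel₀ h1.ne']
    rw [this]
    exact SameRay.sameRay_pos_smul_left _ h1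

theorem rayParam_eq_of (B : RayChart d) (w : ℝ × Euc d) (hw : w ≠ 0) (ht : 0 ≤ w.1)
    (hl : 0 < (B.equiv w).1) :
    rayParam B ⟨(B.equiv w).1⁻¹ • (B.equiv w).2, (B.nonneg_iff w hl).1 ht⟩ =
      ⟨rayOfNeZero ℝ w hw, w, hw, rfl, ht⟩ := by
  apply HalfRay.ext
  change rayOfNeZero ℝ _ _ = rayOfNeZero ℝ _ _
  rw [ray_eq_iff]
  have : w = (B.equiv w).1 • B.equiv.symm (1, (B.equiv w).1⁻¹ • (B.equiv w).2) := by
    rw [← map_smul, ContinuousLinearEquiv.eq_symm_apply]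
    refine Prod.ext (by simp) ?_
    simp [smul_smul, mul_inv_cancel₀ hl.ne']
  have h2 := SameRay.sameRay_pos_smul_right (R := ℝ) (B.equiv.symm (1, (B.equiv w).1⁻¹ • (B.equiv w).2)) hl
  rwa [← this] at h2

/-- Every vector `(t, v) ≠ 0` with `t ≥ 0` is in the domain of a projective chart. -/
theorem exists_rayChart (w : ℝ × Euc d) (hw : w ≠ 0) (ht : 0 ≤ w.1) :
    ∃ B : RayChart d, 0 < (B.equiv w).1 := by
  rcases Nat.eq_zero_or_pos d with hd | hd
  · subst hd
    refine ⟨⟨ContinuousLinearEquiv.refl ℝ _, fun w hw => ⟨fun _ i => i.elim0, fun _ => hw.le⟩⟩, ?_⟩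
    refine lt_of_le_of_ne ht fun h => hw (Prod.ext h.symm (Subsingleton.elim _ _))
  · let z : Fin d := ⟨0, hd⟩
    obtain ⟨i, s, hs, hp⟩ : ∃ (i : Fin d) (s : ℝ), s ≠ 0 ∧ 0 < s * w.2 i + w.1 := by
      rcases ht.lt_or_eq with h | h
      · rcases le_total 0 (w.2 z) with h' | h'
        · exact ⟨z, 1, one_ne_zero, by linarith⟩
        · exact ⟨z, -1, by norm_num, by linarith⟩
      · have : ∃ i, w.2 i ≠ 0 := by
          by_contra! hc
          exact hw (Prod.ext h.symm (by ext i; exact hc i))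
        obtain ⟨i, hi⟩ := this
        exact ⟨i, w.2 i, hi, by rw [← h, add_zero]; exact mul_self_pos.2 hi⟩
    let f : (ℝ × Euc d) →ₗ[ℝ] (ℝ × Euc d) :=
      { toFun := fun w => (s * w.2 i + w.1,
          WithLp.toLp 2 fun j => if Equiv.swap z i j = i then w.1 else w.2 (Equiv.swap z i j))
        map_add' := by
          intro a b
          refine Prod.ext (by simp; ring) ?_
          ext j
          by_cases h : Equiv.swap z i j = i <;> simp [h]
        map_smul' := by
          intro c a
          refine Prod.ext (by simp; ring) ?_
          ext j
          by_cases h : Equiv.swap z i j = i <;> simp [h] }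
    have hf : Injective f := by
      rw [injective_iff_map_eq_zero]
      intro a ha
      have h1 : s * a.2 i + a.1 = 0 := congrArg Prod.fst ha
      have h2 : ∀ j, (if Equiv.swap z i j = i then a.1 else a.2 (Equiv.swap z i j)) = 0 :=
        fun j => congrArg (fun q : ℝ × Euc d => q.2 j) ha
      have h3 : a.1 = 0 := by simpa using h2 z
      have h4 : a.2 i = 0 := by
        rw [h3, add_zero] at h1
        exact (mul_eq_zero.1 h1).resolve_left hs
      refine Prod.ext h3 ?_
      ext j
      by_cases hj : j = i
      · rw [hj]; exact h4
      · have := h2 (Equiv.swap z i j)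
        simpa [hj] using this
    let B := (LinearEquiv.ofInjectiveEndo f hf).toContinuousLinearEquiv
    have hB : ∀ v, B v = f v := fun v => rfl
    refine ⟨⟨B, fun v hv => ?_⟩, ?_⟩
    · have h0 : ∀ j : Fin d, (j : ℕ) = 0 → ((B v).1⁻¹ • (B v).2) j = (B v).1⁻¹ * v.1 := by
        intro j hj
        have : j = z := Fin.ext hj
        subst this
        simp [hB, f]
      constructor
      · intro h j hj
        rw [h0 j hj]
        positivity
      · intro h
        have := h z rfl
        rw [h0 z rfl] at this
        exact (mul_nonneg_iff_of_pos_left (inv_pos.2 hv)).1 this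
    · exact hp

/-- The radial compactification of `ℝᵈ` with its smooth structure of a manifold with boundary
and the action of `GL(d)`. -/
def rayFibre (d : ℕ) :
    LinearFibre (Euc d) (HalfRay (Euc d)) (RayChart d) (HalfSpace d) (Euc d) (halfModel d) where
  act g := HalfRay.map g.toLinearEquiv
  act_refl r := by
    obtain ⟨_, w, hw, rfl, ht⟩ := r
    rfl
  act_trans g h r := by
    obtain ⟨_, w, hw, rfl, ht⟩ := r
    rfl
  param := rayParam
  injective B y y' h := by
    have h0 : HalfRay.map (ContinuousLinearEquiv.refl ℝ (Euc d)).toLinearEquiv (rayParam B y) =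
      rayParam B y := rfl
    have h1 := (map_rayParam_eq_iff B B (ContinuousLinearEquiv.refl ℝ _) y y').1 (h0.trans h)
    have h2 : rayTransition B B
        (((ContinuousLinearEquiv.refl ℝ (Euc d)) : Euc d →L[ℝ] Euc d), y.1) = (1, y.1) :=
      B.equiv.apply_symm_apply _
    rw [h2] at h1
    apply Subtype.ext
    simpa using h1.2.symm
  covers r := by
    obtain ⟨_, w, hw, rfl, ht⟩ := r
    obtain ⟨B, hB⟩ := exists_rayChart w hw ht
    exact ⟨B, _, rayParam_eq_of B w hw ht hB⟩
  dom B B' := {p | 0 < (rayTransition B B' p).1}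
  isOpen_dom B B' := isOpen_lt continuous_const (contDiff_rayTransition B B').continuous.fst
  trans B B' p := (rayTransition B B' p).1⁻¹ • (rayTransition B B' p).2
  contDiffOn_trans B B' := by
    have h := contDiff_rayTransition B B'
    exact (h.fst.contDiffOn.inv fun p hp => (ne_of_gt hp)).smul h.snd.contDiffOn
  mem_dom B B' g y := by
    constructor
    · rintro ⟨y', h⟩
      exact ((map_rayParam_eq_iff B B' g y y').1 h).1
    · intro h
      have hpos : 0 ≤ (B.equiv.symm (1, y.1)).1 := by
        rw [B.nonneg_iff _ (by simp)]; simp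
      exact ⟨⟨_, (B'.nonneg_iff ((B.equiv.symm (1, y.1)).1, g (B.equiv.symm (1, y.1)).2) h).1 hpos⟩,
        (map_rayParam_eq_iff B B' g y _).2 ⟨h, rfl⟩⟩
  trans_eq B B' g y y' h := ((map_rayParam_eq_iff B B' g y y').1 h).2

end Rays

section Bundles

/-- The Grassmann bundle of a `d`-dimensional manifold `M`: pairs `(x, S)` of a point `x` of `M` and
a `k`-dimensional subspace `S` of the tangent space at `x`. -/
def GrassmannBundle (k d : ℕ) (M : Type*) [TopologicalSpace M] [ChartedSpace (Euc d) M] :=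
  Σ x : M, Gr k (TangentSpace (𝓡 d) x)

/-- The fibre-radial compactification of the tangent bundle of a `d`-dimensional manifold `M`. -/
def CompactifiedTangentBundle (d : ℕ) (M : Type*) [TopologicalSpace M] [ChartedSpace (Euc d) M] :=
  Σ x : M, HalfRay (TangentSpace (𝓡 d) x)

/-- The model with corners of the Grassmann bundle (without boundary). -/
abbrev grassmannModel (k d : ℕ) := (𝓡 d).prod 𝓘(ℝ, Euc k →L[ℝ] Euc (d - k))

/-- The model with corners of the compactified tangent bundle (with boundary). -/
abbrev compactifiedModel (d : ℕ) := (𝓡 d).prod (halfModel d)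

variable (k d : ℕ) (M : Type*) [TopologicalSpace M] [ChartedSpace (Euc d) M]
  [IsManifold (𝓡 d) ∞ M]

instance : TopologicalSpace (GrassmannBundle k d M) :=
  ((grassmannFibre k d).core (𝓡 d) (M := M)).toTopologicalSpace

instance : ChartedSpace (ModelProd (Euc d) (Euc k →L[ℝ] Euc (d - k))) (GrassmannBundle k d M) :=
  ((grassmannFibre k d).core (𝓡 d) (M := M)).toChartedSpace

instance : IsManifold (grassmannModel k d) ∞ (GrassmannBundle k d M) :=
  (grassmannFibre k d).isManifold_core (𝓡 d) (M := M)

instance : TopologicalSpace (CompactifiedTangentBundle d M) :=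
  ((rayFibre d).core (𝓡 d) (M := M)).toTopologicalSpace

instance : ChartedSpace (ModelProd (Euc d) (HalfSpace d)) (CompactifiedTangentBundle d M) :=
  ((rayFibre d).core (𝓡 d) (M := M)).toChartedSpace

instance : IsManifold (compactifiedModel d) ∞ (CompactifiedTangentBundle d M) :=
  (rayFibre d).isManifold_core (𝓡 d) (M := M)

end Bundles

section Riemannian

variable {E H : Type*} [NormedAddCommGroup E] [NormedSpace ℝ E] [TopologicalSpace H]

/-- A smooth Riemannian metric on a smooth manifold (smooth up to the boundary, if there is one). -/
abbrev SmoothMetric (I : ModelWithCorners ℝ E H) (M : Type*) [TopologicalSpace M]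
    [ChartedSpace H M] [IsManifold I ∞ M] :=
  ContMDiffRiemannianMetric I ∞ E (TangentSpace I : M → Type _)

variable {I : ModelWithCorners ℝ E H} {M : Type*} [TopologicalSpace M] [ChartedSpace H M]
  [IsManifold I ∞ M]

/-- The length of a tangent vector. -/
def SmoothMetric.norm (g : SmoothMetric I M) {x : M} (v : TangentSpace I x) : ℝ :=
  √(g.inner x v v)

/-- The Riemannian distance, that is, the infimum of the lengths of `C¹` paths (infinite between
points of different components). -/
def SmoothMetric.dist (g : SmoothMetric I M) (x y : M) : ℝ≥0∞ :=
  letI : RiemannianBundle (fun x : M => TangentSpace I x) := ⟨g.toRiemannianMetric⟩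
  Manifold.riemannianEDist I x y

end Riemannian

section Dynamics

variable {d : ℕ} {M : Type*} [TopologicalSpace M] [ChartedSpace (Euc d) M]
  [IsManifold (𝓡 d) ∞ M]

/-- The diffeomorphism `φ` is hyperbolic on the compact invariant set `K`, with the splitting
`T_x M = E_u(x) ⊕ E_s(x)` into spaces of dimensions `du` and `ds` and contraction rate `lam`. -/
structure IsHyperbolicOn {n : ℕ∞ω} (φ : M ≃ₘ^n⟮𝓡 d, 𝓡 d⟯ M) (K : Set M) (du ds : ℕ)
    (Eu Es : ∀ x : M, Submodule ℝ (TangentSpace (𝓡 d) x)) (lam : ℝ) : Prop where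
  isCompact : IsCompact K
  image_eq : φ '' K = K
  finrank_unstable : ∀ x ∈ K, Module.finrank ℝ (Eu x) = du
  finrank_stable : ∀ x ∈ K, Module.finrank ℝ (Es x) = ds
  isCompl : ∀ x ∈ K, IsCompl (Eu x) (Es x)
  map_unstable : ∀ x ∈ K,
    (Eu x).map (mfderiv (𝓡 d) (𝓡 d) φ x).toLinearMap = Eu (φ x)
  map_stable : ∀ x ∈ K,
    (Es x).map (mfderiv (𝓡 d) (𝓡 d) φ x).toLinearMap = Es (φ x)
  lam_pos : 0 < lam
  lam_lt_one : lam < 1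
  contraction : ∃ (g : SmoothMetric (𝓡 d) M) (C : ℝ), 0 < C ∧
    (∀ x ∈ K, ∀ v ∈ Eu x, ∀ m : ℕ,
      g.norm (mfderiv (𝓡 d) (𝓡 d) φ.symm^[m] x v) ≤ C * lam ^ m * g.norm v) ∧
    (∀ x ∈ K, ∀ v ∈ Es x, ∀ m : ℕ,
      g.norm (mfderiv (𝓡 d) (𝓡 d) φ^[m] x v) ≤ C * lam ^ m * g.norm v)

/-- The map `K → 𝒢_u`, `x ↦ (x, E_u(x))`. -/
def IsHyperbolicOn.unstable {n : ℕ∞ω} {φ : M ≃ₘ^n⟮𝓡 d, 𝓡 d⟯ M} {K : Set M} {du ds : ℕ}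
    {Eu Es : ∀ x : M, Submodule ℝ (TangentSpace (𝓡 d) x)} {lam : ℝ}
    (h : IsHyperbolicOn φ K du ds Eu Es lam) (x : K) : GrassmannBundle du d M :=
  ⟨x, ⟨Eu x, h.finrank_unstable x x.2⟩⟩

/-- The map `K → 𝒢_s`, `x ↦ (x, E_s(x))`. -/
def IsHyperbolicOn.stable {n : ℕ∞ω} {φ : M ≃ₘ^n⟮𝓡 d, 𝓡 d⟯ M} {K : Set M} {du ds : ℕ}
    {Eu Es : ∀ x : M, Submodule ℝ (TangentSpace (𝓡 d) x)} {lam : ℝ}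
    (h : IsHyperbolicOn φ K du ds Eu Es lam) (x : K) : GrassmannBundle ds d M :=
  ⟨x, ⟨Es x, h.finrank_stable x x.2⟩⟩

/-- A map `f` from a subset `K` of `M` to the Grassmann bundle is Hölder continuous with exponent
`γ` for the Riemannian distances of `g` and `gG`. -/
def IsHolder {k : ℕ} (g : SmoothMetric (𝓡 d) M)
    (gG : SmoothMetric (grassmannModel k d) (GrassmannBundle k d M))
    {K : Set M} (f : K → GrassmannBundle k d M) (γ : ℝ) : Prop :=
  ∃ C : ℝ≥0, ∀ x y : K, gG.dist (f x) (f y) ≤ C * g.dist (x : M) (y : M) ^ γ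

/-- The action `(x, [t, v]) ↦ (φ(x), [t, dφ(x) v])` of the differential of a diffeomorphism on the
fibre-radial compactification of the tangent bundle. -/
def extendedDifferential {n : ℕ∞ω} (hn : n ≠ 0) (φ : M ≃ₘ^n⟮𝓡 d, 𝓡 d⟯ M)
    (p : CompactifiedTangentBundle d M) : CompactifiedTangentBundle d M :=
  ⟨φ p.1, HalfRay.map (φ.mfderivToContinuousLinearEquiv hn p.1).toLinearEquiv p.2⟩

/-- `Lam` is a Lipschitz constant for the action of the differential of `φ` on the part over `K` of
the fibre-radial compactification of the tangent bundle. -/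
def IsLipschitzOver {n : ℕ∞ω} (hn : n ≠ 0) (φ : M ≃ₘ^n⟮𝓡 d, 𝓡 d⟯ M) (K : Set M)
    (gT : SmoothMetric (compactifiedModel d) (CompactifiedTangentBundle d M))
    (Lam : ℝ) : Prop :=
  ∀ p q : CompactifiedTangentBundle d M, p.1 ∈ K → q.1 ∈ K →
    gT.dist (extendedDifferential hn φ p) (extendedDifferential hn φ q) ≤
      ENNReal.ofReal Lam * gT.dist p q

/-- The exponent `-2 log λ / log (Λ / λ)`. -/
def holderExponent (lam Lam : ℝ) : ℝ := -(2 * Real.log lam) / Real.log (Lam / lam)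

end Dynamics

end HyperbolicHolder

end

open HyperbolicHolder

/-! Stable vectors at nearby points are compared by running the dynamics for as long as the
Lipschitz constant Λ leaves it under control. Let x, y in K be at chart distance ρ, let u be a unit
vector of E_s(x), and let v' be the vector at y with the same coordinates in a common frame. The
points [1,u] and [1,v'] of the compactification are at distance O(ρ), so their m-th images are at
distance O(Λ^m ρ). As long as (Λ/λ)^m ρ stays small this is O(λ^m), which is also the size of dφ^m
u; hence dφ^m v' = O(λ^m). Split v' = a + b with a in E_u(y) and b in E_s(y). Since dφ^m b = O(λ^m
(1+|a|)), the same holds for dφ^m a, and expansion along E_u gives |a| = O(λ^(2m) (1+|a|)). Once m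
is large enough to absorb the last |a|, the stable vector b is within O(λ^(2m)) of u; for smaller m
the bound is trivial. The largest admissible m makes λ^(2m) comparable to ρ^γ, because (Λ/λ)^(-γ) =
λ². This is `IsHyperbolicOn.exists_mem_stable_close`.

A constant Λ exists (`exists_isLipschitzOver`) because the extended differential of a C² map is
locally Lipschitz and the part of the compactification over K is compact, its fibres being closed
half-spheres.

The passage from approximation of vectors to the distance of the Grassmann bundle
(`isHolder_planeSection`) writes nearby planes as graphs of linear maps. The section also records
its base point, so an exponent γ ≤ 1 is needed, that is λΛ ≥ 1; `IsHyperbolicOn.one_le_mul` derives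
this from the dynamics. Riemannian distances may be infinite, so local bounds are globalized by
compactness together with the fact that finite distance in the base implies finite distance in the
bundle (`GrassmannBundle.dist_lt_top`).

The unstable statement is the stable one for the inverse diffeomorphism. -/

noncomputable section

namespace HyperbolicHolder

open Filter Topology MeasureTheory

/-! ### Extended charts are locally bi-Lipschitz for the Riemannian distance. -/

section RiemannianDistance

open Manifold Metric

variable {E : Type*} [NormedAddCommGroup E] [NormedSpace ℝ E]
  {H : Type*} [TopologicalSpace H] (I : ModelWithCorners ℝ E H)
  {M : Type*} [TopologicalSpace M] [ChartedSpace H M]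
  [RiemannianBundle (fun (x : M) ↦ TangentSpace I x)]
  [IsManifold I 1 M] [IsContinuousRiemannianBundle E (fun (x : M) ↦ TangentSpace I x)]

theorem eventually_enorm_mfderivWithin_symm_extChartAt_apply_le (x : M) :
    ∃ C : ℝ≥0, ∀ᶠ y in 𝓝[range I] (extChartAt I x x), ∀ v : E,
      ‖mfderiv[range I] (extChartAt I x).symm y v‖ₑ ≤ C * ‖v‖ₑ := by
  obtain ⟨C, -, hC⟩ := eventually_enorm_mfderivWithin_symm_extChartAt_lt I x
  refine ⟨C, ?_⟩
  filter_upwards [hC] with y hy v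
  let : NormedAddCommGroup (TangentSpace 𝓘(ℝ, E) y) := normedAddCommGroupTangentSpaceVectorSpace y
  let : NormedSpace ℝ (TangentSpace 𝓘(ℝ, E) y) := normedSpaceTangentSpaceVectorSpace y
  refine (ContinuousLinearMap.le_opENorm _ _).trans ?_
  exact mul_le_mul' hy.le le_rfl

theorem eventually_enorm_mfderiv_extChartAt_apply_le (x : M) :
    ∃ C : ℝ≥0, ∀ᶠ y in 𝓝 x, ∀ v : TangentSpace I y,
      enorm (E := E) (mfderiv% (extChartAt I x) y v) ≤ C * ‖v‖ₑ := by
  obtain ⟨C, -, hC⟩ := eventually_enorm_mfderiv_extChartAt_lt I x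
  refine ⟨C, ?_⟩
  filter_upwards [hC] with y hy v
  let := normedAddCommGroupTangentSpaceVectorSpace (extChartAt I x y)
  let := normedSpaceTangentSpaceVectorSpace (extChartAt I x y)
  refine (ContinuousLinearMap.le_opENorm _ _).trans ?_
  exact mul_le_mul' hy.le le_rfl

/-- The inverse of an extended chart is locally Lipschitz for the Riemannian distance. -/
theorem eventually_riemannianEDist_le_edist_extChartAt_two (x : M) :
    ∃ C : ℝ≥0, ∀ᶠ p in 𝓝 x ×ˢ 𝓝 x,
      riemannianEDist I p.1 p.2 ≤ C * edist (extChartAt I x p.1) (extChartAt I x p.2) := by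
  obtain ⟨C, hC⟩ := eventually_enorm_mfderivWithin_symm_extChartAt_apply_le I x
  refine ⟨C, ?_⟩
  obtain ⟨r, r_pos, hr⟩ : ∃ r > 0,
      ball (extChartAt I x x) r ∩ range I ⊆ (extChartAt I x).target ∩
        {y | ∀ v : E, ‖mfderiv[range I] (extChartAt I x).symm y v‖ₑ ≤ C * ‖v‖ₑ} :=
    mem_nhdsWithin_iff.1 (inter_mem (extChartAt_target_mem_nhdsWithin x) hC)
  have A : (extChartAt I x) ⁻¹' (ball (extChartAt I x x) r ∩ range I) ∈ 𝓝 x := by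
    apply extChartAt_preimage_mem_nhds_of_mem_nhdsWithin (by simp)
    rw [inter_comm]
    exact inter_mem_nhdsWithin _ (ball_mem_nhds _ r_pos)
  have A' := inter_mem A (chart_source_mem_nhds H x)
  filter_upwards [prod_mem_prod A' A'] with ⟨z, y⟩ ⟨⟨hz, h'z⟩, ⟨hy, h'y⟩⟩
  dsimp only at hz h'z hy h'y ⊢
  -- The competitor is a straight segment in the chart; convexity of the range of the model keeps it
  -- inside the manifold even at the boundary.
  let η := ContinuousAffineMap.lineMap (R := ℝ) (extChartAt I x z) (extChartAt I x y)
  set γ := (extChartAt I x).symm ∘ η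
  have hη : Icc 0 1 ⊆ ⇑η ⁻¹' ((extChartAt I x).target ∩
        {y | ∀ v : E, ‖mfderiv[range I] (extChartAt I x).symm y v‖ₑ ≤ C * ‖v‖ₑ}) := by
    simp only [← image_subset_iff, ContinuousAffineMap.coe_lineMap_eq,
     ← segment_eq_image_lineMap, η]
    apply Subset.trans _ hr
    exact ((convex_ball _ _).inter I.convex_range).segment_subset hz hy
  simp only [preimage_inter, subset_inter_iff] at hη
  have η_smooth : CMDiff[Icc 0 1] 1 η := by
    apply ContMDiff.contMDiffOn
    rw [contMDiff_iff_contDiff]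
    exact ContinuousAffineMap.contDiff _
  have : riemannianEDist I z y ≤ pathELength I γ 0 1 := by
    apply riemannianEDist_le_pathELength _ _ _ zero_le_one
    · exact (contMDiffOn_extChartAt_symm x).comp η_smooth hη.1
    · simp [γ, η, ContinuousAffineMap.coe_lineMap_eq, h'z]
    · simp [γ, η, ContinuousAffineMap.coe_lineMap_eq, h'y]
  apply this.trans
  rw [← lintegral_fderiv_lineMap_eq_edist, pathELength_eq_lintegral_mfderivWithin_Icc,
    ← lintegral_const_mul' _ _ ENNReal.coe_ne_top]
  apply setLIntegral_mono' measurableSet_Icc (fun t ht ↦ ?_)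
  have : mfderiv[Icc 0 1] γ t =
      (mfderiv[range I] (extChartAt I x).symm (η t)) ∘L (mfderiv[Icc 0 1] η t) := by
    apply mfderivWithin_comp
    · exact mdifferentiableWithinAt_extChartAt_symm (hη.1 ht)
    · exact η_smooth.mdifferentiableOn one_ne_zero t ht
    · exact hη.1.trans (preimage_mono (extChartAt_target_subset_range x))
    · rw [uniqueMDiffWithinAt_iff_uniqueDiffWithinAt]
      exact uniqueDiffOn_Icc zero_lt_one t ht
  have : mfderiv[Icc 0 1] γ t 1 =
      (mfderiv[range I] (extChartAt I x).symm (η t)) (mfderiv[Icc 0 1] η t 1) := congr($this 1)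
  rw [this]
  refine (hη.2 ht _).trans (le_of_eq ?_)
  simp only [mfderivWithin_eq_fderivWithin]
  rfl

/-- An extended chart is locally Lipschitz for the Riemannian distance. -/
theorem eventually_edist_extChartAt_le_riemannianEDist_two [RegularSpace M] (x : M) :
    ∃ C : ℝ≥0, ∀ᶠ p in 𝓝 x ×ˢ 𝓝 x,
      edist (extChartAt I x p.1) (extChartAt I x p.2) ≤ C * riemannianEDist I p.1 p.2 := by
  obtain ⟨C, hC⟩ := eventually_enorm_mfderiv_extChartAt_apply_le I x
  refine ⟨C, ?_⟩
  obtain ⟨c, c_pos, hc⟩ := setOfPred_riemannianEDist_lt_subset_nhds I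
    (inter_mem hC (chart_source_mem_nhds H x))
  have c3 : (0 : ℝ≥0∞) < (c / 2 : ℝ≥0) := by
    exact_mod_cast half_pos c_pos
  have A := eventually_riemannianEDist_lt I x (ENNReal.half_pos c3.ne')
  have A0 := eventually_riemannianEDist_lt I x c3
  -- Both points lie within c/4 of x, hence within c/2 of each other; a curve from z of length below
  -- c/2 then stays in the c-ball, where the derivative bound and the chart are available.
  filter_upwards [prod_mem_prod A A] with ⟨z, y⟩ ⟨hz, hy⟩
  dsimp only [mem_ofPred_eq] at hz hy ⊢
  have hzy : riemannianEDist I z y < (c / 2 : ℝ≥0) := by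
    refine riemannianEDist_triangle.trans_lt
      ((ENNReal.add_lt_add (a := riemannianEDist I z x) ?_ hy).trans_eq (ENNReal.add_halves _))
    rwa [riemannianEDist_comm]
  have key : ∀ ρ : ℝ≥0∞, riemannianEDist I z y < ρ →
      edist (extChartAt I x z) (extChartAt I x y) ≤ C * ρ := by
    intro ρ hρ
    obtain ⟨γ, hγz, hγy, hγ, hl, -⟩ :=
      exists_lt_locally_constant_of_riemannianEDist_lt (lt_min hρ hzy) zero_lt_one
    have hl1 := hl.trans_le (min_le_left _ _)
    have hl2 := hl.trans_le (min_le_right _ _)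
    have hmem : ∀ t ∈ Icc (0 : ℝ) 1, γ t ∈ {y | ∀ v : TangentSpace I y,
        enorm (E := E) (mfderiv% (extChartAt I x) y v) ≤ C * ‖v‖ₑ} ∩ (chartAt H x).source := by
      intro t ht
      apply hc
      have h1 : riemannianEDist I z (γ t) < (c / 2 : ℝ≥0) := by
        refine (riemannianEDist_le_pathELength hγ.contMDiffOn hγz rfl ht.1).trans_lt ?_
        exact (pathELength_mono le_rfl ht.2).trans_lt hl2
      refine (riemannianEDist_triangle (y := z)).trans_lt ?_
      refine (ENNReal.add_lt_add (hz.trans_le ENNReal.half_le_self) h1).trans_eq ?_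
      exact_mod_cast add_halves c
    let γ' := extChartAt I x ∘ γ
    have hC' : CMDiff[Icc 0 1] 1 γ' :=
      contMDiffOn_extChartAt.comp (I' := I) (t := (chartAt H x).source)
        hγ.contMDiffOn (fun t' ht' ↦ (hmem t' ht').2)
    rw [edist_comm, edist_eq_enorm_sub]
    calc
      ‖extChartAt I x y - extChartAt I x z‖ₑ = ‖γ' 1 - γ' 0‖ₑ := by simp [γ', hγz, hγy]
      _ ≤ ∫⁻ t' in Icc 0 1, ‖derivWithin γ' (Icc 0 1) t'‖ₑ := by
        apply enorm_sub_le_lintegral_derivWithin_Icc_of_contDiffOn_Icc _ zero_le_one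
        rwa [← contMDiffOn_iff_contDiffOn]
      _ = ∫⁻ t' in Icc 0 1, enorm (E := E) (mfderiv[Icc 0 1] γ' t' 1) := by
        simp_rw [← fderivWithin_derivWithin, mfderivWithin_eq_fderivWithin]
        rfl
      _ ≤ ∫⁻ t' in Icc 0 1, C * ‖mfderiv[Icc 0 1] γ t' 1‖ₑ := by
        apply setLIntegral_mono' measurableSet_Icc (fun t' ht' ↦ ?_)
        have : mfderiv[Icc 0 1] γ' t' =
            (mfderiv% (extChartAt I x) (γ t')) ∘L (mfderiv[Icc 0 1] γ t') := by
          apply mfderiv_comp_mfderivWithin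
          · exact mdifferentiableAt_extChartAt (hmem t' ht').2
          · exact (hγ.mdifferentiable one_ne_zero).mdifferentiableOn _ ht'
          · rw [uniqueMDiffWithinAt_iff_uniqueDiffWithinAt]
            exact uniqueDiffOn_Icc zero_lt_one _ ht'
        have : mfderiv[Icc 0 1] γ' t' 1 =
            (mfderiv% (extChartAt I x) (γ t')) (mfderiv[Icc 0 1] γ t' 1) :=
          congr($this 1)
        rw [this]
        exact (hmem t' ht').1 _
      _ = C * pathELength I γ 0 1 := by
        rw [lintegral_const_mul' _ _ ENNReal.coe_ne_top,
            pathELength_eq_lintegral_mfderivWithin_Icc]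
      _ ≤ C * ρ := by gcongr
  -- The distance is an infimum of lengths, so `key` is applied with an excess ε/(C+1); the +1
  -- covers C = 0.
  refine ENNReal.le_of_forall_pos_le_add fun ε hε _ => ?_
  have hpos : (0 : ℝ≥0∞) < ε / (C + 1) := ENNReal.div_pos (by simpa using hε.ne') (by finiteness)
  refine (key _ (ENNReal.lt_add_right (hzy.trans ENNReal.coe_lt_top).ne hpos.ne')).trans ?_
  rw [mul_add]
  gcongr
  calc (C : ℝ≥0∞) * (ε / (C + 1)) ≤ (C + 1) * (ε / (C + 1)) := by gcongr; exact le_self_add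
    _ = ε := ENNReal.mul_div_cancel (by simp) (by finiteness)

/-- Points of a curve have finite Riemannian distance. -/
theorem riemannianEDist_lt_top_of_continuous {X : Type*} [TopologicalSpace X] [PreconnectedSpace X]
    {γ : X → M} (hγ : Continuous γ) (a b : X) : riemannianEDist I (γ a) (γ b) < ⊤ := by
  have hs : Std.Symm (fun a b => riemannianEDist I (γ a) (γ b) < ⊤) :=
    ⟨fun x y hxy => by rwa [riemannianEDist_comm]⟩
  refine PreconnectedSpace.induction₂ (fun a b => riemannianEDist I (γ a) (γ b) < ⊤) ?_ ?_ a b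
  · exact fun x => hγ.continuousAt.eventually
      (eventually_riemannianEDist_lt I (γ x) ENNReal.zero_lt_top)
  · exact ⟨fun x y z hxy hyz =>
      riemannianEDist_triangle.trans_lt (ENNReal.add_lt_top.2 ⟨hxy, hyz⟩)⟩

end RiemannianDistance
end HyperbolicHolder

namespace HyperbolicHolder

open Filter Topology MeasureTheory

/-! ### Distance and norm of a smooth metric. -/

namespace SmoothMetric

open Manifold

variable {E : Type*} [NormedAddCommGroup E] [NormedSpace ℝ E]
  {H : Type*} [TopologicalSpace H] {I : ModelWithCorners ℝ E H}
  {M : Type*} [TopologicalSpace M] [ChartedSpace H M] [IsManifold I ∞ M]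
  (g : SmoothMetric I M)

theorem isContinuousRiemannianBundle :
    letI : RiemannianBundle (fun x : M => TangentSpace I x) := ⟨g.toRiemannianMetric⟩
    IsContinuousRiemannianBundle E (fun x : M => TangentSpace I x) :=
  letI : RiemannianBundle (fun x : M => TangentSpace I x) := ⟨g.toRiemannianMetric⟩
  ⟨⟨g.inner, g.contMDiff.continuous, fun _ _ _ ↦ rfl⟩⟩

theorem dist_comm (x y : M) : g.dist x y = g.dist y x := by
  let : RiemannianBundle (fun x : M => TangentSpace I x) := ⟨g.toRiemannianMetric⟩
  exact riemannianEDist_comm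

theorem dist_triangle (x y z : M) : g.dist x z ≤ g.dist x y + g.dist y z := by
  let : RiemannianBundle (fun x : M => TangentSpace I x) := ⟨g.toRiemannianMetric⟩
  exact riemannianEDist_triangle

theorem eventually_dist_le (x : M) : ∃ C : ℝ≥0, ∀ᶠ p in 𝓝 x ×ˢ 𝓝 x,
    g.dist p.1 p.2 ≤ C * edist (extChartAt I x p.1) (extChartAt I x p.2) := by
  let : RiemannianBundle (fun x : M => TangentSpace I x) := ⟨g.toRiemannianMetric⟩
  have := IsManifold.of_le (I := I) (M := M) (m := 1) (n := ∞) (by simp)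
  have : IsContinuousRiemannianBundle E (fun x : M => TangentSpace I x) :=
    g.isContinuousRiemannianBundle
  exact eventually_riemannianEDist_le_edist_extChartAt_two I x

theorem eventually_edist_extChartAt_le [RegularSpace M] (x : M) :
    ∃ C : ℝ≥0, ∀ᶠ p in 𝓝 x ×ˢ 𝓝 x,
      edist (extChartAt I x p.1) (extChartAt I x p.2) ≤ C * g.dist p.1 p.2 := by
  let : RiemannianBundle (fun x : M => TangentSpace I x) := ⟨g.toRiemannianMetric⟩
  have := IsManifold.of_le (I := I) (M := M) (m := 1) (n := ∞) (by simp)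
  have : IsContinuousRiemannianBundle E (fun x : M => TangentSpace I x) :=
    g.isContinuousRiemannianBundle
  exact eventually_edist_extChartAt_le_riemannianEDist_two I x

theorem eventually_dist_lt (x : M) {c : ℝ≥0∞} (hc : 0 < c) : ∀ᶠ y in 𝓝 x, g.dist x y < c := by
  let : RiemannianBundle (fun x : M => TangentSpace I x) := ⟨g.toRiemannianMetric⟩
  have := IsManifold.of_le (I := I) (M := M) (m := 1) (n := ∞) (by simp)
  have : IsContinuousRiemannianBundle E (fun x : M => TangentSpace I x) :=
    g.isContinuousRiemannianBundle
  exact eventually_riemannianEDist_lt I x hc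

theorem dist_lt_top_of_continuous {X : Type*} [TopologicalSpace X] [PreconnectedSpace X]
    {γ : X → M} (hγ : Continuous γ) (a b : X) : g.dist (γ a) (γ b) < ⊤ := by
  let : RiemannianBundle (fun x : M => TangentSpace I x) := ⟨g.toRiemannianMetric⟩
  have := IsManifold.of_le (I := I) (M := M) (m := 1) (n := ∞) (by simp)
  have : IsContinuousRiemannianBundle E (fun x : M => TangentSpace I x) :=
    g.isContinuousRiemannianBundle
  exact riemannianEDist_lt_top_of_continuous I hγ a b

theorem exists_continuous_of_dist_lt_top {x y : M} (h : g.dist x y < ⊤) :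
    ∃ γ : ℝ → M, Continuous γ ∧ γ 0 = x ∧ γ 1 = y := by
  let : RiemannianBundle (fun x : M => TangentSpace I x) := ⟨g.toRiemannianMetric⟩
  have := IsManifold.of_le (I := I) (M := M) (m := 1) (n := ∞) (by simp)
  have : IsContinuousRiemannianBundle E (fun x : M => TangentSpace I x) :=
    g.isContinuousRiemannianBundle
  obtain ⟨γ, h0, h1, hγ, -⟩ := exists_lt_locally_constant_of_riemannianEDist_lt h zero_lt_one
  exact ⟨γ, hγ.continuous, h0, h1⟩

/-- The Riemannian distance as an extended pseudometric inducing the manifold topology. -/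
@[reducible] def pseudoEMetricSpace [RegularSpace M] : PseudoEMetricSpace M :=
  letI : RiemannianBundle (fun x : M => TangentSpace I x) := ⟨g.toRiemannianMetric⟩
  haveI := IsManifold.of_le (I := I) (M := M) (m := 1) (n := ∞) (by simp)
  haveI : IsContinuousRiemannianBundle E (fun x : M => TangentSpace I x) :=
    g.isContinuousRiemannianBundle
  PseudoEMetricSpace.ofRiemannianMetric I M

theorem norm_nonneg {x : M} (v : TangentSpace I x) : 0 ≤ g.norm v := Real.sqrt_nonneg _

theorem norm_eq {x : M} (v : TangentSpace I x) :
    letI : RiemannianBundle (fun x : M => TangentSpace I x) := ⟨g.toRiemannianMetric⟩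
    g.norm v = ‖v‖ := by
  let : RiemannianBundle (fun x : M => TangentSpace I x) := ⟨g.toRiemannianMetric⟩
  rw [norm_eq_sqrt_real_inner]
  rfl

theorem norm_smul {x : M} (a : ℝ) (v : TangentSpace I x) : g.norm (a • v) = |a| * g.norm v := by
  let : RiemannianBundle (fun x : M => TangentSpace I x) := ⟨g.toRiemannianMetric⟩
  rw [norm_eq, norm_eq, _root_.norm_smul, Real.norm_eq_abs]

theorem norm_sub_le {x : M} (v w : TangentSpace I x) : g.norm (v - w) ≤ g.norm v + g.norm w := by
  let : RiemannianBundle (fun x : M => TangentSpace I x) := ⟨g.toRiemannianMetric⟩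
  rw [norm_eq, norm_eq, norm_eq]
  exact _root_.norm_sub_le _ _

theorem norm_eq_zero {x : M} {v : TangentSpace I x} : g.norm v = 0 ↔ v = 0 := by
  let : RiemannianBundle (fun x : M => TangentSpace I x) := ⟨g.toRiemannianMetric⟩
  rw [norm_eq]
  exact _root_.norm_eq_zero

end SmoothMetric

/-! ### Norms of tangent vectors in the frames of charts. -/

section Frames

variable {E : Type*} [NormedAddCommGroup E] [NormedSpace ℝ E]
  {H : Type*} [TopologicalSpace H] {I : ModelWithCorners ℝ E H}
  {M : Type*} [TopologicalSpace M] [ChartedSpace H M] [IsManifold I ∞ M]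

/-- Over its own centre x the trivialization centred at x is the identity, so the change of frame
from x to x₀ is just the trivialization at x₀. -/
theorem frameChange_eq {x₀ x : M} (hx : x ∈ (chartAt H x₀).source) (v : TangentSpace I x) :
    frameChange I x₀ x v = (trivializationAt E (TangentSpace I : M → Type _) x₀).continuousLinearMapAt ℝ x v := by
  have e : ∀ y : M, (trivializationAt E (TangentSpace I : M → Type _) y).baseSet =
      (chartAt H y).source := fun y => rfl
  unfold frameChange
  have hx' := mem_chart_source H x
  refine (Trivialization.coordChangeL_apply (R := ℝ) _ _
    (by rw [e, e]; exact ⟨hx', hx⟩) (show E from v)).trans ?_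
  rw [Trivialization.continuousLinearMapAt_apply, Trivialization.linearMapAt_def_of_mem _ (by rw [e]; exact hx)]
  change _ = (trivializationAt E (TangentSpace I : M → Type _) x₀ ⟨x, v⟩).2
  congr 3
  have := TangentBundle.symmL_trivializationAt_eq_core (I := I) hx'
  have h2 := congrArg (fun f : E →L[ℝ] E => f v) this
  have h3 := h2.trans ((tangentBundleCore I M).coordChange_self (achart H x) x hx' v)
  exact (Trivialization.symmL_apply (R := ℝ) _ (b := x) hx' (show E from v)).symm.trans h3

/-- By continuity of the metric, its norm is locally uniformly equivalent to the norm of frame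
coordinates. This allows vectors over different points to be compared in one fixed space. -/
theorem SmoothMetric.eventually_norm_le (g : SmoothMetric I M) (x : M) :
    ∃ C : ℝ≥0, ∀ᶠ y in 𝓝 x, ∀ v : TangentSpace I y,
      ‖(frameChange I x y v : E)‖ ≤ C * g.norm v ∧ g.norm v ≤ C * ‖(frameChange I x y v : E)‖ := by
  let : RiemannianBundle (fun x : M => TangentSpace I x) := ⟨g.toRiemannianMetric⟩
  have : IsContinuousRiemannianBundle E (fun x : M => TangentSpace I x) :=
    g.isContinuousRiemannianBundle
  obtain ⟨C₁, C₁_pos, h₁⟩ := eventually_norm_trivializationAt_lt E (fun x : M ↦ TangentSpace I x) x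
  obtain ⟨C₂, C₂_pos, h₂⟩ := eventually_norm_symmL_trivializationAt_lt E (fun x : M ↦ TangentSpace I x) x
  refine ⟨⟨max C₁ C₂, by positivity⟩, ?_⟩
  filter_upwards [h₁, h₂, chart_source_mem_nhds H x] with y h1 h2 hy v
  rw [g.norm_eq, frameChange_eq hy]
  constructor
  · refine (ContinuousLinearMap.le_opNorm _ _).trans ?_
    gcongr
    exact h1.le.trans (le_max_left _ _)
  · have hb : y ∈ (trivializationAt E (TangentSpace I : M → Type _) x).baseSet := hy
    conv_lhs => rw [← Trivialization.symmL_continuousLinearMapAt (R := ℝ) _ hb v]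
    refine (ContinuousLinearMap.le_opNorm _ _).trans ?_
    gcongr
    exact h2.le.trans (le_max_right _ _)

end Frames

/-! ### Existence of smooth Riemannian metrics. -/

section Existence

/-- The given norm need not come from an inner product (a product model carries the sup norm), so
the form is transported from Euclidean space. -/
theorem exists_posDef_bilinear (E : Type*) [NormedAddCommGroup E] [NormedSpace ℝ E]
    [FiniteDimensional ℝ E] : ∃ B : E →L[ℝ] E →L[ℝ] ℝ,
    (∀ v w, B v w = B w v) ∧ ∀ v, v ≠ 0 → 0 < B v v := by
  let e := toEuclidean (E := E)
  refine ⟨(innerSL ℝ).bilinearComp e.toContinuousLinearMap e.toContinuousLinearMap, ?_, ?_⟩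
  · exact fun v w => real_inner_comm (e w) (e v)
  · exact fun v hv => real_inner_self_pos.2 (e.map_ne_zero_iff.2 hv)

-- By compactness of the unit sphere B v v is bounded below by m ‖v‖² with m > 0. The structure of
-- Riemannian metrics asks for this boundedness.
set_option synthInstance.maxHeartbeats 200000 in
theorem isVonNBounded_of_posDef {E : Type*} [NormedAddCommGroup E] [NormedSpace ℝ E]
    [FiniteDimensional ℝ E] (B : E →L[ℝ] E →L[ℝ] ℝ) (hB : ∀ v, v ≠ 0 → 0 < B v v) :
    Bornology.IsVonNBounded ℝ {v : E | B v v < 1} := by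
  rw [NormedSpace.isVonNBounded_iff]
  obtain ⟨m, hm, h⟩ : ∃ m > 0, ∀ v ∈ Metric.sphere (0 : E) 1, m ≤ B v v := by
    -- The sphere is empty when E is trivial; any m then works.
    rcases (Metric.sphere (0 : E) 1).eq_empty_or_nonempty with h0 | h0
    · exact ⟨1, one_pos, by simp [h0]⟩
    · obtain ⟨v, hv, hmin⟩ := (isCompact_sphere (0 : E) 1).exists_isMinOn h0
        (f := fun v => B v v) (by fun_prop)
      exact ⟨B v v, hB v (by rintro rfl; simp at hv), fun w hw => hmin hw⟩
  refine (Metric.isBounded_closedBall (x := (0 : E)) (r := √(1 / m))).subset fun v hv => ?_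
  rw [mem_closedBall_zero_iff]
  rcases eq_or_ne v 0 with rfl | hv0
  · simp
  have h1 := h (‖v‖⁻¹ • v) (by simp [norm_smul, hv0])
  have h2 : 0 < ‖v‖ := norm_pos_iff.2 hv0
  apply Real.le_sqrt_of_sq_le
  rw [le_div_iff₀ hm]
  have h3 : B (‖v‖⁻¹ • v) (‖v‖⁻¹ • v) = (‖v‖ ^ 2)⁻¹ * B v v := by
    simp; field_simp
  rw [h3, ← div_eq_inv_mul, le_div_iff₀ (by positivity)] at h1
  linarith [show B v v < 1 from hv]

variable {E : Type*} [NormedAddCommGroup E] [NormedSpace ℝ E]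
  {H : Type*} [TopologicalSpace H] (I : ModelWithCorners ℝ E H)
  (M : Type*) [TopologicalSpace M] [ChartedSpace H M] [IsManifold I ∞ M]


variable {E : Type*} [NormedAddCommGroup E] [NormedSpace ℝ E]
  {H : Type*} [TopologicalSpace H] (I : ModelWithCorners ℝ E H)
  (M : Type*) [TopologicalSpace M] [ChartedSpace H M] [IsManifold I ∞ M]

/-- The pull-back of a bilinear form by the trivialization of the tangent bundle at `x₀`. -/
def pullbackBilinear (B : E →L[ℝ] E →L[ℝ] ℝ) (x₀ x : M) :
    TangentSpace I x →L[ℝ] TangentSpace I x →L[ℝ] ℝ :=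
  (ContinuousLinearMap.precomp ℝ
    ((trivializationAt E (TangentSpace I : M → Type _) x₀).continuousLinearMapAt ℝ x)) ∘L B ∘L
    ((trivializationAt E (TangentSpace I : M → Type _) x₀).continuousLinearMapAt ℝ x)

/-- Read in the trivialization at x₀ this section is the constant B. -/
theorem contMDiffOn_pullbackBilinear (B : E →L[ℝ] E →L[ℝ] ℝ) (x₀ : M) :
    ContMDiffOn I (I.prod 𝓘(ℝ, E →L[ℝ] E →L[ℝ] ℝ)) ∞
      (fun x => TotalSpace.mk' (E →L[ℝ] E →L[ℝ] ℝ)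
        (E := fun x : M => TangentSpace I x →L[ℝ] TangentSpace I x →L[ℝ] ℝ) x
        (pullbackBilinear I M B x₀ x)) (chartAt H x₀).source := by
  refine (Trivialization.contMDiffOn_section_iff (IB := I) (n := ∞) (F := E →L[ℝ] E →L[ℝ] ℝ)
    (s := fun x => pullbackBilinear I M B x₀ x)
    (trivializationAt (E →L[ℝ] E →L[ℝ] ℝ)
      (fun x : M => TangentSpace I x →L[ℝ] TangentSpace I x →L[ℝ] ℝ) x₀)
      (chartAt H x₀).open_source (fun x hx => ?_)).2 ?_
  · rw [hom_trivializationAt_baseSet, hom_trivializationAt_baseSet]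
    exact ⟨hx, hx, mem_univ _⟩
  · refine (contMDiffOn_const (c := B)).congr fun x hx => ?_
    have hb : x ∈ (trivializationAt E (TangentSpace I : M → Type _) x₀).baseSet := hx
    rw [hom_trivializationAt_apply]
    ext v w
    dsimp only
    rw [inCoordinates_apply_eq₂ hb hb (mem_univ x)]
    have key : ∀ u : E, (trivializationAt E (TangentSpace I : M → Type _) x₀).linearMapAt ℝ x
        ((trivializationAt E (TangentSpace I : M → Type _) x₀).symm x u) = u := fun u => by
      rw [← Trivialization.symmL_apply (R := ℝ) _ hb u]
      exact Trivialization.continuousLinearMapAt_symmL (R := ℝ) _ hb u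
    simp only [pullbackBilinear, ContinuousLinearMap.comp_apply,
      ContinuousLinearMap.precomp_apply, Trivialization.continuousLinearMapAt_apply]
    rw [key, key]
    simp
set_option synthInstance.maxHeartbeats 400000 in
set_option maxHeartbeats 800000 in
/-- A finite-dimensional Hausdorff σ-compact manifold carries a smooth Riemannian metric. -/
theorem exists_smoothMetric [FiniteDimensional ℝ E] [T2Space M] [SigmaCompactSpace M] : Nonempty (SmoothMetric I M) := by
  obtain ⟨B₀, hsymm, hpos⟩ := exists_posDef_bilinear E
  -- Symmetric positive definite forms are a convex set in each fibre, so a partition of unity glues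
  -- the local pull-backs.
  obtain ⟨s, hs⟩ := exists_contMDiffSection_forall_mem_convex_of_local I (n := ⊤)
    (F_fiber := E →L[ℝ] E →L[ℝ] ℝ)
    (fun x : M => TangentSpace I x →L[ℝ] TangentSpace I x →L[ℝ] ℝ)
    (fun x => {b | (∀ v w, b v w = b w v) ∧ ∀ v, v ≠ 0 → 0 < b v v})
    (by
      intro x b hb b' hb' r t hr ht hrt
      refine ⟨fun v w => ?_, fun v hv => ?_⟩
      · change r * b v w + t * b' v w = r * b w v + t * b' w v
        rw [hb.1, hb'.1]
      · have h1 := hb.2 v hv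
        have h2 := hb'.2 v hv
        change 0 < r * b v v + t * b' v v
        rcases hr.eq_or_lt with rfl | hr
        · have : t = 1 := by linarith
          subst this; simpa
        · positivity)
    (fun x₀ => ⟨(chartAt H x₀).source, chart_source_mem_nhds H x₀,
      fun x => pullbackBilinear I M B₀ x₀ x, contMDiffOn_pullbackBilinear I M B₀ x₀, fun x hx => by
        refine ⟨fun v w => hsymm _ _, fun v hv => hpos _ fun h0 => hv ?_⟩
        have := (trivializationAt E (TangentSpace I : M → Type _) x₀).symmL_continuousLinearMapAt
          (R := ℝ) hx v
        rw [← this]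
        exact (congrArg _ h0).trans (map_zero _)⟩)
  exact ⟨⟨s, fun b => (hs b).1, fun b => (hs b).2,
    fun b => isVonNBounded_of_posDef (E := E) (s b) (hs b).2, s.contMDiff⟩⟩

end Existence

/-! ### Uniform constants over compact sets. -/

section Compactness

/-- A property of nearby pairs of points, with a constant, holds uniformly near a compact set. -/
theorem exists_uniform_of_eventually {X : Type*} [PseudoEMetricSpace X] {Z : Set X}
    (hZ : IsCompact Z) (P : ℝ≥0 → X → X → Prop) (hP : ∀ C C' p q, C ≤ C' → P C p q → P C' p q)
    (h : ∀ z ∈ Z, ∃ C, ∀ᶠ p in 𝓝 z ×ˢ 𝓝 z, P C p.1 p.2) :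
    ∃ (C : ℝ≥0) (ε : ℝ≥0), 0 < ε ∧ ∀ p ∈ Z, ∀ q, edist p q < ε → P C p q := by
  refine hZ.induction_on (p := fun s => ∃ (C : ℝ≥0) (ε : ℝ≥0), 0 < ε ∧
    ∀ p ∈ s, ∀ q, edist p q < ε → P C p q) ⟨0, 1, one_pos, by simp⟩ ?_ ?_ ?_
  · rintro s t hst ⟨C, ε, hε, h⟩
    exact ⟨C, ε, hε, fun p hp => h p (hst hp)⟩
  · rintro s t ⟨C, ε, hε, h⟩ ⟨C', ε', hε', h'⟩
    refine ⟨max C C', min ε ε', lt_min hε hε', ?_⟩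
    rintro p (hp | hp) q hq
    · exact hP _ _ _ _ (le_max_left _ _) (h p hp q (hq.trans_le (by simp)))
    · exact hP _ _ _ _ (le_max_right _ _) (h' p hp q (hq.trans_le (by simp)))
  · intro z hz
    obtain ⟨C, hC⟩ := h z hz
    rw [← nhds_prod_eq] at hC
    obtain ⟨ε, hε, hball⟩ := EMetric.mem_nhds_iff.1 hC
    -- With p in the δ-ball of z and q within δ of p, both lie in the ε-ball; q need not belong to
    -- Z.
    obtain ⟨δ, hδ, hδε⟩ : ∃ δ : ℝ≥0, 0 < δ ∧ (δ : ℝ≥0∞) + δ ≤ ε := by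
      obtain ⟨δ, h0, h1⟩ := ENNReal.lt_iff_exists_nnreal_btwn.1 (ENNReal.half_pos hε.ne')
      exact ⟨δ, by exact_mod_cast h0, (add_le_add h1.le h1.le).trans (ENNReal.add_halves ε).le⟩
    refine ⟨_, mem_nhdsWithin_of_mem_nhds (Metric.eball_mem_nhds z (ε := δ) (by simpa using hδ)),
      C, δ, hδ, fun p hp q hq => hball (a := (p, q)) ?_⟩
    rw [Metric.mem_eball, Prod.edist_eq, max_lt_iff]
    have hp' : edist p z < δ := hp
    refine ⟨hp'.trans_le (le_self_add.trans hδε), ?_⟩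
    refine ((edist_triangle q p z).trans_lt (ENNReal.add_lt_add ?_ hp')).trans_le hδε
    rwa [edist_comm]

/-- A locally bounded extended pseudodistance is bounded on a compact set, except for its infinite
values. -/
theorem exists_bound_of_locally_bounded {X : Type*} [TopologicalSpace X] {Z : Set X}
    (hZ : IsCompact Z) (F : X → X → ℝ≥0∞) (hsymm : ∀ p q, F p q = F q p)
    (htri : ∀ p q r, F p r ≤ F p q + F q r)
    (h : ∀ z ∈ Z, ∃ C : ℝ≥0, ∀ᶠ p in 𝓝[Z] z, F z p ≤ C) :
    ∃ C : ℝ≥0, ∀ p ∈ Z, ∀ q ∈ Z, F p q < ⊤ → F p q ≤ C := by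
  choose! C hC using h
  obtain ⟨T, hTZ, hT⟩ := hZ.elim_nhdsWithin_subcover (fun z => {p | F z p ≤ C z}) hC
  -- When F a b is infinite, `toNNReal` contributes 0; this is harmless because finiteness of F p q
  -- forces F a b to be finite for the centres that are used.
  refine ⟨∑ a ∈ T, ∑ b ∈ T, (C a + (F a b).toNNReal + C b), fun p hp q hq hpq => ?_⟩
  obtain ⟨a, ha, hap⟩ := mem_iUnion₂.1 (hT hp)
  obtain ⟨b, hb, hbq⟩ := mem_iUnion₂.1 (hT hq)
  simp only [mem_ofPred_eq] at hap hbq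
  have hab : F a b < ⊤ := by
    refine (htri a p b).trans_lt (ENNReal.add_lt_top.2 ⟨hap.trans_lt ENNReal.coe_lt_top, ?_⟩)
    refine (htri p q b).trans_lt (ENNReal.add_lt_top.2 ⟨hpq, ?_⟩)
    rw [hsymm]
    exact hbq.trans_lt ENNReal.coe_lt_top
  have h1 : C a + (F a b).toNNReal + C b ≤ ∑ a ∈ T, ∑ b ∈ T, (C a + (F a b).toNNReal + C b) :=
    (Finset.single_le_sum (f := fun b => C a + (F a b).toNNReal + C b)
      (fun _ _ => zero_le) hb).trans (Finset.single_le_sum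
      (f := fun a => ∑ b ∈ T, (C a + (F a b).toNNReal + C b)) (fun _ _ => zero_le) ha)
  have h2 : F p q ≤ ((C a + (F a b).toNNReal + C b : ℝ≥0) : ℝ≥0∞) := by
    push_cast
    rw [ENNReal.coe_toNNReal hab.ne]
    refine (htri p b q).trans (add_le_add ((htri p a b).trans (add_le_add ?_ le_rfl)) hbq)
    rwa [hsymm]
  exact h2.trans (by exact_mod_cast h1)

end Compactness

end HyperbolicHolder

namespace HyperbolicHolder

open Filter Topology

/-! ### Calculus of locally Lipschitz maps and normalization. -/

section LocallyLipschitz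

variable {X Y Z : Type*} [PseudoEMetricSpace X] [PseudoEMetricSpace Y] [PseudoEMetricSpace Z]

/-- `f` is Lipschitz on a neighbourhood of `a`. -/
def LipschitzNear (f : X → Y) (a : X) : Prop := ∃ K : ℝ≥0, ∃ s ∈ 𝓝 a, LipschitzOnWith K f s

theorem LipschitzNear.comp {f : X → Y} {g : Y → Z} {a : X} (hg : LipschitzNear g (f a))
    (hf : LipschitzNear f a) : LipschitzNear (g ∘ f) a := by
  obtain ⟨K, s, hs, h⟩ := hf
  obtain ⟨K', s', hs', h'⟩ := hg
  have hc : ContinuousAt f a := h.continuousOn.continuousAt hs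
  exact ⟨K' * K, s ∩ f ⁻¹' s', inter_mem hs (hc hs'),
    h'.comp (h.mono inter_subset_left) fun x hx => hx.2⟩

theorem LipschitzNear.prodMk {f : X → Y} {g : X → Z} {a : X} (hf : LipschitzNear f a)
    (hg : LipschitzNear g a) : LipschitzNear (fun x => (f x, g x)) a := by
  obtain ⟨K, s, hs, h⟩ := hf
  obtain ⟨K', s', hs', h'⟩ := hg
  refine ⟨max K K', s ∩ s', inter_mem hs hs', fun x hx y hy => ?_⟩
  rw [Prod.edist_eq, max_le_iff]
  refine ⟨(h hx.1 hy.1).trans ?_, (h' hx.2 hy.2).trans ?_⟩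
  · gcongr; exact le_max_left _ _
  · gcongr; exact le_max_right _ _

theorem LipschitzNear.continuousAt {f : X → Y} {a : X} (hf : LipschitzNear f a) :
    ContinuousAt f a := by
  obtain ⟨K, s, hs, h⟩ := hf
  exact h.continuousOn.continuousAt hs

theorem LipschitzNear.eventually {f : X → Y} {a : X} (hf : LipschitzNear f a) :
    ∃ K : ℝ≥0, ∀ᶠ p in 𝓝 a ×ˢ 𝓝 a, edist (f p.1) (f p.2) ≤ K * edist p.1 p.2 := by
  obtain ⟨K, s, hs, h⟩ := hf
  exact ⟨K, mem_of_superset (prod_mem_prod hs hs) fun p hp => h hp.1 hp.2⟩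

theorem lipschitzNear_of_contDiffAt {E F : Type*} [NormedAddCommGroup E] [NormedSpace ℝ E]
    [NormedAddCommGroup F] [NormedSpace ℝ F] {f : E → F} {a : E} (hf : ContDiffAt ℝ 1 f a) :
    LipschitzNear f a := hf.exists_lipschitzOnWith

/-- The normalization of a vector. -/
def normalize {E : Type*} [NormedAddCommGroup E] [NormedSpace ℝ E] (v : E) : E := ‖v‖⁻¹ • v

variable {E : Type*} [NormedAddCommGroup E] [NormedSpace ℝ E]

theorem norm_normalize {v : E} (hv : v ≠ 0) : ‖normalize v‖ = 1 := by
  simp [normalize, norm_smul, hv]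

theorem normalize_eq_self {v : E} (hv : ‖v‖ = 1) : normalize v = v := by simp [normalize, hv]

theorem normalize_smul {c : ℝ} (hc : 0 < c) (v : E) : normalize (c • v) = normalize v := by
  unfold normalize
  rw [norm_smul, smul_smul, Real.norm_of_nonneg hc.le, mul_inv, mul_assoc,
    mul_comm (‖v‖⁻¹), ← mul_assoc, inv_mul_cancel₀ hc.ne', one_mul]

/-- The space ℝ × ℝᵈ carries the sup norm, so normalization is in general not differentiable; this
is why local Lipschitz maps, and not C¹ maps, are composed below. -/
theorem lipschitzNear_normalize {a : E} (ha : a ≠ 0) : LipschitzNear (normalize (E := E)) a := by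
  have hpos : 0 < ‖a‖ / 2 := by have := norm_pos_iff.2 ha; positivity
  refine ⟨⟨2 / (‖a‖ / 2), by positivity⟩, {v | ‖a‖ / 2 < ‖v‖},
    (isOpen_lt continuous_const continuous_norm).mem_nhds ?_, LipschitzOnWith.of_dist_le_mul ?_⟩
  · change ‖a‖ / 2 < ‖a‖; linarith
  intro u hu v hv
  simp only [mem_ofPred_eq] at hu hv
  have hu0 : 0 < ‖u‖ := hpos.trans hu
  have hv0 : 0 < ‖v‖ := hpos.trans hv
  rw [dist_eq_norm, dist_eq_norm]
  have e : normalize u - normalize v = ‖u‖⁻¹ • (u - v) + (‖u‖⁻¹ - ‖v‖⁻¹) • v := by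
    unfold normalize; module
  have e2 : (‖u‖⁻¹ - ‖v‖⁻¹) = ‖u‖⁻¹ * ‖v‖⁻¹ * (‖v‖ - ‖u‖) := by field_simp
  have h1 : ‖(‖u‖⁻¹ - ‖v‖⁻¹) • v‖ ≤ ‖u‖⁻¹ * ‖u - v‖ := by
    rw [norm_smul, e2, norm_mul, Real.norm_of_nonneg (by positivity), mul_assoc, mul_assoc]
    gcongr
    rw [mul_comm, mul_assoc, mul_inv_cancel₀ hv0.ne', mul_one, Real.norm_eq_abs, norm_sub_rev]
    exact abs_norm_sub_norm_le v u
  rw [e]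
  refine (norm_add_le _ _).trans ?_
  rw [norm_smul, norm_inv, norm_norm]
  calc ‖u‖⁻¹ * ‖u - v‖ + ‖(‖u‖⁻¹ - ‖v‖⁻¹) • v‖ ≤ 2 / ‖u‖ * ‖u - v‖ := by
        rw [div_mul_eq_mul_div, mul_div_assoc, div_eq_inv_mul]; linarith
    _ ≤ 2 / (‖a‖ / 2) * ‖u - v‖ := by gcongr

end LocallyLipschitz

/-! ### Rays represented by unit vectors of a half-sphere. -/

section HalfRays

theorem halfRay_default_ne (V : Type*) [AddCommGroup V] [Module ℝ V] : ((1, 0) : ℝ × V) ≠ 0 :=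
  fun h => one_ne_zero (congrArg Prod.fst h)

variable {V W : Type*} [AddCommGroup V] [Module ℝ V] [AddCommGroup W] [Module ℝ W]

open Classical in
/-- The ray of a vector `(t, v) ≠ 0` with `t ≥ 0` (and the ray `[1, 0]` for other vectors). -/
def HalfRay.of (w : ℝ × V) : HalfRay V :=
  if h : w ≠ 0 ∧ 0 ≤ w.1 then ⟨rayOfNeZero ℝ w h.1, w, h.1, rfl, h.2⟩
  else ⟨rayOfNeZero ℝ (1, 0) (halfRay_default_ne V), (1, 0), halfRay_default_ne V, rfl, zero_le_one⟩

theorem HalfRay.of_eq {w : ℝ × V} (h : w ≠ 0) (h' : 0 ≤ w.1) :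
    HalfRay.of w = ⟨rayOfNeZero ℝ w h, w, h, rfl, h'⟩ := dif_pos ⟨h, h'⟩

theorem HalfRay.of_smul {w : ℝ × V} (h : w ≠ 0) (h' : 0 ≤ w.1) {c : ℝ} (hc : 0 < c) :
    HalfRay.of (c • w) = HalfRay.of w := by
  rw [HalfRay.of_eq h h', HalfRay.of_eq (smul_ne_zero hc.ne' h) (by simpa using by positivity)]
  apply HalfRay.ext
  exact (ray_eq_iff _ _).2 (SameRay.sameRay_pos_smul_left _ hc)

theorem HalfRay.map_of (e : V ≃ₗ[ℝ] W) {w : ℝ × V} (h : w ≠ 0) (h' : 0 ≤ w.1) :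
    HalfRay.map e (HalfRay.of w) = HalfRay.of (w.1, e w.2) := by
  have h2 : ((w.1, e w.2) : ℝ × W) ≠ 0 := by
    intro h0
    have h1 := congrArg Prod.fst h0
    have h2 := congrArg Prod.snd h0
    exact h (Prod.ext h1 (e.map_eq_zero_iff.1 h2))
  rw [HalfRay.of_eq h h', HalfRay.of_eq h2 h']
  rfl

theorem HalfRay.exists_smul_eq {w w' : ℝ × V} (h : w ≠ 0) (ht : 0 ≤ w.1) (h' : w' ≠ 0)
    (ht' : 0 ≤ w'.1) (he : HalfRay.of w = HalfRay.of w') : ∃ c : ℝ, 0 < c ∧ c • w = w' := by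
  rw [HalfRay.of_eq h ht, HalfRay.of_eq h' ht', HalfRay.ext_iff] at he
  exact ((ray_eq_iff h h').1 he).exists_pos_left h h'

theorem HalfRay.exists_of (r : HalfRay V) : ∃ w : ℝ × V, w ≠ 0 ∧ 0 ≤ w.1 ∧ HalfRay.of w = r := by
  obtain ⟨_, w, hw, rfl, ht⟩ := r
  exact ⟨w, hw, ht, HalfRay.of_eq hw ht⟩

variable {d : ℕ}

/-- Unit vectors `(t, v)` with `t ≥ 0`. -/
def halfSphere (d : ℕ) : Set (ℝ × Euc d) := {w | ‖w‖ = 1 ∧ 0 ≤ w.1}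

theorem halfSphere_ne_zero {w : ℝ × Euc d} (hw : w ∈ halfSphere d) : w ≠ 0 := by
  rintro rfl; simpa using hw.1

theorem isCompact_halfSphere : IsCompact (halfSphere d) := by
  refine (isCompact_sphere (0 : ℝ × Euc d) 1).of_isClosed_subset ?_ ?_
  · exact (isClosed_eq continuous_norm continuous_const).inter
      (isClosed_le continuous_const continuous_fst)
  · intro w hw; simpa using hw.1

theorem normalize_mem_halfSphere {w : ℝ × Euc d} (h : w ≠ 0) (h' : 0 ≤ w.1) :
    normalize w ∈ halfSphere d :=
  ⟨norm_normalize h, by simpa [normalize] using by positivity⟩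

/-- The unit vector on a ray. -/
def HalfRay.rep (r : HalfRay (Euc d)) : ℝ × Euc d := normalize r.exists_of.choose

theorem HalfRay.rep_mem (r : HalfRay (Euc d)) : r.rep ∈ halfSphere d :=
  normalize_mem_halfSphere r.exists_of.choose_spec.1 r.exists_of.choose_spec.2.1

theorem HalfRay.of_normalize {w : ℝ × Euc d} (h : w ≠ 0) (h' : 0 ≤ w.1) :
    HalfRay.of (normalize w) = HalfRay.of w :=
  HalfRay.of_smul h h' (inv_pos.2 (norm_pos_iff.2 h))

theorem HalfRay.of_rep (r : HalfRay (Euc d)) : HalfRay.of r.rep = r := by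
  have h := r.exists_of.choose_spec
  exact (HalfRay.of_normalize h.1 h.2.1).trans h.2.2

theorem HalfRay.rep_of {w : ℝ × Euc d} (h : w ≠ 0) (h' : 0 ≤ w.1) :
    (HalfRay.of w).rep = normalize w := by
  have h1 := (HalfRay.of w).of_rep
  have h2 := (HalfRay.of w).rep_mem
  have h3 := halfSphere_ne_zero h2
  obtain ⟨c, hc, hcw⟩ := HalfRay.exists_smul_eq h3 h2.2 h h' h1
  conv_rhs => rw [← hcw, normalize_smul hc, normalize_eq_self h2.1]

/-- Projective charts are thereby read off from representing vectors: the domain condition is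
positivity of one linear form. -/
theorem mem_range_rayParam_iff (B : RayChart d) {w : ℝ × Euc d} (h : w ≠ 0) (h' : 0 ≤ w.1) :
    HalfRay.of w ∈ range (rayParam B) ↔ 0 < (B.equiv w).1 := by
  constructor
  · rintro ⟨y, hy⟩
    rw [rayParam, HalfRay.of_eq h h', HalfRay.ext_iff] at hy
    obtain ⟨c, hc, hcw⟩ := ((ray_eq_iff (B.ne_zero y.1) h).1 hy).exists_pos_left (B.ne_zero y.1) h
    rw [← hcw]
    simpa using hc
  · intro hl
    rw [HalfRay.of_eq h h']
    exact ⟨_, rayParam_eq_of B w h h' hl⟩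

end HalfRays

end HyperbolicHolder

namespace HyperbolicHolder

open Filter Topology

/-! ### Topology and coordinates of the compactified tangent bundle. -/

namespace CompactifiedTangentBundle

variable {d : ℕ} {M : Type*} [TopologicalSpace M] [ChartedSpace (Euc d) M]
  [IsManifold (𝓡 d) ∞ M]

/-- The unit vector on a ray of `ℝ ⊕ T_x M`, in the frame of the chart centred at `x₀`. -/
def rayCoord (x₀ : M) (p : CompactifiedTangentBundle d M) : ℝ × Euc d :=
  HalfRay.rep ((rayFibre d).act (frameChange (𝓡 d) x₀ p.1) p.2)

/-- The ray of `ℝ ⊕ T_x M` given by a vector in the frame of the chart centred at `x₀`. -/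
def rayPoint (x₀ x : M) (w : ℝ × Euc d) : CompactifiedTangentBundle d M :=
  ⟨x, (rayFibre d).act (frameChange (𝓡 d) x₀ x).symm (HalfRay.of w)⟩

theorem rayCoord_mem (x₀ : M) (p : CompactifiedTangentBundle d M) :
    rayCoord x₀ p ∈ halfSphere d := HalfRay.rep_mem _

theorem rayPoint_rayCoord (x₀ : M) (p : CompactifiedTangentBundle d M) :
    rayPoint x₀ p.1 (rayCoord x₀ p) = p := by
  unfold rayPoint rayCoord
  rw [HalfRay.of_rep]
  exact congrArg (Sigma.mk p.1) ((rayFibre d).act_symm_act _ p.2)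

theorem rayCoord_rayPoint (x₀ x : M) {w : ℝ × Euc d} (hw : w ∈ halfSphere d) :
    rayCoord x₀ (rayPoint x₀ x w) = w := by
  have h := congrArg HalfRay.rep ((rayFibre d).act_act_symm (frameChange (𝓡 d) x₀ x) (HalfRay.of w))
  refine h.trans ?_
  rw [HalfRay.rep_of (halfSphere_ne_zero hw) hw.2, normalize_eq_self hw.1]

/-- The chart of the compactified tangent bundle given by a chart of `M` and a projective chart. -/
def rayBundleChart (x₀ : M) (B : RayChart d) :
    OpenPartialHomeomorph (CompactifiedTangentBundle d M) (ModelProd (Euc d) (HalfSpace d)) :=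
  ((rayFibre d).core (𝓡 d) (M := M)).openPartialHomeomorph
    ((rayFibre d).bundleChart (𝓡 d) x₀ B) ⟨x₀, B, rfl⟩

theorem mem_rayBundleChart_source (x₀ : M) (B : RayChart d) (p : CompactifiedTangentBundle d M) :
    p ∈ (rayBundleChart x₀ B).source ↔
      p.1 ∈ (chartAt (Euc d) x₀).source ∧ 0 < (B.equiv (rayCoord x₀ p)).1 := by
  rw [← mem_range_rayParam_iff B (halfSphere_ne_zero (rayCoord_mem x₀ p)) (rayCoord_mem x₀ p).2,
    rayCoord, HalfRay.of_rep]
  rfl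

/-- The projective coordinates of a vector. -/
def projCoord (B : RayChart d) (w : ℝ × Euc d) : Euc d := (B.equiv w).1⁻¹ • (B.equiv w).2

theorem lipschitzNear_projCoord (B : RayChart d) {w : ℝ × Euc d} (hw : 0 < (B.equiv w).1) :
    LipschitzNear (projCoord B) w := by
  apply lipschitzNear_of_contDiffAt
  have h : ContDiffAt ℝ 1 B.equiv w := B.equiv.contDiff.contDiffAt
  exact (h.fst.inv hw.ne').smul h.snd

/-- The unit vector with given projective coordinates. -/
def unprojCoord (B : RayChart d) (y : Euc d) : ℝ × Euc d := normalize (B.equiv.symm (1, y))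

theorem lipschitzNear_unprojCoord (B : RayChart d) (y : Euc d) :
    LipschitzNear (unprojCoord B) y := by
  refine LipschitzNear.comp (f := fun y => B.equiv.symm (1, y)) (lipschitzNear_normalize (B.ne_zero y)) ?_
  apply lipschitzNear_of_contDiffAt
  exact B.equiv.symm.contDiff.contDiffAt.comp y (contDiffAt_const.prodMk contDiffAt_id)

theorem unprojCoord_projCoord (B : RayChart d) {w : ℝ × Euc d} (hw : ‖w‖ = 1)
    (h : 0 < (B.equiv w).1) : unprojCoord B (projCoord B w) = w := by
  have e : ((1, projCoord B w) : ℝ × Euc d) = (B.equiv w).1⁻¹ • B.equiv w :=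
    Prod.ext (by simp [h.ne']) rfl
  rw [unprojCoord, e, map_smul, B.equiv.symm_apply_apply, normalize_smul (inv_pos.2 h),
    normalize_eq_self hw]

theorem rayBundleChart_apply_snd (x₀ : M) (B : RayChart d) {p : CompactifiedTangentBundle d M}
    (hp : p ∈ (rayBundleChart x₀ B).source) :
    ((rayBundleChart x₀ B p).2 : Euc d) = projCoord B (rayCoord x₀ p) := by
  have h := ((mem_rayBundleChart_source x₀ B p).1 hp).2
  have hm := rayCoord_mem x₀ p
  have h1 := rayParam_eq_of B _ (halfSphere_ne_zero hm) hm.2 h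
  rw [← HalfRay.of_eq (halfSphere_ne_zero hm) hm.2] at h1
  have h2 : HalfRay.of (rayCoord x₀ p) = (rayFibre d).act (frameChange (𝓡 d) x₀ p.1) p.2 :=
    HalfRay.of_rep _
  have h3 : (rayBundleChart x₀ B p).2 = Function.invFun (rayParam B) (HalfRay.of (rayCoord x₀ p)) :=
    congrArg (Function.invFun (rayParam B)) h2.symm
  rw [h3, ← h1]
  exact congrArg Subtype.val (Function.leftInverse_invFun ((rayFibre d).injective B) _)

theorem rayBundleChart_symm_apply (x₀ : M) (B : RayChart d) {x : M}
    (hx : x ∈ (chartAt (Euc d) x₀).source) {w : ℝ × Euc d} (hw : w ∈ halfSphere d)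
    (h : 0 < (B.equiv w).1) :
    (rayBundleChart x₀ B).symm (chartAt (Euc d) x₀ x, (halfModel d).symm (projCoord B w)) =
      rayPoint x₀ x w := by
  have hs : rayPoint x₀ x w ∈ (rayBundleChart x₀ B).source := by
    rw [mem_rayBundleChart_source, rayCoord_rayPoint x₀ x hw]
    exact ⟨hx, h⟩
  rw [← (rayBundleChart x₀ B).left_inv hs]
  congr 1
  refine Prod.ext rfl ?_
  have := rayBundleChart_apply_snd x₀ B hs
  rw [rayCoord_rayPoint x₀ x hw] at this
  change (halfModel d).symm (projCoord B w) = _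
  rw [← this]
  exact (halfModel d).left_inv _

theorem exists_mem_rayBundleChart_source (x₀ : M) {p : CompactifiedTangentBundle d M}
    (hp : p.1 ∈ (chartAt (Euc d) x₀).source) :
    ∃ B : RayChart d, p ∈ (rayBundleChart x₀ B).source := by
  obtain ⟨B, hB⟩ := exists_rayChart _ (halfSphere_ne_zero (rayCoord_mem x₀ p)) (rayCoord_mem x₀ p).2
  exact ⟨B, (mem_rayBundleChart_source x₀ B p).2 ⟨hp, hB⟩⟩

theorem continuous_fst : Continuous (fun p : CompactifiedTangentBundle d M => p.1) := by
  rw [continuous_iff_continuousAt]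
  intro p
  obtain ⟨B, hB⟩ := exists_mem_rayBundleChart_source p.1 (p := p) (mem_chart_source _ _)
  have h1 : ContinuousAt (fun q => (rayBundleChart p.1 B q).1) p :=
    Continuous.fst continuous_id |>.continuousAt.comp ((rayBundleChart p.1 B).continuousAt hB)
  have h2 : ContinuousAt (fun q => (chartAt (Euc d) p.1).symm ((rayBundleChart p.1 B q).1)) p :=
    ((chartAt (Euc d) p.1).continuousAt_symm (mem_chart_target _ _)).comp
      (f := fun q => (rayBundleChart p.1 B q).1) h1
  refine h2.congr ?_
  filter_upwards [(rayBundleChart p.1 B).open_source.mem_nhds hB] with q hq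
  exact (chartAt (Euc d) p.1).left_inv ((mem_rayBundleChart_source _ _ _).1 hq).1

theorem continuousOn_rayCoord (x₀ : M) : ContinuousOn (rayCoord x₀)
    {p : CompactifiedTangentBundle d M | p.1 ∈ (chartAt (Euc d) x₀).source} := by
  intro p hp
  obtain ⟨B, hB⟩ := exists_mem_rayBundleChart_source x₀ (p := p) hp
  have h1 : ContinuousAt (fun q => ((rayBundleChart x₀ B q).2 : Euc d)) p :=
    (continuous_subtype_val.comp (Continuous.snd continuous_id)).continuousAt.comp
      ((rayBundleChart x₀ B).continuousAt hB)
  have h2 := (lipschitzNear_unprojCoord B _).continuousAt.comp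
      (f := fun q => ((rayBundleChart x₀ B q).2 : Euc d)) h1
  refine (h2.congr ?_).continuousWithinAt
  filter_upwards [(rayBundleChart x₀ B).open_source.mem_nhds hB] with q hq
  simp only [comp_apply]
  rw [rayBundleChart_apply_snd x₀ B hq, unprojCoord_projCoord B (rayCoord_mem x₀ q).1
    ((mem_rayBundleChart_source _ _ _).1 hq).2]

theorem continuousOn_rayPoint (x₀ : M) : ContinuousOn (fun q : M × (ℝ × Euc d) => rayPoint x₀ q.1 q.2)
    ((chartAt (Euc d) x₀).source ×ˢ halfSphere d) := by
  rintro ⟨x, w⟩ ⟨hx, hw⟩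
  dsimp only at hx hw
  obtain ⟨B, hB⟩ := exists_rayChart _ (halfSphere_ne_zero hw) hw.2
  have h1 : ContinuousAt (fun q : M × (ℝ × Euc d) =>
      (chartAt (Euc d) x₀ q.1, (halfModel d).symm (projCoord B q.2))) (x, w) := by
    refine ContinuousAt.prodMk ?_ ?_
    · exact ((chartAt (Euc d) x₀).continuousAt hx).comp (f := Prod.fst) continuousAt_fst
    · exact (halfModel d).continuous_symm.continuousAt.comp
        (ContinuousAt.comp (f := Prod.snd) (x := (x, w))
          (lipschitzNear_projCoord B hB).continuousAt continuousAt_snd)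
  have ht : ((chartAt (Euc d) x₀ x, (halfModel d).symm (projCoord B w)) :
      ModelProd (Euc d) (HalfSpace d)) ∈ (rayBundleChart x₀ B).target :=
    (chartAt (Euc d) x₀).map_source hx
  have h2 := ((rayBundleChart x₀ B).continuousAt_symm ht).comp (f := fun q : M × (ℝ × Euc d) =>
      ((chartAt (Euc d) x₀ q.1, (halfModel d).symm (projCoord B q.2)) :
        ModelProd (Euc d) (HalfSpace d))) h1
  refine h2.continuousWithinAt.congr_of_eventuallyEq ?_ ?_
  · have hpos : ∀ᶠ q : M × (ℝ × Euc d) in 𝓝 (x, w), 0 < (B.equiv q.2).1 :=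
      (isOpen_lt continuous_const (Continuous.fst (B.equiv.continuous.comp
        (Continuous.snd continuous_id)))).mem_nhds hB
    filter_upwards [self_mem_nhdsWithin, mem_nhdsWithin_of_mem_nhds hpos] with q hq hq'
    exact (rayBundleChart_symm_apply x₀ B hq.1 hq.2 hq').symm
  · exact (rayBundleChart_symm_apply x₀ B hx hw hB).symm

/-- Points over different base points are separated by the projection, points of one fibre by their
unit vectors in a common frame. -/
instance [T2Space M] : T2Space (CompactifiedTangentBundle d M) := by
  refine ⟨fun p q hpq => ?_⟩
  by_cases h : p.1 = q.1
  · have hs : IsOpen {r : CompactifiedTangentBundle d M | r.1 ∈ (chartAt (Euc d) p.1).source} :=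
      (chartAt (Euc d) p.1).open_source.preimage continuous_fst
    have hc := continuousOn_rayCoord (d := d) (M := M) p.1
    have hne : rayCoord p.1 p ≠ rayCoord p.1 q := by
      intro he
      apply hpq
      rw [← rayPoint_rayCoord p.1 p, ← rayPoint_rayCoord p.1 q, he, h]
    obtain ⟨u, v, hu, hv, hpu, hqv, huv⟩ := t2_separation hne
    refine ⟨_, _, hc.isOpen_inter_preimage hs hu, hc.isOpen_inter_preimage hs hv,
      ⟨mem_chart_source _ _, hpu⟩, ⟨?_, hqv⟩, ?_⟩
    · change q.1 ∈ (chartAt (Euc d) p.1).source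
      rw [← h]
      exact mem_chart_source _ _
    · exact (huv.preimage _).mono inter_subset_right inter_subset_right
  · exact separated_by_continuous continuous_fst h

instance : LocallyCompactSpace (CompactifiedTangentBundle d M) :=
  Manifold.locallyCompact_of_finiteDimensional (compactifiedModel d)

/-- Over a compact piece L of a chart domain, the bundle is the continuous image of L times the
half-sphere; finitely many such pieces cover the part over K. -/
theorem isCompact_preimage [T2Space M] {K : Set M} (hK : IsCompact K) :
    IsCompact ((fun p : CompactifiedTangentBundle d M => p.1) ⁻¹' K) := by
  have := Manifold.locallyCompact_of_finiteDimensional (𝓡 d) (M := M)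
  obtain ⟨Z, hZ, hKZ⟩ : ∃ Z : Set (CompactifiedTangentBundle d M), IsCompact Z ∧
      (fun p : CompactifiedTangentBundle d M => p.1) ⁻¹' K ⊆ Z := by
    refine hK.induction_on (p := fun s => ∃ Z : Set (CompactifiedTangentBundle d M),
      IsCompact Z ∧ (fun p : CompactifiedTangentBundle d M => p.1) ⁻¹' s ⊆ Z)
      ⟨∅, isCompact_empty, by simp⟩ ?_ ?_ ?_
    · rintro s t hst ⟨Z, hZ, h⟩
      exact ⟨Z, hZ, (preimage_mono hst).trans h⟩
    · rintro s t ⟨Z, hZ, h⟩ ⟨Z', hZ', h'⟩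
      exact ⟨Z ∪ Z', hZ.union hZ', union_subset_union h h'⟩
    · intro x hx
      obtain ⟨L, hL, hLs, hLc⟩ := local_compact_nhds (chart_source_mem_nhds (Euc d) x)
      refine ⟨L, mem_nhdsWithin_of_mem_nhds hL, _, (hLc.prod isCompact_halfSphere).image_of_continuousOn
        ((continuousOn_rayPoint x).mono (prod_mono hLs subset_rfl)), ?_⟩
      intro p hp
      exact ⟨(p.1, rayCoord x p), ⟨hp, rayCoord_mem x p⟩, rayPoint_rayCoord x p⟩
  exact hZ.of_isClosed_subset (hK.isClosed.preimage continuous_fst) hKZ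

/-- Needed for the partition of unity that produces a metric on the compactified bundle. -/
instance [T2Space M] [SecondCountableTopology M] :
    SigmaCompactSpace (CompactifiedTangentBundle d M) := by
  have := Manifold.locallyCompact_of_finiteDimensional (𝓡 d) (M := M)
  refine ⟨⟨fun n => (fun p : CompactifiedTangentBundle d M => p.1) ⁻¹' compactCovering M n,
    fun n => isCompact_preimage (isCompact_compactCovering M n), ?_⟩⟩
  rw [← preimage_iUnion, iUnion_compactCovering, preimage_univ]

/-- The coordinates of a point in the chart of `M` and the frame given by `x₀`. -/
def coord (x₀ : M) (p : CompactifiedTangentBundle d M) : Euc d × (ℝ × Euc d) :=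
  (extChartAt (𝓡 d) x₀ p.1, rayCoord x₀ p)

theorem continuousAt_coord (p : CompactifiedTangentBundle d M) : ContinuousAt (coord p.1) p := by
  refine ContinuousAt.prodMk ?_ ?_
  · exact (continuousAt_extChartAt p.1).comp (f := fun q : CompactifiedTangentBundle d M => q.1)
      continuous_fst.continuousAt
  · exact (continuousOn_rayCoord p.1).continuousAt
      (((chartAt (Euc d) p.1).open_source.preimage continuous_fst).mem_nhds (mem_chart_source _ _))

theorem exists_extChartAt_eq (z : CompactifiedTangentBundle d M) : ∃ B : RayChart d,
    0 < (B.equiv (rayCoord z.1 z)).1 ∧ ∀ᶠ p in 𝓝 z, 0 < (B.equiv (rayCoord z.1 p)).1 ∧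
      extChartAt (compactifiedModel d) z p = (extChartAt (𝓡 d) z.1 p.1, projCoord B (rayCoord z.1 p)) := by
  obtain ⟨B, hB⟩ : ∃ B, chartAt (ModelProd (Euc d) (HalfSpace d)) z = rayBundleChart z.1 B :=
    ⟨_, rfl⟩
  have hz : z ∈ (rayBundleChart z.1 B).source := by rw [← hB]; exact mem_chart_source _ _
  refine ⟨B, ((mem_rayBundleChart_source _ _ _).1 hz).2, ?_⟩
  filter_upwards [(rayBundleChart z.1 B).open_source.mem_nhds hz] with p hp
  refine ⟨((mem_rayBundleChart_source _ _ _).1 hp).2, ?_⟩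
  rw [← rayBundleChart_apply_snd z.1 B hp, extChartAt, hB]
  rfl

variable (g : SmoothMetric (compactifiedModel d) (CompactifiedTangentBundle d M))

/-- A unit vector serves as coordinate on a whole fibre, while a projective chart sees only part of
it. The change from one to the other is locally Lipschitz in both directions, so estimates for the
Riemannian distance carry over to `coord`; the converse inequality follows in the same way. -/
theorem eventually_dist_le_coord (z : CompactifiedTangentBundle d M) : ∃ C : ℝ≥0,
    ∀ᶠ p in 𝓝 z ×ˢ 𝓝 z, g.dist p.1 p.2 ≤ C * edist (coord z.1 p.1) (coord z.1 p.2) := by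
  obtain ⟨C, hC⟩ := g.eventually_dist_le z
  obtain ⟨B, hB, h⟩ := exists_extChartAt_eq z
  have hL : LipschitzNear (fun c : Euc d × (ℝ × Euc d) => (c.1, projCoord B c.2)) (coord z.1 z) :=
    (lipschitzNear_of_contDiffAt contDiffAt_fst).prodMk
      ((lipschitzNear_projCoord B (w := (coord z.1 z).2) hB).comp
        (f := Prod.snd) (lipschitzNear_of_contDiffAt contDiffAt_snd))
  obtain ⟨K, hK⟩ := hL.eventually
  have hK' := (Filter.Tendsto.prodMap (continuousAt_coord z) (continuousAt_coord z)).eventually hK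
  refine ⟨C * K, ?_⟩
  filter_upwards [hC, hK', prod_mem_prod h h] with p h1 h2 h3
  refine h1.trans ?_
  rw [h3.1.2, h3.2.2, ENNReal.coe_mul, mul_assoc]
  gcongr
  exact h2

theorem eventually_edist_coord_le [T2Space M] (z : CompactifiedTangentBundle d M) : ∃ C : ℝ≥0,
    ∀ᶠ p in 𝓝 z ×ˢ 𝓝 z, edist (coord z.1 p.1) (coord z.1 p.2) ≤ C * g.dist p.1 p.2 := by
  obtain ⟨C, hC⟩ := g.eventually_edist_extChartAt_le z
  obtain ⟨B, hB, h⟩ := exists_extChartAt_eq z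
  have hL : LipschitzNear (fun c : Euc d × Euc d => (c.1, unprojCoord B c.2))
      (extChartAt (compactifiedModel d) z z) :=
    (lipschitzNear_of_contDiffAt contDiffAt_fst).prodMk
      ((lipschitzNear_unprojCoord B _).comp
        (f := Prod.snd) (lipschitzNear_of_contDiffAt contDiffAt_snd))
  obtain ⟨K, hK⟩ := hL.eventually
  have hc := continuousAt_extChartAt (I := compactifiedModel d) z
  have hK' := (Filter.Tendsto.prodMap hc hc).eventually hK
  refine ⟨K * C, ?_⟩
  filter_upwards [hC, hK', prod_mem_prod h h] with p h1 h2 h3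
  have e : ∀ q, (0 < (B.equiv (rayCoord z.1 q)).1 ∧ extChartAt (compactifiedModel d) z q =
      (extChartAt (𝓡 d) z.1 q.1, projCoord B (rayCoord z.1 q))) →
      coord z.1 q = ((extChartAt (compactifiedModel d) z q).1,
        unprojCoord B (extChartAt (compactifiedModel d) z q).2) := fun q hq => by
    rw [hq.2]
    exact Prod.ext rfl (unprojCoord_projCoord B (rayCoord_mem z.1 q).1 hq.1).symm
  rw [e _ h3.1, e _ h3.2, ENNReal.coe_mul, mul_assoc]
  refine h2.trans ?_
  gcongr
  exact h1

end CompactifiedTangentBundle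

end HyperbolicHolder

/-! ### The extended differential is Lipschitz over compact sets. -/

namespace HyperbolicHolder

open Filter Topology

variable {d : ℕ} {M : Type*} [TopologicalSpace M] [ChartedSpace (Euc d) M]
  [IsManifold (𝓡 d) ∞ M]

theorem CompactifiedTangentBundle.rayCoord_of (x₀ x : M) {w : ℝ × TangentSpace (𝓡 d) x}
    (h : w ≠ 0) (h' : 0 ≤ w.1) :
    CompactifiedTangentBundle.rayCoord x₀ (⟨x, HalfRay.of w⟩ : CompactifiedTangentBundle d M) =
      normalize (w.1, (frameChange (𝓡 d) x₀ x w.2 : Euc d)) := by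
  have h1 := HalfRay.map_of (V := Euc d) (frameChange (𝓡 d) x₀ x).toLinearEquiv (w := w) h h'
  have h2 : ((w.1, (frameChange (𝓡 d) x₀ x w.2 : Euc d)) : ℝ × Euc d) ≠ 0 := by
    intro h0
    have h3 := congrArg Prod.fst h0
    have h4 := congrArg Prod.snd h0
    exact h (Prod.ext h3 ((frameChange (𝓡 d) x₀ x).map_eq_zero_iff.1 h4))
  rw [← HalfRay.rep_of h2 h']
  exact congrArg HalfRay.rep h1

theorem extendedDifferential_of {n : ℕ∞ω} (hn : n ≠ 0) (φ : M ≃ₘ^n⟮𝓡 d, 𝓡 d⟯ M) (x : M)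
    {w : ℝ × TangentSpace (𝓡 d) x} (h : w ≠ 0) (h' : 0 ≤ w.1) :
    extendedDifferential hn φ (⟨x, HalfRay.of w⟩ : CompactifiedTangentBundle d M) =
      ⟨φ x, HalfRay.of (w.1, mfderiv (𝓡 d) (𝓡 d) φ x w.2)⟩ := by
  have h1 := HalfRay.map_of (φ.mfderivToContinuousLinearEquiv hn x).toLinearEquiv h h'
  exact congrArg (Sigma.mk (φ x)) h1

theorem CompactifiedTangentBundle.exists_of (p : CompactifiedTangentBundle d M) :
    ∃ w : ℝ × TangentSpace (𝓡 d) p.1, w ≠ 0 ∧ 0 ≤ w.1 ∧ p = ⟨p.1, HalfRay.of w⟩ := by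
  obtain ⟨w, h, h', hw⟩ := p.2.exists_of
  exact ⟨w, h, h', congrArg (Sigma.mk p.1) hw.symm⟩

/-- The differential of `φ` in the frames of the charts centred at `x₀` and `φ x₀`. -/
def localDifferential (φ : M → M) (x₀ x : M) : Euc d →L[ℝ] Euc d :=
  inTangentCoordinates (𝓡 d) (𝓡 d) id φ (mfderiv (𝓡 d) (𝓡 d) φ) x₀ x

theorem localDifferential_apply (φ : M → M) {x₀ x : M} (hx : x ∈ (chartAt (Euc d) x₀).source)
    (hx' : φ x ∈ (chartAt (Euc d) (φ x₀)).source) (v : TangentSpace (𝓡 d) x) :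
    localDifferential φ x₀ x (frameChange (𝓡 d) x₀ x v) =
      frameChange (𝓡 d) (φ x₀) (φ x) (mfderiv (𝓡 d) (𝓡 d) φ x v) := by
  rw [frameChange_eq hx, frameChange_eq hx']
  unfold localDifferential inTangentCoordinates ContinuousLinearMap.inCoordinates
  have := (trivializationAt (Euc d) (TangentSpace (𝓡 d) : M → Type _) x₀).symmL_continuousLinearMapAt
          (R := ℝ) hx v
  exact congrArg (fun v => (trivializationAt (Euc d) (TangentSpace (𝓡 d) : M → Type _) (φ x₀)).continuousLinearMapAt ℝ (φ x) (mfderiv (𝓡 d) (𝓡 d) φ x v)) this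

/-- The differential of a C² map is C¹ in coordinates. This is where two derivatives of φ are used.
-/
theorem lipschitzNear_localDifferential {n : ℕ∞ω} (hn : 2 ≤ n) (φ : M ≃ₘ^n⟮𝓡 d, 𝓡 d⟯ M) (x₀ : M) :
    LipschitzNear (fun ξ => localDifferential (d := d) φ x₀ ((extChartAt (𝓡 d) x₀).symm ξ))
      (extChartAt (𝓡 d) x₀ x₀) := by
  have h : ContMDiffAt (𝓡 d) 𝓘(ℝ, Euc d →L[ℝ] Euc d) 1 (localDifferential (d := d) φ x₀) x₀ :=
    ((φ.contMDiff x₀).of_le hn).mfderiv_const (m := 1) (by norm_num)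
  apply lipschitzNear_of_contDiffAt
  rw [contMDiffAt_iff] at h
  have h2 := h.2
  rw [ModelWithCorners.range_eq_univ, contDiffWithinAt_univ] at h2
  exact h2

theorem lipschitzNear_writtenInExtChartAt {n : ℕ∞ω} (hn : 2 ≤ n) (φ : M ≃ₘ^n⟮𝓡 d, 𝓡 d⟯ M) (x₀ : M) :
    LipschitzNear (fun ξ => extChartAt (𝓡 d) (φ x₀) (φ ((extChartAt (𝓡 d) x₀).symm ξ)))
      (extChartAt (𝓡 d) x₀ x₀) := by
  have h := ((φ.contMDiff x₀).of_le (m := 1) (le_trans (by norm_num) hn))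
  apply lipschitzNear_of_contDiffAt
  have h2 := (contMDiffAt_iff.1 h).2
  rw [ModelWithCorners.range_eq_univ, contDiffWithinAt_univ] at h2
  exact h2

namespace CompactifiedTangentBundle

/-- The extended differential in coordinates. -/
def localExtendedDifferential (φ : M → M) (x₀ : M) (c : Euc d × (ℝ × Euc d)) :
    Euc d × (ℝ × Euc d) :=
  (extChartAt (𝓡 d) (φ x₀) (φ ((extChartAt (𝓡 d) x₀).symm c.1)),
    normalize (c.2.1, localDifferential φ x₀ ((extChartAt (𝓡 d) x₀).symm c.1) c.2.2))

/-- The differential acts linearly on representatives, and the scale lost by passing to the unit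
vector is removed again by the final normalization. -/
theorem coord_extendedDifferential {n : ℕ∞ω} (hn : n ≠ 0) (φ : M ≃ₘ^n⟮𝓡 d, 𝓡 d⟯ M) {x₀ : M}
    {p : CompactifiedTangentBundle d M} (hp : p.1 ∈ (chartAt (Euc d) x₀).source)
    (hp' : φ p.1 ∈ (chartAt (Euc d) (φ x₀)).source) :
    coord (φ x₀) (extendedDifferential hn φ p) = localExtendedDifferential φ x₀ (coord x₀ p) := by
  obtain ⟨w, h, h', hw⟩ := exists_of p
  have hx : (extChartAt (𝓡 d) x₀).symm (extChartAt (𝓡 d) x₀ p.1) = p.1 :=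
    (extChartAt (𝓡 d) x₀).left_inv (by rwa [extChartAt_source])
  refine Prod.ext (congrArg (fun x => extChartAt (𝓡 d) (φ x₀) (φ x)) hx.symm) ?_
  change rayCoord (φ x₀) (extendedDifferential hn φ p) =
    normalize ((rayCoord x₀ p).1, localDifferential φ x₀ _ (rayCoord x₀ p).2)
  have hx2 : (extChartAt (𝓡 d) x₀).symm (coord x₀ p).1 = p.1 := hx
  rw [hx2]
  have h1 : rayCoord (φ x₀) (extendedDifferential hn φ p) = normalize (w.1,
      (frameChange (𝓡 d) (φ x₀) (φ p.1) (mfderiv (𝓡 d) (𝓡 d) φ p.1 w.2) : Euc d)) := by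
    conv_lhs => rw [hw]
    rw [extendedDifferential_of hn φ p.1 h h']
    refine rayCoord_of (φ x₀) (φ p.1)
      (w := ((w.1, mfderiv (𝓡 d) (𝓡 d) φ p.1 w.2) : ℝ × TangentSpace (𝓡 d) (φ p.1))) ?_ h'
    intro h0
    have h3 := congrArg Prod.fst h0
    have h4 := congrArg Prod.snd h0
    exact h (Prod.ext h3 ((φ.mfderivToContinuousLinearEquiv hn p.1).map_eq_zero_iff.1 h4))
  have h2 : rayCoord x₀ p = normalize (w.1, (frameChange (𝓡 d) x₀ p.1 w.2 : Euc d)) := by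
    conv_lhs => rw [hw]
    exact rayCoord_of x₀ p.1 h h'
  have hne : ((w.1, (frameChange (𝓡 d) x₀ p.1 w.2 : Euc d)) : ℝ × Euc d) ≠ 0 := by
    intro h0
    have h3 := congrArg Prod.fst h0
    have h4 := congrArg Prod.snd h0
    exact h (Prod.ext h3 ((frameChange (𝓡 d) x₀ p.1).map_eq_zero_iff.1 h4))
  rw [h1, h2, ← localDifferential_apply φ hp hp']
  rw [← normalize_smul (inv_pos.2 (norm_pos_iff.2 hne))]
  congr 1
  refine Prod.ext rfl ?_
  exact (map_smul (localDifferential φ x₀ p.1) _ _).symm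

theorem lipschitzNear_localExtendedDifferential {n : ℕ∞ω} (hn : 2 ≤ n) (φ : M ≃ₘ^n⟮𝓡 d, 𝓡 d⟯ M)
    (z : CompactifiedTangentBundle d M) :
    LipschitzNear (localExtendedDifferential φ z.1) (coord z.1 z) := by
  have h1 := lipschitzNear_writtenInExtChartAt hn φ z.1
  have h2 := lipschitzNear_localDifferential hn φ z.1
  have hn0 : n ≠ 0 := by rintro rfl; simp at hn
  have h1' := LipschitzNear.comp (a := coord z.1 z) (f := Prod.fst) h1
    (lipschitzNear_of_contDiffAt contDiffAt_fst)
  refine LipschitzNear.prodMk h1' ?_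
  have h3 : LipschitzNear (fun c : Euc d × (ℝ × Euc d) =>
      (localDifferential φ z.1 ((extChartAt (𝓡 d) z.1).symm c.1), c.2)) (coord z.1 z) :=
    (LipschitzNear.comp (a := coord z.1 z) (f := Prod.fst) h2
      (lipschitzNear_of_contDiffAt contDiffAt_fst)).prodMk
      (lipschitzNear_of_contDiffAt contDiffAt_snd)
  have h4 : LipschitzNear (fun c : (Euc d →L[ℝ] Euc d) × (ℝ × Euc d) => ((c.2.1, c.1 c.2.2) : ℝ × Euc d))
      (localDifferential φ z.1 ((extChartAt (𝓡 d) z.1).symm (coord z.1 z).1), (coord z.1 z).2) := by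
    apply lipschitzNear_of_contDiffAt
    apply ContDiff.contDiffAt
    fun_prop
  refine LipschitzNear.comp (g := normalize) (f := fun c : Euc d × (ℝ × Euc d) => ((c.2.1,
    localDifferential φ z.1 ((extChartAt (𝓡 d) z.1).symm c.1) c.2.2) : ℝ × Euc d)) ?_ (LipschitzNear.comp (f := fun c : Euc d × (ℝ × Euc d) =>
      (localDifferential φ z.1 ((extChartAt (𝓡 d) z.1).symm c.1), c.2)) h4 h3)
  apply lipschitzNear_normalize
  -- Normalization is Lipschitz only away from 0; the image vector is nonzero because dφ is
  -- injective.
  intro h0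
  have h5 := congrArg Prod.fst h0
  have h6 := congrArg Prod.snd h0
  apply halfSphere_ne_zero (rayCoord_mem z.1 z)
  refine Prod.ext h5 ?_
  have hx : (extChartAt (𝓡 d) z.1).symm (coord z.1 z).1 = z.1 := extChartAt_to_inv z.1
  dsimp only at h6
  rw [hx] at h6
  obtain ⟨v, hv⟩ := (frameChange (𝓡 d) z.1 z.1).surjective (coord z.1 z).2.2
  have h9 := (localDifferential_apply (d := d) φ (mem_chart_source (Euc d) z.1)
    (mem_chart_source (Euc d) (φ z.1)) v).symm.trans
      ((congrArg (localDifferential (d := d) φ z.1 z.1) hv).trans h6)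
  have h7 := (frameChange (𝓡 d) (φ z.1) (φ z.1)).map_eq_zero_iff.1 h9
  have h8 := (φ.mfderivToContinuousLinearEquiv hn0 z.1).map_eq_zero_iff.1 h7
  exact (hv.symm.trans (congrArg (frameChange (𝓡 d) z.1 z.1) h8)).trans
    (map_zero (frameChange (𝓡 d) z.1 z.1))

theorem continuous_extendedDifferential {n : ℕ∞ω} (hn : 2 ≤ n) (hn0 : n ≠ 0)
    (φ : M ≃ₘ^n⟮𝓡 d, 𝓡 d⟯ M) : Continuous (extendedDifferential hn0 φ) := by
  rw [continuous_iff_continuousAt]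
  intro z
  have hc := ((lipschitzNear_localExtendedDifferential hn φ z).continuousAt.comp
    (f := coord z.1) (continuousAt_coord z))
  have hs : ∀ᶠ p in 𝓝 z, p.1 ∈ (chartAt (Euc d) z.1).source ∧
      φ p.1 ∈ (chartAt (Euc d) (φ z.1)).source :=
    (continuous_fst.continuousAt.eventually (chart_source_mem_nhds (Euc d) z.1)).and
      ((φ.continuous.comp continuous_fst).continuousAt.eventually
        (chart_source_mem_nhds (Euc d) (φ z.1)))
  have h1 : ContinuousWithinAt (fun q : M × (ℝ × Euc d) => rayPoint (φ z.1) q.1 q.2)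
      ((chartAt (Euc d) (φ z.1)).source ×ˢ halfSphere d)
      (φ z.1, rayCoord (φ z.1) (extendedDifferential hn0 φ z)) :=
    continuousOn_rayPoint (φ z.1) _ ⟨mem_chart_source _ _, rayCoord_mem _ _⟩
  have h2 : Tendsto (fun p => ((φ p.1, rayCoord (φ z.1) (extendedDifferential hn0 φ p)) :
      M × (ℝ × Euc d))) (𝓝 z) (𝓝[(chartAt (Euc d) (φ z.1)).source ×ˢ halfSphere d]
      (φ z.1, rayCoord (φ z.1) (extendedDifferential hn0 φ z))) := by
    refine tendsto_nhdsWithin_iff.2 ⟨?_, ?_⟩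
    · refine ContinuousAt.prodMk (φ.continuous.comp continuous_fst).continuousAt ?_
      have h3 : ContinuousAt (fun p => (localExtendedDifferential φ z.1 (coord z.1 p)).2) z :=
        continuousAt_snd.comp (f := fun p => localExtendedDifferential φ z.1 (coord z.1 p)) hc
      refine h3.congr ?_
      filter_upwards [hs] with p hp
      rw [← coord_extendedDifferential hn0 φ hp.1 hp.2]
      rfl
    · filter_upwards [hs] with p hp
      exact ⟨hp.2, rayCoord_mem _ _⟩
  have h3 := h1.tendsto.comp h2
  have e : ∀ p, rayPoint (φ z.1) (φ p.1) (rayCoord (φ z.1) (extendedDifferential hn0 φ p)) =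
      extendedDifferential hn0 φ p := fun p => rayPoint_rayCoord (φ z.1) (extendedDifferential hn0 φ p)
  simp only [comp_def, e] at h3
  exact h3

theorem eventually_dist_extendedDifferential_le [T2Space M] {n : ℕ∞ω} (hn : 2 ≤ n) (hn0 : n ≠ 0)
    (φ : M ≃ₘ^n⟮𝓡 d, 𝓡 d⟯ M)
    (g : SmoothMetric (compactifiedModel d) (CompactifiedTangentBundle d M))
    (z : CompactifiedTangentBundle d M) : ∃ C : ℝ≥0, ∀ᶠ p in 𝓝 z ×ˢ 𝓝 z,
      g.dist (extendedDifferential hn0 φ p.1) (extendedDifferential hn0 φ p.2) ≤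
        C * g.dist p.1 p.2 := by
  have hc := (continuous_extendedDifferential hn hn0 φ).continuousAt (x := z)
  obtain ⟨C₁, h₁⟩ := eventually_dist_le_coord g (extendedDifferential hn0 φ z)
  obtain ⟨C₂, h₂⟩ := eventually_edist_coord_le g z
  obtain ⟨C₃, h₃⟩ := (lipschitzNear_localExtendedDifferential hn φ z).eventually
  have h₁' := (Filter.Tendsto.prodMap hc hc).eventually h₁
  have h₃' := (Filter.Tendsto.prodMap (continuousAt_coord z) (continuousAt_coord z)).eventually h₃
  have hs : ∀ᶠ p in 𝓝 z, p.1 ∈ (chartAt (Euc d) z.1).source ∧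
      φ p.1 ∈ (chartAt (Euc d) (φ z.1)).source :=
    (continuous_fst.continuousAt.eventually (chart_source_mem_nhds (Euc d) z.1)).and
      ((φ.continuous.comp continuous_fst).continuousAt.eventually
        (chart_source_mem_nhds (Euc d) (φ z.1)))
  refine ⟨C₁ * (C₃ * C₂), ?_⟩
  filter_upwards [h₁', h₂, h₃', prod_mem_prod hs hs] with p k₁ k₂ k₃ k₄
  refine k₁.trans ?_
  rw [ENNReal.coe_mul, ENNReal.coe_mul, mul_assoc, mul_assoc]
  gcongr
  have e1 := coord_extendedDifferential hn0 φ k₄.1.1 k₄.1.2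
  have e2 := coord_extendedDifferential hn0 φ k₄.2.1 k₄.2.2
  have e3 : (extendedDifferential hn0 φ z).1 = φ z.1 := rfl
  simp only [Prod.map_fst, Prod.map_snd]
  rw [e3, e1, e2]
  refine k₃.trans ?_
  gcongr
  exact k₂

end CompactifiedTangentBundle

open CompactifiedTangentBundle in
theorem exists_isLipschitzOver [T2Space M] {n : ℕ∞ω} (hn : 2 ≤ n) (hn0 : n ≠ 0)
    (φ : M ≃ₘ^n⟮𝓡 d, 𝓡 d⟯ M) {K : Set M} (hK : IsCompact K)
    (g : SmoothMetric (compactifiedModel d) (CompactifiedTangentBundle d M)) :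
    ∃ Lam : ℝ, 1 ≤ Lam ∧ IsLipschitzOver hn0 φ K g Lam := by
  have hZ := CompactifiedTangentBundle.isCompact_preimage (d := d) hK
  have hcont := continuous_extendedDifferential hn hn0 φ
  obtain ⟨C, ε, hε, hC⟩ : ∃ (C : ℝ≥0) (ε : ℝ≥0), 0 < ε ∧
      ∀ p ∈ (fun p : CompactifiedTangentBundle d M => p.1) ⁻¹' K, ∀ q, g.dist p q < ε →
        g.dist (extendedDifferential hn0 φ p) (extendedDifferential hn0 φ q) ≤ C * g.dist p q := by
    let := g.pseudoEMetricSpace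
    refine exists_uniform_of_eventually hZ (fun C p q =>
      g.dist (extendedDifferential hn0 φ p) (extendedDifferential hn0 φ q) ≤ C * g.dist p q) ?_ ?_
    · intro C C' p q h h'
      refine h'.trans ?_
      gcongr
    · intro z _
      exact eventually_dist_extendedDifferential_le hn hn0 φ g z
  obtain ⟨D, hD⟩ := exists_bound_of_locally_bounded hZ
    (fun p q => g.dist (extendedDifferential hn0 φ p) (extendedDifferential hn0 φ q))
    (fun p q => g.dist_comm _ _) (fun p q r => g.dist_triangle _ _ _) (by
      intro z _
      refine ⟨1, mem_nhdsWithin_of_mem_nhds ?_⟩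
      filter_upwards [hcont.continuousAt.eventually
        (g.eventually_dist_lt (extendedDifferential hn0 φ z) (c := 1) one_pos)] with p hp
      simpa using hp.le)
  -- C handles pairs closer than ε. For other pairs at finite distance the images are at distance at
  -- most D, and D = (D/ε) ε. The 1 keeps the constant positive, so that its product with an
  -- infinite distance is infinite.
  refine ⟨max 1 (max C (D / ε) : ℝ≥0), le_max_left _ _, fun p q hp hq => ?_⟩
  have hmax : ENNReal.ofReal (max 1 ((max C (D / ε) : ℝ≥0) : ℝ)) =
      max 1 (max (C : ℝ≥0∞) ((D / ε : ℝ≥0) : ℝ≥0∞)) := by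
    rw [ENNReal.ofReal_max, ENNReal.ofReal_one, ENNReal.ofReal_coe_nnreal, ENNReal.coe_max]
  rw [hmax]
  by_cases h1 : g.dist p q < ε
  · refine (hC p hp q h1).trans ?_
    gcongr
    exact (le_max_left _ _).trans (le_max_right _ _)
  by_cases h2 : g.dist p q = ⊤
  · rw [h2, ENNReal.mul_top]
    · exact le_top
    · exact (zero_lt_one.trans_le (le_max_left _ _)).ne'
  -- A curve joining p to q is mapped to a curve joining the images, whose distance is therefore
  -- finite.
  obtain ⟨γ, hγ, hγ0, hγ1⟩ := g.exists_continuous_of_dist_lt_top (lt_top_iff_ne_top.2 h2)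
  have h3 := g.dist_lt_top_of_continuous (hcont.comp hγ) 0 1
  simp only [comp_apply, hγ0, hγ1] at h3
  refine (hD p hp q hq h3).trans ?_
  calc (D : ℝ≥0∞) = ((D / ε : ℝ≥0) : ℝ≥0∞) * ε := by
        rw [← ENNReal.coe_mul, div_mul_cancel₀ _ hε.ne']
    _ ≤ _ := by
      gcongr
      · exact (le_max_right _ _).trans (le_max_right _ _)
      · exact not_lt.1 h1

end HyperbolicHolder

namespace HyperbolicHolder

open Filter Topology

variable {d : ℕ} {M : Type*} [TopologicalSpace M] [ChartedSpace (Euc d) M]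
  [IsManifold (𝓡 d) ∞ M]

/-! ### Quantitative comparison of fibre coordinates with the distance. -/

section Coordinates

/-- Makes a local estimate uniform in a parameter on a compact set, here the unit vectors of a
fibre. -/
theorem exists_eventually_le_of_isCompact {X Y : Type*} [TopologicalSpace Y] {l : Filter X}
    {S : Set Y} (hS : IsCompact S) (F : X → Y → ℝ≥0∞) (G : X → ℝ≥0∞)
    (h : ∀ w ∈ S, ∃ C : ℝ≥0, ∀ᶠ q in l ×ˢ 𝓝[S] w, F q.1 q.2 ≤ C * G q.1) :
    ∃ C : ℝ≥0, ∀ᶠ p in l, ∀ w ∈ S, F p w ≤ C * G p := by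
  refine hS.induction_on (p := fun s => ∃ C : ℝ≥0, ∀ᶠ p in l, ∀ w ∈ s, F p w ≤ C * G p)
    ⟨0, by simp⟩ ?_ ?_ ?_
  · rintro s t hst ⟨C, hC⟩
    exact ⟨C, hC.mono fun p hp w hw => hp w (hst hw)⟩
  · rintro s t ⟨C, hC⟩ ⟨C', hC'⟩
    refine ⟨max C C', ?_⟩
    filter_upwards [hC, hC'] with p hp hp'
    rintro w (hw | hw)
    · refine (hp w hw).trans ?_
      gcongr
      exact le_max_left _ _
    · refine (hp' w hw).trans ?_
      gcongr
      exact le_max_right _ _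
  · intro w hw
    obtain ⟨C, hC⟩ := h w hw
    obtain ⟨U, hU, V, hV, hUV⟩ := mem_prod_iff.1 hC
    exact ⟨V, hV, C, mem_of_superset hU fun p hp w hw => hUV (mk_mem_prod hp hw)⟩

namespace CompactifiedTangentBundle

theorem coord_rayPoint (x₀ x : M) {w : ℝ × Euc d} (hw : w ∈ halfSphere d) :
    coord x₀ (rayPoint x₀ x w) = (extChartAt (𝓡 d) x₀ x, w) :=
  Prod.ext rfl (rayCoord_rayPoint x₀ x hw)

/-- The ray `[t, v]` over `x`. -/
def ray (x : M) (t : ℝ) (v : TangentSpace (𝓡 d) x) : CompactifiedTangentBundle d M :=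
  ⟨x, HalfRay.of (t, v)⟩

theorem ray_eq_rayPoint (x₀ : M) {x : M} {t : ℝ} {v : TangentSpace (𝓡 d) x} (h : t ≠ 0 ∨ v ≠ 0)
    (ht : 0 ≤ t) :
    ray x t v = rayPoint x₀ x (normalize (t, (frameChange (𝓡 d) x₀ x v : Euc d))) := by
  have hne : ((t, v) : ℝ × TangentSpace (𝓡 d) x) ≠ 0 := by
    intro h0
    have h1 := congrArg Prod.fst h0
    have h2 := congrArg Prod.snd h0
    exact h.elim (fun h => h h1) (fun h => h h2)
  rw [← rayPoint_rayCoord x₀ (ray x t v)]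
  exact congrArg (rayPoint x₀ x) (rayCoord_of x₀ x hne ht)

theorem coord_ray (x₀ : M) {x : M} {t : ℝ} {v : TangentSpace (𝓡 d) x} (h : t ≠ 0 ∨ v ≠ 0)
    (ht : 0 ≤ t) :
    coord x₀ (ray x t v) =
      (extChartAt (𝓡 d) x₀ x, normalize (t, (frameChange (𝓡 d) x₀ x v : Euc d))) := by
  have hne : ((t, v) : ℝ × TangentSpace (𝓡 d) x) ≠ 0 := by
    intro h0
    have h1 := congrArg Prod.fst h0
    have h2 := congrArg Prod.snd h0
    exact h.elim (fun h => h h1) (fun h => h h2)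
  exact Prod.ext rfl (rayCoord_of x₀ x hne ht)

variable (g : SmoothMetric (compactifiedModel d) (CompactifiedTangentBundle d M))

/-- Carrying a ray from one base point to another with fixed frame coordinates costs no more than a
multiple of the base displacement, uniformly in the ray including infinity. -/
theorem exists_dist_rayPoint_le (x₀ : M) : ∃ C : ℝ≥0, ∀ᶠ p in 𝓝 x₀ ×ˢ 𝓝 x₀, ∀ w ∈ halfSphere d,
    g.dist (rayPoint x₀ p.1 w) (rayPoint x₀ p.2 w) ≤
      C * edist (extChartAt (𝓡 d) x₀ p.1) (extChartAt (𝓡 d) x₀ p.2) := by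
  refine exists_eventually_le_of_isCompact (X := M × M) (Y := ℝ × Euc d) (l := 𝓝 x₀ ×ˢ 𝓝 x₀)
    isCompact_halfSphere (fun p w => g.dist (rayPoint x₀ p.1 w) (rayPoint x₀ p.2 w))
    (fun p => edist (extChartAt (𝓡 d) x₀ p.1) (extChartAt (𝓡 d) x₀ p.2)) fun w₀ hw₀ => ?_
  obtain ⟨C, hC⟩ := eventually_dist_le_coord g (rayPoint x₀ x₀ w₀)
  have h1 := (continuousOn_rayPoint (d := d) x₀ (x₀, w₀) ⟨mem_chart_source _ _, hw₀⟩).tendsto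
  have h2 : ∀ᶠ q in (𝓝[(chartAt (Euc d) x₀).source ×ˢ halfSphere d] (x₀, w₀)) ×ˢ
      (𝓝[(chartAt (Euc d) x₀).source ×ˢ halfSphere d] (x₀, w₀)),
      g.dist (rayPoint x₀ q.1.1 q.1.2) (rayPoint x₀ q.2.1 q.2.2) ≤
        C * edist (coord x₀ (rayPoint x₀ q.1.1 q.1.2)) (coord x₀ (rayPoint x₀ q.2.1 q.2.2)) :=
    (h1.prodMap h1).eventually hC
  rw [nhdsWithin_prod_eq, (chartAt (Euc d) x₀).open_source.nhdsWithin_eq (mem_chart_source _ _)]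
    at h2
  have hd : Tendsto (fun q : (M × M) × (ℝ × Euc d) => ((q.1.1, q.2), (q.1.2, q.2)))
      ((𝓝 x₀ ×ˢ 𝓝 x₀) ×ˢ 𝓝[halfSphere d] w₀)
      ((𝓝 x₀ ×ˢ 𝓝[halfSphere d] w₀) ×ˢ (𝓝 x₀ ×ˢ 𝓝[halfSphere d] w₀)) :=
    ((tendsto_fst.comp tendsto_fst).prodMk tendsto_snd).prodMk
      ((tendsto_snd.comp tendsto_fst).prodMk tendsto_snd)
  have hm : ∀ᶠ q in (𝓝 x₀ ×ˢ 𝓝 x₀) ×ˢ 𝓝[halfSphere d] w₀, q.2 ∈ halfSphere d :=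
    tendsto_snd.eventually self_mem_nhdsWithin
  refine ⟨C, ?_⟩
  filter_upwards [hd.eventually h2, hm] with q h3 hw'
  refine h3.trans ?_
  rw [coord_rayPoint x₀ q.1.1 hw', coord_rayPoint x₀ q.1.2 hw', Prod.edist_eq]
  simp

theorem exists_dist_rayPoint_fibre_le (x : M) {w₀ : ℝ × Euc d} (hw₀ : w₀ ∈ halfSphere d) :
    ∃ C : ℝ≥0, ∀ᶠ w in 𝓝[halfSphere d] w₀,
      g.dist (rayPoint x x w₀) (rayPoint x x w) ≤ C * edist w₀ w := by
  obtain ⟨C, hC⟩ := eventually_dist_le_coord g (rayPoint x x w₀)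
  have h1 := continuousOn_rayPoint (d := d) x (x, w₀) ⟨mem_chart_source _ _, hw₀⟩
  have h2 : Tendsto (fun w => rayPoint x x w) (𝓝[halfSphere d] w₀) (𝓝 (rayPoint x x w₀)) := by
    refine h1.tendsto.comp (f := fun w => (x, w)) (tendsto_nhdsWithin_iff.2 ⟨?_, ?_⟩)
    · exact tendsto_const_nhds.prodMk_nhds (tendsto_id.mono_left nhdsWithin_le_nhds)
    · filter_upwards [self_mem_nhdsWithin] with w hw
      exact ⟨mem_chart_source _ _, hw⟩
  have h3 : ∀ᶠ w in 𝓝[halfSphere d] w₀, g.dist (rayPoint x x w₀) (rayPoint x x w) ≤ C *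
      edist (coord (rayPoint x x w₀).1 (rayPoint x x w₀)) (coord (rayPoint x x w₀).1 (rayPoint x x w)) :=
    (tendsto_const_nhds (x := rayPoint x x w₀)).prodMk h2 |>.eventually hC
  refine ⟨C, ?_⟩
  filter_upwards [h3, self_mem_nhdsWithin] with w hw hw'
  have e : ∀ w' ∈ halfSphere d, coord (rayPoint x x w₀).1 (rayPoint x x w') =
      (extChartAt (𝓡 d) x x, w') := fun w' h => coord_rayPoint x x h
  rw [e w hw', e w₀ hw₀, Prod.edist_eq] at hw
  simpa using hw

/-- Uniformly over a compact set, the coordinates of `CompactifiedTangentBundle.coord` are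
controlled by the Riemannian distance. -/
theorem exists_uniform_coord [T2Space M] (g₀ : SmoothMetric (𝓡 d) M) {K : Set M} (hK : IsCompact K) :
    ∃ (C : ℝ≥0) (ε : ℝ≥0), 0 < ε ∧ ∀ p q : CompactifiedTangentBundle d M, p.1 ∈ K →
      g.dist p q < ε → ∃ x₀ : M,
        (∀ v : TangentSpace (𝓡 d) p.1, ‖(frameChange (𝓡 d) x₀ p.1 v : Euc d)‖ ≤ C * g₀.norm v) ∧
        (∀ v : TangentSpace (𝓡 d) q.1, g₀.norm v ≤ C * ‖(frameChange (𝓡 d) x₀ q.1 v : Euc d)‖) ∧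
        edist (coord x₀ p) (coord x₀ q) ≤ C * g.dist p q := by
  let := g.pseudoEMetricSpace
  refine (exists_uniform_of_eventually (CompactifiedTangentBundle.isCompact_preimage (d := d) hK)
    (fun C p q => ∃ x₀ : M,
        (∀ v : TangentSpace (𝓡 d) p.1, ‖(frameChange (𝓡 d) x₀ p.1 v : Euc d)‖ ≤ C * g₀.norm v) ∧
        (∀ v : TangentSpace (𝓡 d) q.1, g₀.norm v ≤ C * ‖(frameChange (𝓡 d) x₀ q.1 v : Euc d)‖) ∧
        edist (coord x₀ p) (coord x₀ q) ≤ C * g.dist p q) ?_ ?_).imp fun C ⟨ε, hε, h⟩ =>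
          ⟨ε, hε, fun p q hp hpq => h p hp q hpq⟩
  · rintro C C' p q hC ⟨x₀, h1, h2, h3⟩
    refine ⟨x₀, fun v => (h1 v).trans ?_, fun v => (h2 v).trans ?_, h3.trans ?_⟩
    · have := g₀.norm_nonneg v
      gcongr
    · gcongr
    · gcongr
  · intro z _
    obtain ⟨C₁, h₁⟩ := g₀.eventually_norm_le z.1
    obtain ⟨C₂, h₂⟩ := eventually_edist_coord_le g z
    have h₁' := continuous_fst.continuousAt.eventually h₁
    refine ⟨max C₁ C₂, ?_⟩
    filter_upwards [h₂, prod_mem_prod h₁' h₁'] with p k₂ k₁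
    refine ⟨z.1, fun v => (k₁.1 v).1.trans ?_, fun v => (k₁.2 v).2.trans ?_, k₂.trans ?_⟩
    · have := g₀.norm_nonneg v
      gcongr
      exact le_max_left _ _
    · gcongr
      exact le_max_left _ _
    · gcongr
      exact le_max_right _ _

/-- With m, l the norms of (1,a), (1,b), the first components give 1/l ≥ 1/m − D ≥ 1/(2A), so l ≤
2A; the second components give ‖b‖/l ≤ ‖a‖ + D. -/
theorem norm_le_of_normalize_close {V : Type*} [NormedAddCommGroup V] [NormedSpace ℝ V] {a b : V}
    {A D : ℝ} (hA : 1 ≤ A) (ha : ‖a‖ ≤ A) (hD : D ≤ 1 / (2 * A))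
    (h : ‖normalize ((1, a) : ℝ × V) - normalize ((1, b) : ℝ × V)‖ ≤ D) :
    ‖b‖ ≤ 2 * A * (‖a‖ + D) := by
  set m := ‖((1, a) : ℝ × V)‖ with hm
  set l := ‖((1, b) : ℝ × V)‖ with hl
  have hm1 : 1 ≤ m := by rw [hm, Prod.norm_def]; simp
  have hl1 : 1 ≤ l := by rw [hl, Prod.norm_def]; simp
  have hmA : m ≤ A := by rw [hm, Prod.norm_def]; simp [hA, ha]
  have h1 : ‖m⁻¹ - l⁻¹‖ ≤ D := by
    have := (norm_fst_le _).trans h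
    simpa [normalize, ← hm, ← hl] using this
  have h2 : ‖m⁻¹ • a - l⁻¹ • b‖ ≤ D := by
    have := (norm_snd_le _).trans h
    simpa [normalize, ← hm, ← hl] using this
  have hm0 : 0 < m := by linarith
  have hl0 : 0 < l := by linarith
  have hA0 : 0 < A := by linarith
  have h3 : (2 * A)⁻¹ ≤ l⁻¹ := by
    rw [Real.norm_eq_abs] at h1
    have h4 := (abs_le.1 h1).2
    have h5 : A⁻¹ ≤ m⁻¹ := inv_anti₀ hm0 hmA
    have h6 : A⁻¹ = 2 * (2 * A)⁻¹ := by field_simp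
    rw [one_div] at hD
    linarith
  have h4 : l ≤ 2 * A := by
    rwa [inv_le_inv₀ (by positivity) hl0] at h3
  have h5 : ‖l⁻¹ • b‖ ≤ ‖a‖ + D := by
    have e : l⁻¹ • b = m⁻¹ • a - (m⁻¹ • a - l⁻¹ • b) := by abel
    rw [e]
    refine (norm_sub_le _ _).trans (add_le_add ?_ h2)
    rw [norm_smul, Real.norm_of_nonneg (by positivity)]
    exact mul_le_of_le_one_left (norm_nonneg _) (inv_le_one_of_one_le₀ hm1)
  have h6 : ‖b‖ = l * ‖l⁻¹ • b‖ := by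
    rw [norm_smul, Real.norm_of_nonneg (by positivity), ← mul_assoc, mul_inv_cancel₀ hl0.ne', one_mul]
  rw [h6]
  gcongr

/-- The first component of the normalized (t,a) is t / max(t,‖a‖) ≤ D; since D < 1 the maximum must
be ‖a‖. -/
theorem le_of_normalize_close {V : Type*} [NormedAddCommGroup V] [NormedSpace ℝ V] {a : V}
    {t D : ℝ} (ht : 0 < t) (hD : D < 1)
    (h : ‖normalize ((0, a) : ℝ × V) - normalize ((t, a) : ℝ × V)‖ ≤ D) :
    t ≤ D * ‖a‖ := by
  set l := ‖((t, a) : ℝ × V)‖ with hl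
  have hl2 : l = max t ‖a‖ := by rw [hl, Prod.norm_def]; simp [abs_of_pos ht]
  have hl0 : 0 < l := ht.trans_le (by rw [hl2]; exact le_max_left _ _)
  have h1 : l⁻¹ * t ≤ D := by
    have := (norm_fst_le _).trans h
    simp only [normalize, ← hl, Prod.fst_sub, Prod.smul_fst, smul_eq_mul, mul_zero, zero_sub,
      norm_neg] at this
    rwa [Real.norm_of_nonneg (by positivity)] at this
  have h2 : t ≤ D * l := by
    rw [inv_mul_le_iff₀ hl0] at h1
    linarith
  rcases le_total t ‖a‖ with h3 | h3
  · rwa [hl2, max_eq_right h3] at h2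
  · rw [hl2, max_eq_left h3] at h2
    nlinarith

/-- Near a finite vector of bounded length, fibre coordinates are controlled by the distance. -/
theorem exists_norm_le_of_dist_le [T2Space M] (g₀ : SmoothMetric (𝓡 d) M) {K : Set M}
    (hK : IsCompact K) (R : ℝ) : ∃ C ε : ℝ, 0 < C ∧ 0 < ε ∧ ∀ x ∈ K, ∀ (y : M)
      (v : TangentSpace (𝓡 d) x) (v' : TangentSpace (𝓡 d) y) (D : ℝ), 0 ≤ D → D < ε →
      g₀.norm v ≤ R → g.dist (ray x 1 v) (ray y 1 v') ≤ ENNReal.ofReal D →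
      g₀.norm v' ≤ C * (g₀.norm v + D) := by
  obtain ⟨C, ε, hε, h⟩ := exists_uniform_coord g g₀ hK
  have hε' : (0 : ℝ) < ε := hε
  set A : ℝ := 1 + C * |R| with hA
  have hA1 : 1 ≤ A := by rw [hA]; have : 0 ≤ (C : ℝ) * |R| := by positivity
                         linarith
  -- A bounds the frame norm of v; the radius ensures C D ≤ 1/(2A), as `norm_le_of_normalize_close`
  -- requires. The added ones keep everything positive if C = 0.
  refine ⟨C * (2 * A) * C + 1, min ε (1 / (2 * A * (C + 1))), by positivity, by positivity, ?_⟩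
  intro x hx y v v' D hD0 hD hv hdist
  have hD1 := hD.trans_le (min_le_left _ _)
  have hD2 := hD.trans_le (min_le_right _ _)
  have hlt : g.dist (ray x 1 v) (ray y 1 v') < ε := by
    refine hdist.trans_lt ?_
    rw [← ENNReal.ofReal_coe_nnreal]
    exact (ENNReal.ofReal_lt_ofReal_iff hε').2 hD1
  obtain ⟨x₀, h1, h2, h3⟩ := h (ray x 1 v) (ray y 1 v') hx hlt
  have h1 := h1 v
  have h2 := h2 v'
  rw [coord_ray x₀ (Or.inl one_ne_zero) zero_le_one, coord_ray x₀ (Or.inl one_ne_zero) zero_le_one,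
    Prod.edist_eq] at h3
  have h4 := (le_max_right _ _).trans (h3.trans (mul_le_mul_right hdist _))
  dsimp only at h4
  rw [edist_dist, ← ENNReal.ofReal_coe_nnreal, ← ENNReal.ofReal_mul (by positivity),
    ENNReal.ofReal_le_ofReal_iff (by positivity), dist_eq_norm] at h4
  have h5 := norm_le_of_normalize_close hA1 (h1.trans ?_) ?_ h4
  · have h8 : g₀.norm v' ≤ C * (2 * A * (C * g₀.norm v + C * D)) := by
      refine h2.trans (mul_le_mul_of_nonneg_left (h5.trans ?_) C.2)
      exact mul_le_mul_of_nonneg_left (add_le_add h1 le_rfl) (by positivity)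
    calc g₀.norm v' ≤ C * (2 * A * (C * g₀.norm v + C * D)) := h8
      _ = (C * (2 * A) * C) * (g₀.norm v + D) := by ring
      _ ≤ _ := by
        have := g₀.norm_nonneg v
        gcongr
        linarith
  · rw [hA]
    have := mul_le_mul_of_nonneg_left (hv.trans (le_abs_self R)) C.2
    have h6 : (C : ℝ) * |R| ≤ 1 + C * |R| := by linarith
    exact this.trans h6
  · have hC : (0 : ℝ) ≤ C := C.2
    rw [lt_div_iff₀ (by positivity)] at hD2
    rw [le_div_iff₀ (by positivity)]
    nlinarith [mul_nonneg hD0 (by linarith : 0 ≤ A)]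

/-- Near infinity, the radial coordinate is controlled by the distance. -/
theorem exists_le_norm_of_dist_le [T2Space M] (g₀ : SmoothMetric (𝓡 d) M) {K : Set M}
    (hK : IsCompact K) : ∃ C ε : ℝ, 0 < C ∧ 0 < ε ∧ ∀ x ∈ K, ∀
      (v : TangentSpace (𝓡 d) x) (t D : ℝ), v ≠ 0 → 0 < t → 0 ≤ D → D < ε →
      g.dist (ray x 0 v) (ray x t v) ≤ ENNReal.ofReal D → t ≤ C * D * g₀.norm v := by
  obtain ⟨C, ε, hε, h⟩ := exists_uniform_coord g g₀ hK
  have hε' : (0 : ℝ) < ε := hε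
  refine ⟨C * C + 1, min ε (1 / (C + 1)), by positivity, by positivity, ?_⟩
  intro x hx v t D hv ht hD0 hD hdist
  have hD1 := hD.trans_le (min_le_left _ _)
  have hD2 := hD.trans_le (min_le_right _ _)
  have hlt : g.dist (ray x 0 v) (ray x t v) < ε := by
    refine hdist.trans_lt ?_
    rw [← ENNReal.ofReal_coe_nnreal]
    exact (ENNReal.ofReal_lt_ofReal_iff hε').2 hD1
  obtain ⟨x₀, h1, -, h3⟩ := h (ray x 0 v) (ray x t v) hx hlt
  have h1 := h1 v
  rw [coord_ray x₀ (Or.inr hv) le_rfl, coord_ray x₀ (Or.inr hv) ht.le, Prod.edist_eq] at h3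
  have h4 := (le_max_right _ _).trans (h3.trans (mul_le_mul_right hdist _))
  dsimp only at h4
  rw [edist_dist, ← ENNReal.ofReal_coe_nnreal, ← ENNReal.ofReal_mul (by positivity),
    ENNReal.ofReal_le_ofReal_iff (by positivity), dist_eq_norm] at h4
  have hC : (0 : ℝ) ≤ C := C.2
  have h5 := le_of_normalize_close ht ?_ h4
  · calc t ≤ C * D * (C * g₀.norm v) := h5.trans (mul_le_mul_of_nonneg_left h1 (by positivity))
      _ = (C * C) * (D * g₀.norm v) := by ring
      _ ≤ (C * C + 1) * (D * g₀.norm v) := by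
        have := g₀.norm_nonneg v
        gcongr
        linarith
      _ = _ := by ring
  · rw [lt_div_iff₀ (by positivity)] at hD2
    nlinarith

end CompactifiedTangentBundle

end Coordinates

/-! ### Iterates of φ and of its extended differential. -/

section Iterates

variable {n : ℕ∞ω}

theorem mdifferentiableAt_iterate (hn : n ≠ 0) (φ : M ≃ₘ^n⟮𝓡 d, 𝓡 d⟯ M) (m : ℕ) (x : M) :
    MDifferentiableAt (𝓡 d) (𝓡 d) φ^[m] x := by
  induction m with
  | zero => exact mdifferentiableAt_id
  | succ m ih =>
    rw [iterate_succ']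
    exact (φ.mdifferentiable hn _).comp x ih

theorem mfderiv_iterate_succ (hn : n ≠ 0) (φ : M ≃ₘ^n⟮𝓡 d, 𝓡 d⟯ M) (m : ℕ) (x : M)
    (v : TangentSpace (𝓡 d) x) :
    mfderiv (𝓡 d) (𝓡 d) φ^[m + 1] x v =
      mfderiv (𝓡 d) (𝓡 d) φ (φ^[m] x) (mfderiv (𝓡 d) (𝓡 d) φ^[m] x v) := by
  have h3 := mfderiv_comp x (φ.mdifferentiable hn _) (mdifferentiableAt_iterate hn φ m x)
  rw [← iterate_succ'] at h3
  rw [h3]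
  rfl

theorem symm_iterate_iterate (φ : M ≃ₘ^n⟮𝓡 d, 𝓡 d⟯ M) (m : ℕ) (x : M) : φ.symm^[m] (φ^[m] x) = x :=
  (Function.LeftInverse.iterate φ.symm_apply_apply m) x

/-- The base points of the two sides are equal but not definitionally so; the equation is stated in
ℝᵈ, with which every tangent space coincides. -/
theorem mfderiv_symm_iterate_iterate (hn : n ≠ 0) (φ : M ≃ₘ^n⟮𝓡 d, 𝓡 d⟯ M) (m : ℕ) (x : M)
    (v : TangentSpace (𝓡 d) x) :
    (mfderiv (𝓡 d) (𝓡 d) φ.symm^[m] (φ^[m] x) (mfderiv (𝓡 d) (𝓡 d) φ^[m] x v) : Euc d) = v := by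
  have h3 := mfderiv_comp x (mdifferentiableAt_iterate hn φ.symm m (φ^[m] x))
    (mdifferentiableAt_iterate hn φ m x)
  have h4 : φ.symm^[m] ∘ φ^[m] = id := funext (symm_iterate_iterate φ m)
  rw [h4, mfderiv_id] at h3
  exact (DFunLike.congr_fun h3 v).symm

open CompactifiedTangentBundle in
theorem extendedDifferential_iterate_ray (hn : n ≠ 0) (φ : M ≃ₘ^n⟮𝓡 d, 𝓡 d⟯ M) (m : ℕ) (x : M)
    {t : ℝ} {v : TangentSpace (𝓡 d) x} (h : t ≠ 0 ∨ v ≠ 0) (ht : 0 ≤ t) :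
    (extendedDifferential hn φ)^[m] (ray x t v) =
      ray (φ^[m] x) t (mfderiv (𝓡 d) (𝓡 d) φ^[m] x v) := by
  induction m with
  | zero =>
    simp only [iterate_zero, mfderiv_id]
    rfl
  | succ m ih =>
    rw [iterate_succ_apply', ih]
    have hne : ((t, mfderiv (𝓡 d) (𝓡 d) φ^[m] x v) : ℝ × TangentSpace (𝓡 d) (φ^[m] x)) ≠ 0 := by
      intro h0
      have h1 := congrArg Prod.fst h0
      have h2 := congrArg Prod.snd h0
      refine h.elim (fun h => h h1) (fun h => h ?_)
      have h3 := mfderiv_symm_iterate_iterate hn φ m x v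
      rw [← h3]
      exact (congrArg (mfderiv (𝓡 d) (𝓡 d) φ.symm^[m] (φ^[m] x)) h2).trans (map_zero _)
    have h4 := extendedDifferential_of hn φ (φ^[m] x) hne ht
    refine h4.trans ?_
    have h5 : ∀ (y y' : M) (u u' : Euc d), y = y' → u = u' →
        (ray y t u : CompactifiedTangentBundle d M) = ray y' t u' := by
      rintro y _ u _ rfl rfl
      rfl
    exact h5 _ _ _ _ (iterate_succ_apply' φ m x).symm (mfderiv_iterate_succ hn φ m x v).symm

theorem dist_iterate_le (hn : n ≠ 0) {φ : M ≃ₘ^n⟮𝓡 d, 𝓡 d⟯ M} {K : Set M} (hK : MapsTo φ K K)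
    {g : SmoothMetric (compactifiedModel d) (CompactifiedTangentBundle d M)} {Lam : ℝ}
    (hLam : 0 ≤ Lam) (h : IsLipschitzOver hn φ K g Lam) (m : ℕ) {p q : CompactifiedTangentBundle d M}
    (hp : p.1 ∈ K) (hq : q.1 ∈ K) :
    g.dist ((extendedDifferential hn φ)^[m] p) ((extendedDifferential hn φ)^[m] q) ≤
      ENNReal.ofReal (Lam ^ m) * g.dist p q := by
  induction m generalizing p q with
  | zero => simp
  | succ m ih =>
    rw [iterate_succ_apply, iterate_succ_apply]
    refine (ih (p := extendedDifferential hn φ p) (q := extendedDifferential hn φ q)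
      (hK hp) (hK hq)).trans ?_
    rw [pow_succ, ENNReal.ofReal_mul (by positivity), mul_assoc]
    gcongr
    exact h p q hp hq

end Iterates

end HyperbolicHolder

namespace HyperbolicHolder

open Filter Topology CompactifiedTangentBundle

/-! ### Arithmetic of the Hölder exponent. -/

section Exponent

variable {lam Lam : ℝ}

theorem one_lt_div_of_rate (h0 : 0 < lam) (h1 : lam < 1) (hL : 1 ≤ Lam) : 1 < Lam / lam := by
  rw [lt_div_iff₀ h0]; linarith

theorem holderExponent_pos (h0 : 0 < lam) (h1 : lam < 1) (hL : 1 ≤ Lam) :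
    0 < holderExponent lam Lam :=
  div_pos (by linarith [Real.log_neg h0 h1]) (Real.log_pos (one_lt_div_of_rate h0 h1 hL))

/-- The property that dictates the exponent: it turns the growth rate Λ/λ of the admissible scale
into the decay rate λ² of the error. -/
theorem rpow_neg_holderExponent (h0 : 0 < lam) (h1 : lam < 1) (hL : 1 ≤ Lam) :
    (Lam / lam) ^ (-holderExponent lam Lam) = lam ^ 2 := by
  have h := one_lt_div_of_rate h0 h1 hL
  have hlog := Real.log_pos h
  rw [Real.rpow_def_of_pos (by linarith), holderExponent]
  have e : Real.log (Lam / lam) * -(-(2 * Real.log lam) / Real.log (Lam / lam)) =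
      Real.log (lam ^ 2) := by
    rw [Real.log_pow]
    field_simp
    push_cast
    ring
  rw [e, Real.exp_log (by positivity)]

theorem holderExponent_le_one (h0 : 0 < lam) (h1 : lam < 1) (hL : 1 ≤ Lam) (h : 1 ≤ lam * Lam) :
    holderExponent lam Lam ≤ 1 := by
  have hlog := Real.log_pos (one_lt_div_of_rate h0 h1 hL)
  rw [holderExponent, div_le_one hlog, Real.log_div (by linarith) h0.ne']
  have := Real.log_nonneg h
  rw [Real.log_mul h0.ne' (by linarith)] at this
  linarith

theorem exists_pow_le_rpow (h0 : 0 < lam) (h1 : lam < 1) (hL : 1 ≤ Lam) {ρ ε : ℝ} (hρ : 0 < ρ)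
    (hε : ρ ≤ ε) : ∃ n : ℕ, (Lam / lam) ^ n * ρ ≤ ε ∧ lam ^ (2 * n) ≤
      (lam ^ 2)⁻¹ * ε ^ (-holderExponent lam Lam) * ρ ^ holderExponent lam Lam := by
  have h := one_lt_div_of_rate h0 h1 hL
  have hγ := holderExponent_pos h0 h1 hL
  have hε0 := hρ.trans_le hε
  -- n is the largest integer with (Λ/λ)^n ρ ≤ ε. The opposite inequality holds for n + 1, and the
  -- factor (λ²)⁻¹ pays for this shift.
  obtain ⟨n, hn, hn'⟩ := exists_nat_pow_near ((one_le_div hρ).2 hε) h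
  refine ⟨n, (le_div_iff₀ hρ).1 hn, ?_⟩
  have e1 : lam ^ (2 * n) = (lam ^ 2)⁻¹ * (lam ^ 2) ^ (n + 1) := by
    have : lam ^ 2 ≠ 0 := by positivity
    rw [pow_mul, pow_succ' (lam ^ 2) n, inv_mul_cancel_left₀ this]
  have e2 : (lam ^ 2) ^ (n + 1) = ((Lam / lam) ^ (n + 1)) ^ (-holderExponent lam Lam) := by
    rw [← rpow_neg_holderExponent h0 h1 hL, ← Real.rpow_natCast, ← Real.rpow_natCast,
      ← Real.rpow_mul (by linarith), ← Real.rpow_mul (by linarith), mul_comm]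
  have e3 : ((Lam / lam) ^ (n + 1)) ^ (-holderExponent lam Lam) ≤ (ε / ρ) ^ (-holderExponent lam Lam) :=
    Real.rpow_le_rpow_of_nonpos (by positivity) hn'.le (by linarith)
  rw [Real.div_rpow hε0.le hρ.le, Real.rpow_neg hρ.le (holderExponent lam Lam), div_inv_eq_mul] at e3
  rw [e1, e2, mul_assoc]
  gcongr

end Exponent

/-! ### Estimates on the hyperbolic set. -/

variable {d : ℕ} {M : Type*} [TopologicalSpace M] [ChartedSpace (Euc d) M]
  [IsManifold (𝓡 d) ∞ M] {n : ℕ∞ω} {φ : M ≃ₘ^n⟮𝓡 d, 𝓡 d⟯ M} {K : Set M} {du ds : ℕ}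
  {Eu Es : ∀ x : M, Submodule ℝ (TangentSpace (𝓡 d) x)} {lam Lam : ℝ}

namespace IsHyperbolicOn

theorem mapsTo (h : IsHyperbolicOn φ K du ds Eu Es lam) : MapsTo φ K K :=
  mapsTo_iff_image_subset.2 h.image_eq.subset

theorem mapsTo_iterate (h : IsHyperbolicOn φ K du ds Eu Es lam) (m : ℕ) : MapsTo φ^[m] K K :=
  h.mapsTo.iterate m

theorem mem_congr (F : ∀ x : M, Submodule ℝ (TangentSpace (𝓡 d) x)) (y y' : M) (u u' : Euc d)
    (hy : y = y') (hu : u = u') (hm : (show TangentSpace (𝓡 d) y from u) ∈ F y) :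
    (show TangentSpace (𝓡 d) y' from u') ∈ F y' := by
  subst hy hu
  exact hm

theorem iterate_mem_unstable (hn : n ≠ 0) (h : IsHyperbolicOn φ K du ds Eu Es lam) {x : M} (hx : x ∈ K)
    {v : TangentSpace (𝓡 d) x} (hv : v ∈ Eu x) (m : ℕ) :
    mfderiv (𝓡 d) (𝓡 d) φ^[m] x v ∈ Eu (φ^[m] x) := by
  induction m with
  | zero =>
    simp only [iterate_zero, mfderiv_id]
    exact hv
  | succ m ih =>
    have h1 : mfderiv (𝓡 d) (𝓡 d) φ (φ^[m] x) (mfderiv (𝓡 d) (𝓡 d) φ^[m] x v) ∈ Eu (φ (φ^[m] x)) := by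
      rw [← h.map_unstable _ (h.mapsTo_iterate m hx)]
      exact ⟨_, ih, rfl⟩
    exact mem_congr Eu _ _ _ _ (iterate_succ_apply' φ m x).symm (mfderiv_iterate_succ hn φ m x v).symm h1

/-- Contraction of backward iterates, applied at φ^m(x) to dφ^m v, becomes expansion of forward
iterates on E_u; only forward iterates appear afterwards. -/
theorem exists_contraction (hn : n ≠ 0) (h : IsHyperbolicOn φ K du ds Eu Es lam) :
    ∃ (g : SmoothMetric (𝓡 d) M) (C : ℝ), 0 < C ∧
    (∀ x ∈ K, ∀ v ∈ Eu x, ∀ m : ℕ,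
      g.norm v ≤ C * lam ^ m * g.norm (mfderiv (𝓡 d) (𝓡 d) φ^[m] x v)) ∧
    (∀ x ∈ K, ∀ v ∈ Es x, ∀ m : ℕ,
      g.norm (mfderiv (𝓡 d) (𝓡 d) φ^[m] x v) ≤ C * lam ^ m * g.norm v) := by
  obtain ⟨g, C, hC, hu, hs⟩ := h.contraction
  refine ⟨g, C, hC, fun x hx v hv m => ?_, hs⟩
  have h1 := hu _ (h.mapsTo_iterate m hx) _ (h.iterate_mem_unstable hn hx hv m) m
  have h2 : ∀ (y y' : M) (u u' : Euc d), y = y' → u = u' →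
      g.norm (show TangentSpace (𝓡 d) y from u) = g.norm (show TangentSpace (𝓡 d) y' from u') := by
    rintro y _ u _ rfl rfl
    rfl
  have h3 := h2 _ _ _ _ (symm_iterate_iterate φ m x) (mfderiv_symm_iterate_iterate hn φ m x v)
  exact h3.symm.le.trans h1

end IsHyperbolicOn

/-- A ray moving linearly in a fibre leaves its starting point with at most bounded speed. These
infinitesimal displacements are the test pairs for a lower bound on Λ. -/
theorem exists_dist_rayPoint_normalize_le
    (g : SmoothMetric (compactifiedModel d) (CompactifiedTangentBundle d M)) (x : M)
    {a b : ℝ × Euc d} (ha : a ≠ 0) (ha' : 0 ≤ a.1) (hb : 0 ≤ b.1) :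
    ∃ C : ℝ, 0 ≤ C ∧ ∀ᶠ t : ℝ in 𝓝[>] 0,
      g.dist (rayPoint x x (normalize a)) (rayPoint x x (normalize (a + t • b))) ≤
        ENNReal.ofReal (C * t) := by
  obtain ⟨C, hC⟩ := exists_dist_rayPoint_fibre_le g x (normalize_mem_halfSphere ha ha')
  obtain ⟨C', hC'⟩ := (lipschitzNear_normalize ha).eventually
  have hc : Tendsto (fun t : ℝ => a + t • b) (𝓝[>] 0) (𝓝 a) := by
    have : ContinuousAt (fun t : ℝ => a + t • b) 0 := by fun_prop
    have h2 := this.tendsto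
    rw [zero_smul, add_zero] at h2
    exact h2.mono_left nhdsWithin_le_nhds
  have hne : ∀ᶠ t : ℝ in 𝓝[>] 0, a + t • b ≠ 0 := hc.eventually (isOpen_ne.mem_nhds ha)
  have h1 := (tendsto_const_nhds (x := a)).prodMk hc |>.eventually hC'
  have h2 : Tendsto (fun t : ℝ => normalize (a + t • b)) (𝓝[>] 0) (𝓝[halfSphere d] (normalize a)) := by
    refine tendsto_nhdsWithin_iff.2 ⟨(lipschitzNear_normalize ha).continuousAt.tendsto.comp hc, ?_⟩
    filter_upwards [hne, self_mem_nhdsWithin] with t ht ht'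
    refine normalize_mem_halfSphere ht ?_
    have : (0 : ℝ) < t := ht'
    simp only [Prod.fst_add, Prod.smul_fst, smul_eq_mul]
    positivity
  refine ⟨C * (C' * ‖b‖), by positivity, ?_⟩
  filter_upwards [h2.eventually hC, h1, self_mem_nhdsWithin] with t k1 k2 ht
  have ht' : (0 : ℝ) < t := ht
  refine k1.trans ?_
  have e : edist a (a + t • b) = ENNReal.ofReal (t * ‖b‖) := by
    rw [edist_dist, dist_eq_norm]
    simp [norm_smul, abs_of_pos ht']
  rw [e] at k2
  calc (C : ℝ≥0∞) * edist (normalize a) (normalize (a + t • b))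
      ≤ C * (C' * ENNReal.ofReal (t * ‖b‖)) := by gcongr
    _ = _ := by
      rw [← ENNReal.ofReal_coe_nnreal, ← ENNReal.ofReal_coe_nnreal, ← ENNReal.ofReal_mul (by positivity),
        ← ENNReal.ofReal_mul (by positivity)]
      congr 1
      ring

theorem one_le_of_forall_le_pow {r A B : ℝ} (hr : 0 ≤ r) (hA : 0 < A) (h : ∀ m : ℕ, A ≤ B * r ^ m) :
    1 ≤ r := by
  by_contra! hr1
  have h1 := (tendsto_pow_atTop_nhds_zero_of_lt_one hr hr1).const_mul B
  rw [mul_zero] at h1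
  exact absurd (ge_of_tendsto' h1 h) (not_le.2 hA)

/-- A Lipschitz constant is at least the inverse of the contraction rate. -/
theorem IsHyperbolicOn.one_le_mul [T2Space M] (hn0 : n ≠ 0)
    (h : IsHyperbolicOn φ K du ds Eu Es lam)
    {g : SmoothMetric (compactifiedModel d) (CompactifiedTangentBundle d M)}
    (hL : 1 ≤ Lam) (hLip : IsLipschitzOver hn0 φ K g Lam) {x : M} (hx : x ∈ K) (hd : d ≠ 0) :
    1 ≤ lam * Lam := by
  obtain ⟨g₀, C, hC, hu, hs⟩ := h.exists_contraction hn0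
  have hlam := h.lam_pos
  have hLam : 0 < Lam := by linarith
  have hnorm : ∀ v : TangentSpace (𝓡 d) x, v ≠ 0 → 0 < g₀.norm v := fun v hv =>
    lt_of_le_of_ne (g₀.norm_nonneg v) fun h0 => hv (g₀.norm_eq_zero.1 h0.symm)
  by_cases hbot : Eu x = ⊥
  -- Without unstable directions the fibre at infinity repels: dφ^m v shrinks like λ^m while t stays
  -- fixed, so [t,v] moves away from [0,v] at a rate of at least λ^(-m).
  · have htop : Es x = ⊤ := by
      have := (h.isCompl x hx).sup_eq_top
      rwa [hbot, bot_sup_eq] at this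
    have : Nonempty (Fin d) := ⟨⟨0, Nat.pos_of_ne_zero hd⟩⟩
    obtain ⟨v, hv⟩ : ∃ v : Euc d, v ≠ 0 := exists_ne 0
    let v : TangentSpace (𝓡 d) x := v
    have hv : v ≠ 0 := hv
    have hvs : v ∈ Es x := by rw [htop]; trivial
    obtain ⟨C₂, ε, hC₂, hε, h₂⟩ := exists_le_norm_of_dist_le g g₀ h.isCompact
    have ha : ((0, (frameChange (𝓡 d) x x v : Euc d)) : ℝ × Euc d) ≠ 0 := by
      intro h0
      have h1 := congrArg Prod.snd h0
      exact hv ((frameChange (𝓡 d) x x).map_eq_zero_iff.1 h1)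
    obtain ⟨C₁, hC₁, h₁⟩ := exists_dist_rayPoint_normalize_le g x ha le_rfl
      (b := (1, 0)) zero_le_one
    refine one_le_of_forall_le_pow (B := C₂ * C₁ * C * g₀.norm v) (by positivity) one_pos fun m => ?_
    -- The scale t is chosen after m, so that the images are still close enough for the local
    -- estimate; t cancels at the end.
    have h3 : ∀ᶠ t : ℝ in 𝓝[>] 0, Lam ^ m * (C₁ * t) < ε := by
      have : ContinuousAt (fun t : ℝ => Lam ^ m * (C₁ * t)) 0 := by fun_prop
      have h4 := this.tendsto.mono_left (nhdsWithin_le_nhds (s := Ioi 0))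
      rw [mul_zero, mul_zero] at h4
      exact h4.eventually (gt_mem_nhds hε)
    obtain ⟨t, k1, k2, ht⟩ := (h₁.and (h3.and self_mem_nhdsWithin)).exists
    have ht : 0 < t := ht
    have e : ((0, (frameChange (𝓡 d) x x v : Euc d)) : ℝ × Euc d) + t • (1, 0) =
        (t, (frameChange (𝓡 d) x x v : Euc d)) := by simp
    rw [e, ← ray_eq_rayPoint x (Or.inr hv) le_rfl, ← ray_eq_rayPoint x (Or.inr hv) ht.le] at k1
    have k3 := (dist_iterate_le hn0 h.mapsTo hLam.le hLip m (p := ray x 0 v) (q := ray x t v) hx hx).trans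
      (mul_le_mul_right k1 _)
    rw [extendedDifferential_iterate_ray hn0 φ m x (Or.inr hv) le_rfl,
      extendedDifferential_iterate_ray hn0 φ m x (Or.inr hv) ht.le,
      ← ENNReal.ofReal_mul (by positivity)] at k3
    have hvm : mfderiv (𝓡 d) (𝓡 d) φ^[m] x v ≠ 0 := by
      intro h0
      apply hv
      have h3 := mfderiv_symm_iterate_iterate hn0 φ m x v
      exact h3.symm.trans ((congrArg (mfderiv (𝓡 d) (𝓡 d) φ.symm^[m] (φ^[m] x)) h0).trans (map_zero _))
    have k4 := h₂ _ (h.mapsTo_iterate m hx) _ t _ hvm ht (by positivity) k2 k3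
    have k5 := hs x hx v hvs m
    have k6 : t * 1 ≤ t * (C₂ * C₁ * C * g₀.norm v * (lam * Lam) ^ m) := by
      calc t * 1 = t := mul_one t
        _ ≤ C₂ * (Lam ^ m * (C₁ * t)) * (C * lam ^ m * g₀.norm v) := k4.trans (by gcongr)
        _ = _ := by rw [mul_pow]; ring
    exact le_of_mul_le_mul_left k6 ht
  -- With an unstable vector v, the pair of 0 and t v separates at a rate of at least λ^(-m), and at
  -- most Λ^m.
  · obtain ⟨v, hvu, hv⟩ := (Submodule.ne_bot_iff _).1 hbot
    obtain ⟨C₂, ε, hC₂, hε, h₂⟩ := exists_norm_le_of_dist_le g g₀ h.isCompact 0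
    obtain ⟨C₁, hC₁, h₁⟩ := exists_dist_rayPoint_normalize_le g x (a := (1, 0))
      (b := (0, (frameChange (𝓡 d) x x v : Euc d))) (halfRay_default_ne _) zero_le_one le_rfl
    refine one_le_of_forall_le_pow (B := C * (C₂ * C₁)) (by positivity) (hnorm v hv) fun m => ?_
    have h3 : ∀ᶠ t : ℝ in 𝓝[>] 0, Lam ^ m * (C₁ * t) < ε := by
      have : ContinuousAt (fun t : ℝ => Lam ^ m * (C₁ * t)) 0 := by fun_prop
      have h4 := this.tendsto.mono_left (nhdsWithin_le_nhds (s := Ioi 0))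
      rw [mul_zero, mul_zero] at h4
      exact h4.eventually (gt_mem_nhds hε)
    obtain ⟨t, k1, k2, ht⟩ := (h₁.and (h3.and self_mem_nhdsWithin)).exists
    have ht : 0 < t := ht
    have e0 : (frameChange (𝓡 d) x x (0 : TangentSpace (𝓡 d) x) : Euc d) = 0 := map_zero _
    have e : ((1, 0) : ℝ × Euc d) + t • (0, (frameChange (𝓡 d) x x v : Euc d)) =
        (1, (frameChange (𝓡 d) x x (t • v) : Euc d)) := by
      have e2 : (frameChange (𝓡 d) x x (t • v) : Euc d) = t • (frameChange (𝓡 d) x x v : Euc d) :=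
        map_smul (frameChange (𝓡 d) x x) t v
      rw [e2]
      simp
    have e1 : rayPoint x x (normalize ((1, 0) : ℝ × Euc d)) = ray x 1 (0 : TangentSpace (𝓡 d) x) := by
      rw [ray_eq_rayPoint x (Or.inl one_ne_zero) zero_le_one, e0]
    rw [e, e1, ← ray_eq_rayPoint x (Or.inl one_ne_zero) zero_le_one] at k1
    have k3 := (dist_iterate_le hn0 h.mapsTo hLam.le hLip m (p := ray x 1 0) (q := ray x 1 (t • v)) hx hx).trans
      (mul_le_mul_right k1 _)
    rw [extendedDifferential_iterate_ray hn0 φ m x (Or.inl one_ne_zero) zero_le_one,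
      extendedDifferential_iterate_ray hn0 φ m x (Or.inl one_ne_zero) zero_le_one,
      ← ENNReal.ofReal_mul (by positivity), map_zero, map_smul] at k3
    have k0 : g₀.norm (0 : TangentSpace (𝓡 d) (φ^[m] x)) = 0 := g₀.norm_eq_zero.2 rfl
    have k4 := h₂ _ (h.mapsTo_iterate m hx) _ _ _ _ (by positivity) k2 k0.le k3
    rw [k0, zero_add, g₀.norm_smul, abs_of_pos ht] at k4
    have k5 := hu x hx v hvu m
    have k6 : g₀.norm (mfderiv (𝓡 d) (𝓡 d) φ^[m] x v) ≤ C₂ * C₁ * Lam ^ m := by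
      refine le_of_mul_le_mul_left (k4.trans_eq ?_) ht
      ring
    calc g₀.norm v ≤ C * lam ^ m * (C₂ * C₁ * Lam ^ m) := k5.trans (by gcongr)
      _ = _ := by rw [mul_pow]; ring

set_option maxHeartbeats 1000000 in
/-- Stable vectors at nearby points of `K` are close, up to a power of the distance. -/
theorem IsHyperbolicOn.exists_mem_stable_close [T2Space M] (hn0 : n ≠ 0)
    (h : IsHyperbolicOn φ K du ds Eu Es lam)
    {g : SmoothMetric (compactifiedModel d) (CompactifiedTangentBundle d M)}
    (hL : 1 ≤ Lam) (hLip : IsLipschitzOver hn0 φ K g Lam) (x₀ : M) :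
    ∃ B : ℝ, 0 ≤ B ∧ ∀ᶠ p in 𝓝 x₀ ×ˢ 𝓝 x₀, p.1 ∈ K → p.2 ∈ K → ∀ u ∈ Es p.1, ∃ w ∈ Es p.2,
      ‖(frameChange (𝓡 d) x₀ p.1 u - frameChange (𝓡 d) x₀ p.2 w : Euc d)‖ ≤
        B * ‖extChartAt (𝓡 d) x₀ p.1 - extChartAt (𝓡 d) x₀ p.2‖ ^ holderExponent lam Lam *
          ‖(frameChange (𝓡 d) x₀ p.1 u : Euc d)‖ := by
  obtain ⟨g₀, C, hC, hu, hs⟩ := h.exists_contraction hn0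
  have hlam := h.lam_pos
  have hlam1 := h.lam_lt_one
  have hLam : 0 < Lam := by linarith
  obtain ⟨C₁, h₁⟩ := exists_dist_rayPoint_le g x₀
  obtain ⟨Cf, hf⟩ := g₀.eventually_norm_le x₀
  obtain ⟨C₂, ε, hC₂, hε, h₂⟩ := exists_norm_le_of_dist_le g g₀ h.isCompact (C * Cf)
  have hCf : (0 : ℝ) ≤ Cf := Cf.2
  have hC₁ : (0 : ℝ) ≤ C₁ := C₁.2
  -- Chosen so that C₁ ε₁ < ε: when Λ^m ρ ≤ ε₁ the m-th images stay in the range of the local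
  -- estimate `h₂`.
  set ε₁ : ℝ := ε / (2 * (C₁ + 1)) with hε₁
  have hε₁0 : 0 < ε₁ := by positivity
  have hε₁' : C₁ * ε₁ < ε := by
    have e : (C₁ + 1) * ε₁ = ε / 2 := by rw [hε₁]; field_simp
    nlinarith
  set C₃ : ℝ := C₂ * (C * Cf + C₁ * ε₁) with hC₃
  have hC₃0 : 0 ≤ C₃ := by positivity
  set A : ℝ := C * C₃ + C ^ 2 * Cf with hA
  have hA0 : 0 ≤ A := by positivity
  set C₅ : ℝ := 2 * Cf * A + 2 * C ^ 2 with hC₅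
  have hC₅0 : 0 ≤ C₅ := by positivity
  have hext : ∀ᶠ p in 𝓝 x₀ ×ˢ 𝓝 x₀, ‖extChartAt (𝓡 d) x₀ p.1 - extChartAt (𝓡 d) x₀ p.2‖ < ε₁ := by
    have h3 : Tendsto (fun p : M × M => ‖extChartAt (𝓡 d) x₀ p.1 - extChartAt (𝓡 d) x₀ p.2‖)
        (𝓝 x₀ ×ˢ 𝓝 x₀) (𝓝 ‖extChartAt (𝓡 d) x₀ x₀ - extChartAt (𝓡 d) x₀ x₀‖) :=
      (((continuousAt_extChartAt x₀).tendsto.comp tendsto_fst).sub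
        ((continuousAt_extChartAt x₀).tendsto.comp tendsto_snd)).norm
    rw [sub_self, norm_zero] at h3
    exact h3.eventually (gt_mem_nhds hε₁0)
  have hsrc := extChartAt_source_mem_nhds (I := 𝓡 d) x₀
  refine ⟨C₅ * ((lam ^ 2)⁻¹ * ε₁ ^ (-holderExponent lam Lam)), by positivity, ?_⟩
  filter_upwards [h₁, hext, prod_mem_prod hf hf, prod_mem_prod hsrc hsrc] with p k₁ kρ kf ksrc
  obtain ⟨x, y⟩ := p
  dsimp only at k₁ kρ kf ksrc ⊢
  intro hx hy
  obtain ⟨kx, ky⟩ := kf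
  dsimp only [mem_ofPred_eq] at kx ky
  set ρ := ‖extChartAt (𝓡 d) x₀ x - extChartAt (𝓡 d) x₀ y‖ with hρ
  -- The estimate for a vector of frame norm one and any admissible number m of steps; homogeneity
  -- and the choice of m come afterwards.
  have main : ∀ u ∈ Es x, ‖(frameChange (𝓡 d) x₀ x u : Euc d)‖ = 1 → ∀ m : ℕ,
      (Lam / lam) ^ m * ρ ≤ ε₁ → ∃ w ∈ Es y,
      ‖(frameChange (𝓡 d) x₀ x u - frameChange (𝓡 d) x₀ y w : Euc d)‖ ≤ C₅ * lam ^ (2 * m) := by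
    intro u hus hu1 m hm
    obtain ⟨v', hv'⟩ : ∃ v' : TangentSpace (𝓡 d) y,
      (frameChange (𝓡 d) x₀ y v' : Euc d) = frameChange (𝓡 d) x₀ x u :=
      (frameChange (𝓡 d) x₀ y).surjective _
    have hlm : lam ^ m ≤ 1 := pow_le_one₀ hlam.le hlam1.le
    -- The surplus factor λ^m makes the separation of the images as small as dφ^m u itself, and
    -- hence dφ^m v' of order λ^m.
    have hm' : Lam ^ m * ρ ≤ ε₁ * lam ^ m := by
      rw [div_pow, div_mul_eq_mul_div, div_le_iff₀ (by positivity)] at hm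
      exact hm
    have hm'' : Lam ^ m * ρ ≤ ε₁ := hm'.trans (mul_le_of_le_one_right hε₁0.le hlm)
    have d1 : g.dist (ray x 1 u) (ray y 1 v') ≤ ENNReal.ofReal (C₁ * ρ) := by
      rw [ray_eq_rayPoint x₀ (Or.inl one_ne_zero) zero_le_one,
        ray_eq_rayPoint x₀ (Or.inl one_ne_zero) zero_le_one, hv']
      have hne : ((1, (frameChange (𝓡 d) x₀ x u : Euc d)) : ℝ × Euc d) ≠ 0 := fun h0 =>
        one_ne_zero (congrArg Prod.fst h0)
      refine (k₁ _ (normalize_mem_halfSphere hne zero_le_one)).trans_eq ?_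
      rw [edist_dist, dist_eq_norm, ← hρ, ENNReal.ofReal_mul hC₁, ENNReal.ofReal_coe_nnreal]
    have d2 := (dist_iterate_le hn0 h.mapsTo hLam.le hLip m (p := ray x 1 u) (q := ray y 1 v') hx hy).trans
      (mul_le_mul_right d1 _)
    rw [extendedDifferential_iterate_ray hn0 φ m x (Or.inl one_ne_zero) zero_le_one,
      extendedDifferential_iterate_ray hn0 φ m y (Or.inl one_ne_zero) zero_le_one,
      ← ENNReal.ofReal_mul (by positivity)] at d2
    have hunorm : g₀.norm u ≤ Cf := by
      have := (kx u).2
      rwa [hu1, mul_one] at this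
    have hun : g₀.norm (mfderiv (𝓡 d) (𝓡 d) φ^[m] x u) ≤ C * Cf * lam ^ m := by
      refine (hs x hx u hus m).trans ?_
      calc C * lam ^ m * g₀.norm u ≤ C * lam ^ m * Cf := by gcongr
        _ = _ := by ring
    have hD : Lam ^ m * (C₁ * ρ) ≤ C₁ * (ε₁ * lam ^ m) := by
      calc Lam ^ m * (C₁ * ρ) = C₁ * (Lam ^ m * ρ) := by ring
        _ ≤ _ := by gcongr
    have hv'n : g₀.norm (mfderiv (𝓡 d) (𝓡 d) φ^[m] y v') ≤ C₃ * lam ^ m := by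
      refine (h₂ _ (h.mapsTo_iterate m hx) _ _ _ _ (by positivity) ?_ ?_ d2).trans ?_
      · calc Lam ^ m * (C₁ * ρ) = C₁ * (Lam ^ m * ρ) := by ring
          _ ≤ C₁ * ε₁ := by gcongr
          _ < ε := hε₁'
      · exact hun.trans (mul_le_of_le_one_right (by positivity) hlm)
      · calc _ ≤ C₂ * (C * Cf * lam ^ m + C₁ * (ε₁ * lam ^ m)) := by gcongr
          _ = _ := by rw [hC₃]; ring
    obtain ⟨a, ha, b, hb, hab⟩ : ∃ a ∈ Eu y, ∃ b ∈ Es y, a + b = v' := by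
      have : v' ∈ Eu y ⊔ Es y := by rw [(h.isCompl y hy).sup_eq_top]; trivial
      exact Submodule.mem_sup.1 this
    have hv'norm : g₀.norm v' ≤ Cf := by
      have := (ky v').2
      rwa [hv', hu1, mul_one] at this
    have hbn : g₀.norm b ≤ Cf + g₀.norm a := by
      have e : b = v' - a := by rw [← hab]; abel
      rw [e]
      exact (g₀.norm_sub_le _ _).trans (by gcongr)
    have ham : g₀.norm (mfderiv (𝓡 d) (𝓡 d) φ^[m] y a) ≤
        C₃ * lam ^ m + C * lam ^ m * (Cf + g₀.norm a) := by
      have e : mfderiv (𝓡 d) (𝓡 d) φ^[m] y a =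
          mfderiv (𝓡 d) (𝓡 d) φ^[m] y v' - mfderiv (𝓡 d) (𝓡 d) φ^[m] y b := by
        rw [← hab, map_add, add_sub_cancel_right]
      rw [e]
      refine (g₀.norm_sub_le _ _).trans (add_le_add hv'n ((hs y hy b hb m).trans ?_))
      gcongr
    -- Expansion on E_u supplies the second factor λ^m. The norm of a recurs on the right and is
    -- absorbed when its coefficient is at most 1/2.
    have han : g₀.norm a ≤ lam ^ (2 * m) * A + lam ^ (2 * m) * C ^ 2 * g₀.norm a := by
      refine (hu y hy a ha m).trans ?_
      calc _ ≤ C * lam ^ m * (C₃ * lam ^ m + C * lam ^ m * (Cf + g₀.norm a)) := by gcongr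
        _ = _ := by rw [hA, two_mul, pow_add]; ring
    have hpos : 0 < lam ^ (2 * m) := by positivity
    rcases le_or_gt (lam ^ (2 * m) * C ^ 2) (1 / 2) with hsmall | hbig
    · refine ⟨b, hb, ?_⟩
      have han' : g₀.norm a ≤ 2 * A * lam ^ (2 * m) := by
        have := g₀.norm_nonneg a
        nlinarith
      have e : (frameChange (𝓡 d) x₀ x u - frameChange (𝓡 d) x₀ y b : Euc d) =
          frameChange (𝓡 d) x₀ y a := by
        rw [← hv', ← hab]
        have := map_add (frameChange (𝓡 d) x₀ y) a b
        exact sub_eq_of_eq_add this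
      rw [e]
      calc _ ≤ Cf * (2 * A * lam ^ (2 * m)) := (ky a).1.trans (by gcongr)
        _ = (2 * Cf * A) * lam ^ (2 * m) := by ring
        _ ≤ C₅ * lam ^ (2 * m) := by
          gcongr
          rw [hC₅]
          have : 0 ≤ 2 * C ^ 2 := by positivity
          linarith
    -- If the coefficient exceeds 1/2, then λ^(2m) is bounded below and the zero vector is a good
    -- enough approximation of a unit vector.
    · refine ⟨0, (Es y).zero_mem, ?_⟩
      have e : (frameChange (𝓡 d) x₀ y (0 : TangentSpace (𝓡 d) y) : Euc d) = 0 := map_zero _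
      rw [e, sub_zero, hu1]
      calc (1 : ℝ) ≤ 2 * C ^ 2 * lam ^ (2 * m) := by linarith
        _ ≤ C₅ * lam ^ (2 * m) := by
          gcongr
          rw [hC₅]
          have : 0 ≤ 2 * Cf * A := by positivity
          linarith
  intro u hus
  -- For ρ = 0 there is no largest admissible m, but then x = y.
  by_cases hρ0 : ρ = 0
  · have hxy : x = y := by
      refine (extChartAt (𝓡 d) x₀).injOn ksrc.1 ksrc.2 ?_
      rw [hρ, norm_eq_zero, sub_eq_zero] at hρ0
      exact hρ0
    clear_value ρ
    subst hxy
    refine ⟨u, hus, ?_⟩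
    rw [sub_self, norm_zero]
    positivity
  have hρpos : 0 < ρ := lt_of_le_of_ne (norm_nonneg _) (Ne.symm hρ0)
  by_cases hu0 : u = 0
  · obtain ⟨w, hw⟩ : ∃ w : TangentSpace (𝓡 d) y, w = 0 := ⟨0, rfl⟩
    refine ⟨w, hw ▸ (Es y).zero_mem, ?_⟩
    have e : ∀ z (v : TangentSpace (𝓡 d) z), v = 0 → (frameChange (𝓡 d) x₀ z v : Euc d) = 0 := by
      rintro z _ rfl
      exact map_zero _
    rw [e x u hu0, e y w hw, sub_zero, norm_zero, mul_zero]
  set r := ‖(frameChange (𝓡 d) x₀ x u : Euc d)‖ with hr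
  have hr0 : 0 < r := norm_pos_iff.2 fun h0 => hu0 ((frameChange (𝓡 d) x₀ x).map_eq_zero_iff.1 h0)
  have hsm : ∀ z (c : ℝ) (v v' : TangentSpace (𝓡 d) z), v' = c • v →
      (frameChange (𝓡 d) x₀ z v' : Euc d) = c • (frameChange (𝓡 d) x₀ z v : Euc d) := by
    rintro z c v _ rfl
    exact map_smul (frameChange (𝓡 d) x₀ z) c v
  obtain ⟨m, hm, hm'⟩ := exists_pow_le_rpow hlam hlam1 hL hρpos kρ.le
  obtain ⟨u₁, hu₁⟩ : ∃ u₁ : TangentSpace (𝓡 d) x, u₁ = r⁻¹ • u := ⟨_, rfl⟩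
  obtain ⟨w, hw, hw'⟩ := main u₁ (hu₁ ▸ (Es x).smul_mem _ hus) (by
    rw [hsm x r⁻¹ u u₁ hu₁, norm_smul, norm_inv, Real.norm_of_nonneg hr0.le, ← hr, inv_mul_cancel₀ hr0.ne']) m hm
  obtain ⟨w₁, hw₁⟩ : ∃ w₁ : TangentSpace (𝓡 d) y, w₁ = r • w := ⟨_, rfl⟩
  refine ⟨w₁, hw₁ ▸ (Es y).smul_mem _ hw, ?_⟩
  rw [hsm x r⁻¹ u u₁ hu₁] at hw'
  rw [hsm y r w w₁ hw₁]
  have e : (frameChange (𝓡 d) x₀ x u : Euc d) - r • (frameChange (𝓡 d) x₀ y w : Euc d) =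
      r • (r⁻¹ • (frameChange (𝓡 d) x₀ x u : Euc d) - (frameChange (𝓡 d) x₀ y w : Euc d)) := by
    rw [smul_sub, smul_smul, mul_inv_cancel₀ hr0.ne', one_smul]
  rw [e, norm_smul, Real.norm_of_nonneg hr0.le, mul_comm r]
  gcongr
  refine hw'.trans ?_
  rw [mul_assoc]
  gcongr

end HyperbolicHolder

namespace HyperbolicHolder

open Filter Topology

/-! ### Common complements of two subspaces. -/

section Complements

variable {V : Type*} [AddCommGroup V] [Module ℝ V]

theorem exists_notMem_notMem {S T : Submodule ℝ V} (hS : S ≠ ⊤) (hT : T ≠ ⊤) :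
    ∃ v, v ∉ S ∧ v ∉ T := by
  obtain ⟨a, ha⟩ : ∃ a, a ∉ S := by
    by_contra! h
    exact hS (eq_top_iff.2 fun x _ => h x)
  obtain ⟨b, hb⟩ : ∃ b, b ∉ T := by
    by_contra! h
    exact hT (eq_top_iff.2 fun x _ => h x)
  by_cases haT : a ∈ T
  · by_cases hbS : b ∈ S
    · exact ⟨a + b, fun h => ha ((S.add_mem_iff_left hbS).1 h), fun h => hb ((T.add_mem_iff_right haT).1 h)⟩
    · exact ⟨b, hbS, hb⟩
  · exact ⟨a, ha, haT⟩

/-- Induction on the codimension: a vector outside both subspaces exists, since two proper subspaces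
do not cover the space. Its line is added to both, and afterwards moved to the complement. -/
theorem exists_common_isCompl [FiniteDimensional ℝ V] (S T : Submodule ℝ V)
    (h : Module.finrank ℝ S = Module.finrank ℝ T) : ∃ Q, IsCompl S Q ∧ IsCompl T Q := by
  obtain ⟨m, hm⟩ := Nat.exists_eq_add_of_le (Submodule.finrank_le S)
  induction m generalizing S T with
  | zero =>
    have h1 : S = ⊤ := Submodule.eq_top_of_finrank_eq hm.symm
    have h2 : T = ⊤ := Submodule.eq_top_of_finrank_eq (h ▸ hm.symm)
    exact ⟨⊥, by rw [h1]; exact isCompl_top_bot, by rw [h2]; exact isCompl_top_bot⟩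
  | succ m ih =>
    have hne : ∀ U : Submodule ℝ V, Module.finrank ℝ U = Module.finrank ℝ S → U ≠ ⊤ := by
      rintro U hU rfl
      rw [finrank_top] at hU
      omega
    obtain ⟨v, hvS, hvT⟩ := exists_notMem_notMem (hne S rfl) (hne T h.symm)
    have hv0 : v ≠ 0 := fun h0 => hvS (h0 ▸ S.zero_mem)
    have hd : ∀ U : Submodule ℝ V, v ∉ U → Disjoint U (ℝ ∙ v) := fun U hU =>
      (Submodule.disjoint_span_singleton' hv0).2 hU
    have hf : ∀ U : Submodule ℝ V, v ∉ U →
        Module.finrank ℝ ↥(U ⊔ ℝ ∙ v) = Module.finrank ℝ U + 1 := by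
      intro U hU
      have h1 := Submodule.finrank_sup_add_finrank_inf_eq U (ℝ ∙ v)
      rw [(hd U hU).eq_bot, finrank_bot, finrank_span_singleton hv0] at h1
      omega
    obtain ⟨Q, hSQ, hTQ⟩ := ih (S ⊔ ℝ ∙ v) (T ⊔ ℝ ∙ v) (by rw [hf S hvS, hf T hvT, h])
      (by rw [hf S hvS]; omega)
    have key : ∀ U : Submodule ℝ V, v ∉ U → IsCompl (U ⊔ ℝ ∙ v) Q → IsCompl U ((ℝ ∙ v) ⊔ Q) :=
      fun U hU hQ => ⟨(hd U hU).disjoint_sup_right_of_disjoint_sup_left hQ.disjoint,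
        codisjoint_iff.2 (by rw [← sup_assoc]; exact hQ.sup_eq_top)⟩
    exact ⟨_, key S hvS hSQ, key T hvT hTQ⟩

end Complements

/-! ### Planes as graphs of linear maps. -/

section Graphs

variable {k d : ℕ} (A : (Euc k × Euc (d - k)) ≃L[ℝ] Euc d)

/-- If the projection to the first factor is injective on S, it is bijective by dimension, and its
inverse followed by the second projection is the required map. -/
theorem exists_planeOfGraph_eq (S : Gr k (Euc d))
    (h : ∀ w ∈ S.space, (A.symm w).1 = 0 → w = 0) : ∃ L, planeOfGraph A L = S := by
  let f : S.space →ₗ[ℝ] Euc k := (LinearMap.fst ℝ (Euc k) (Euc (d - k))) ∘ₗ A.symm.toLinearMap ∘ₗ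
    S.space.subtype
  have hf : Injective f := by
    rw [injective_iff_map_eq_zero]
    intro w hw
    exact Subtype.ext (h w w.2 hw)
  let e := LinearEquiv.ofInjectiveOfFinrankEq f hf (by rw [S.finrank_space, finrank_euclideanSpace_fin])
  have he : ∀ w, e w = f w := fun w => rfl
  let L : Euc k →ₗ[ℝ] Euc (d - k) := (LinearMap.snd ℝ (Euc k) (Euc (d - k))) ∘ₗ
    A.symm.toLinearMap ∘ₗ S.space.subtype ∘ₗ e.symm.toLinearMap
  refine ⟨L.toContinuousLinearMap, Gr.ext (Submodule.eq_of_le_of_finrank_eq ?_ ?_)⟩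
  · rintro _ ⟨a, rfl⟩
    have h1 : (A.symm (e.symm a : Euc d)) = (a, L a) := by
      refine Prod.ext ?_ rfl
      exact e.apply_symm_apply a
    have h2 : A (a, L a) = (e.symm a : Euc d) := by rw [← h1, A.apply_symm_apply]
    change A (a, L a) ∈ S.space
    rw [h2]
    exact (e.symm a).2
  · rw [(planeOfGraph A _).finrank_space, S.finrank_space]

/-- `S` is contained in the cone of aperture `η` around `T`. -/
def IsNear (η : ℝ) (S T : Submodule ℝ (Euc d)) : Prop := ∀ w ∈ S, ∃ u ∈ T, ‖w - u‖ ≤ η * ‖w‖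

theorem norm_graph_le (L : Euc k →L[ℝ] Euc (d - k)) (a : Euc k) :
    ‖A (a, L a)‖ ≤ ‖(A : (Euc k × Euc (d - k)) →L[ℝ] Euc d)‖ * ((1 + ‖L‖) * ‖a‖) := by
  refine ((A : (Euc k × Euc (d - k)) →L[ℝ] Euc d).le_opNorm _).trans ?_
  refine mul_le_mul_of_nonneg_left ?_ (norm_nonneg _)
  rw [Prod.norm_def]
  have := L.le_opNorm a
  have := norm_nonneg a
  have := norm_nonneg L
  exact max_le (by nlinarith) (by linarith)

theorem norm_symm_sub_le (w : Euc d) (q : Euc k × Euc (d - k)) :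
    ‖A.symm w - q‖ ≤ ‖(A.symm : Euc d →L[ℝ] (Euc k × Euc (d - k)))‖ * ‖w - A q‖ := by
  have h := (A.symm : Euc d →L[ℝ] (Euc k × Euc (d - k))).le_opNorm (w - A q)
  rwa [map_sub, ContinuousLinearEquiv.coe_coe, A.symm_apply_apply] at h

/-- A point A(a, L'a) has a nearby A(b, Lb), and (L' − L)a = (L'a − Lb) − L(a − b), where both
differences are controlled through A⁻¹. One-sided nearness suffices because both planes are graphs
over the same space. -/
theorem norm_graph_sub_le {L L' : Euc k →L[ℝ] Euc (d - k)} {η : ℝ} (hη : 0 ≤ η)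
    (h : IsNear η (planeOfGraph A L').space (planeOfGraph A L).space) :
    ‖L' - L‖ ≤ ‖(A.symm : Euc d →L[ℝ] (Euc k × Euc (d - k)))‖ * (1 + ‖L‖) *
      ‖(A : (Euc k × Euc (d - k)) →L[ℝ] Euc d)‖ * (1 + ‖L'‖) * η := by
  refine ContinuousLinearMap.opNorm_le_bound _ (by positivity) fun a => ?_
  obtain ⟨_, ⟨b, rfl⟩, hb⟩ := h (A (a, L' a)) ⟨a, rfl⟩
  change ‖A (a, L' a) - A (b, L b)‖ ≤ _ at hb
  have h1 : ‖A (a, L' a)‖ ≤ ‖(A : (Euc k × Euc (d - k)) →L[ℝ] Euc d)‖ * ((1 + ‖L'‖) * ‖a‖) :=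
    norm_graph_le A L' a
  have h2 : ‖((a - b, L' a - L b) : Euc k × Euc (d - k))‖ ≤
      ‖(A.symm : Euc d →L[ℝ] (Euc k × Euc (d - k)))‖ * ‖A (a, L' a) - A (b, L b)‖ := by
    have h3 := norm_symm_sub_le A (A (a, L' a)) (b, L b)
    rwa [A.symm_apply_apply] at h3
  have h3 := (norm_fst_le _).trans h2
  have h4 := (norm_snd_le _).trans h2
  dsimp only at h3 h4
  have e : (L' - L) a = (L' a - L b) - L (a - b) := by
    rw [sub_apply, map_sub]; abel
  rw [e]
  set s := ‖(A.symm : Euc d →L[ℝ] (Euc k × Euc (d - k)))‖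
  set r := ‖(A : (Euc k × Euc (d - k)) →L[ℝ] Euc d)‖
  calc ‖L' a - L b - L (a - b)‖ ≤ ‖L' a - L b‖ + ‖L (a - b)‖ := norm_sub_le _ _
    _ ≤ s * ‖A (a, L' a) - A (b, L b)‖ + ‖L‖ * (s * ‖A (a, L' a) - A (b, L b)‖) := by
      gcongr
      exact (L.le_opNorm _).trans (by gcongr)
    _ = s * (1 + ‖L‖) * ‖A (a, L' a) - A (b, L b)‖ := by ring
    _ ≤ s * (1 + ‖L‖) * (η * (r * ((1 + ‖L'‖) * ‖a‖))) := by
      gcongr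
      exact hb.trans (by gcongr)
    _ = _ := by ring

/-- A vector w of S with zero first coordinate is close to some A(b, Lb) with b small, so ‖w‖ ≤
‖w‖/2 and w = 0; thus S is a graph. -/
theorem exists_graph_of_isNear (L : Euc k →L[ℝ] Euc (d - k)) : ∃ δ C : ℝ, 0 < δ ∧ 0 ≤ C ∧
    ∀ (S : Gr k (Euc d)) (η : ℝ), 0 ≤ η → η ≤ δ → IsNear η S.space (planeOfGraph A L).space →
      ∃ L', planeOfGraph A L' = S ∧ ‖L' - L‖ ≤ C * η := by
  set s := ‖(A.symm : Euc d →L[ℝ] (Euc k × Euc (d - k)))‖ with hs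
  set r := ‖(A : (Euc k × Euc (d - k)) →L[ℝ] Euc d)‖ with hr
  have hs0 : 0 ≤ s := norm_nonneg _
  have hr0 : 0 ≤ r := norm_nonneg _
  set c := s * (1 + ‖L‖) * r with hc
  have hc0 : 0 ≤ c := by positivity
  -- For η ≤ δ one has c η ≤ 1/2, so the ‖L'‖ in the bound of `norm_graph_sub_le` is absorbed,
  -- giving 1 + ‖L'‖ ≤ 2(1 + ‖L‖).
  refine ⟨1 / (2 * (1 + c)), c * (2 * (1 + ‖L‖)), by positivity, by positivity, ?_⟩
  intro S η hη hηδ hnear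
  have hη1 : η * (1 + c) ≤ 1 / 2 := by
    rw [le_div_iff₀ (by positivity)] at hηδ
    linarith
  obtain ⟨L', rfl⟩ : ∃ L', planeOfGraph A L' = S := by
    refine exists_planeOfGraph_eq A S fun w hw hw0 => ?_
    obtain ⟨_, ⟨b, rfl⟩, hb⟩ := hnear w hw
    change ‖w - A (b, L b)‖ ≤ _ at hb
    have h1 : ‖b‖ ≤ s * (η * ‖w‖) := by
      have h4 := (norm_fst_le _).trans (norm_symm_sub_le A w (b, L b))
      rw [Prod.fst_sub, hw0, zero_sub, norm_neg] at h4
      exact h4.trans (mul_le_mul_of_nonneg_left hb hs0)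
    have h2 : ‖A (b, L b)‖ ≤ r * ((1 + ‖L‖) * ‖b‖) :=
      norm_graph_le A L b
    have h3 : ‖w‖ ≤ η * ‖w‖ + r * ((1 + ‖L‖) * (s * (η * ‖w‖))) := by
      calc ‖w‖ = ‖(w - A (b, L b)) + A (b, L b)‖ := by rw [sub_add_cancel]
        _ ≤ _ := norm_add_le _ _
        _ ≤ _ := add_le_add hb (h2.trans (by gcongr))
    have h4 : ‖w‖ ≤ η * (1 + c) * ‖w‖ := by
      refine h3.trans_eq ?_
      rw [hc]; ring
    have h5 : ‖w‖ ≤ 0 := by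
      have := norm_nonneg w
      nlinarith
    exact norm_le_zero_iff.1 h5
  refine ⟨L', rfl, ?_⟩
  have h1 := norm_graph_sub_le A hη hnear
  rw [← hs, ← hr, ← hc] at h1
  have h2 : ‖L'‖ ≤ ‖L‖ + ‖L' - L‖ := by
    calc ‖L'‖ = ‖L + (L' - L)‖ := by rw [add_sub_cancel]
      _ ≤ _ := norm_add_le _ _
  have h4 : c * η ≤ 1 / 2 := by nlinarith
  have h3 : 1 + ‖L'‖ ≤ 2 * (1 + ‖L‖) := by
    have : c * (1 + ‖L'‖) * η ≤ 1 / 2 * (1 + ‖L'‖) := by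
      have h5 : 0 ≤ 1 + ‖L'‖ := by positivity
      nlinarith
    linarith
  calc ‖L' - L‖ ≤ c * (1 + ‖L'‖) * η := h1
    _ ≤ c * (2 * (1 + ‖L‖)) * η := by gcongr

/-- Both planes are transversal to a common complement Q, hence graphs in the splitting that has Q
as second factor. -/
theorem exists_common_graph (S T : Gr k (Euc d)) :
    ∃ (A : (Euc k × Euc (d - k)) ≃L[ℝ] Euc d) (L L' : Euc k →L[ℝ] Euc (d - k)),
      planeOfGraph A L = S ∧ planeOfGraph A L' = T := by
  obtain ⟨Q, hS, hT⟩ := exists_common_isCompl S.space T.space (by rw [S.finrank_space, T.finrank_space])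
  have hd := Submodule.finrank_add_eq_of_isCompl hS
  rw [finrank_euclideanSpace_fin, S.finrank_space] at hd
  have e1 : Euc k ≃ₗ[ℝ] S.space := LinearEquiv.ofFinrankEq _ _ (by simp [S.finrank_space])
  have e2 : Euc (d - k) ≃ₗ[ℝ] Q := LinearEquiv.ofFinrankEq _ _ (by
    rw [finrank_euclideanSpace_fin]; omega)
  let A := ((e1.prodCongr e2).trans (Submodule.prodEquivOfIsCompl S.space Q hS)).toContinuousLinearEquiv
  have hA : ∀ q, A q = (e1 q.1 : Euc d) + e2 q.2 := fun q => rfl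
  have key : ∀ U : Gr k (Euc d), IsCompl U.space Q → ∃ L, planeOfGraph A L = U := by
    intro U hU
    refine exists_planeOfGraph_eq A U fun w hw hw0 => ?_
    have h1 : w ∈ Q := by
      rw [← A.apply_symm_apply w, hA, hw0]
      simp
    exact (Submodule.disjoint_def.1 hU.disjoint) w hw h1
  obtain ⟨L, hL⟩ := key S hS
  obtain ⟨L', hL'⟩ := key T hT
  exact ⟨A, L, L', hL, hL'⟩

end Graphs

/-! ### Charts and finiteness of distances in the Grassmann bundle. -/

namespace GrassmannBundle

variable {k d : ℕ} {M : Type*} [TopologicalSpace M] [ChartedSpace (Euc d) M]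
  [IsManifold (𝓡 d) ∞ M]

/-- A subspace of `T_x M` in the frame of the chart centred at `x₀`. -/
def planeCoord (x₀ : M) (p : GrassmannBundle k d M) : Gr k (Euc d) :=
  (grassmannFibre k d).act (frameChange (𝓡 d) x₀ p.1) p.2

/-- The chart of the Grassmann bundle given by a chart of `M` and a chart of the Grassmannian. -/
def graphChart (x₀ : M) (A : (Euc k × Euc (d - k)) ≃L[ℝ] Euc d) :
    OpenPartialHomeomorph (GrassmannBundle k d M)
      (ModelProd (Euc d) (Euc k →L[ℝ] Euc (d - k))) :=
  ((grassmannFibre k d).core (𝓡 d) (M := M)).openPartialHomeomorph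
    ((grassmannFibre k d).bundleChart (𝓡 d) x₀ A) ⟨x₀, A, rfl⟩

theorem mem_graphChart_source {x₀ : M} {A : (Euc k × Euc (d - k)) ≃L[ℝ] Euc d}
    {p : GrassmannBundle k d M} (hp : p.1 ∈ (chartAt (Euc d) x₀).source)
    {L : Euc k →L[ℝ] Euc (d - k)} (hL : planeOfGraph A L = planeCoord x₀ p) :
    p ∈ (graphChart x₀ A).source := ⟨hp, L, hL⟩

theorem graphChart_apply {x₀ : M} {A : (Euc k × Euc (d - k)) ≃L[ℝ] Euc d}
    {p : GrassmannBundle k d M}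
    {L : Euc k →L[ℝ] Euc (d - k)} (hL : planeOfGraph A L = planeCoord x₀ p) :
    graphChart x₀ A p = (chartAt (Euc d) x₀ p.1, L) := by
  refine Prod.ext rfl ?_
  have h : (graphChart x₀ A p).2 = Function.invFun (planeOfGraph A) (planeCoord x₀ p) := rfl
  rw [h, ← hL]
  exact Function.leftInverse_invFun ((grassmannFibre k d).injective A) L

theorem graphChart_symm_apply {x₀ : M} {A : (Euc k × Euc (d - k)) ≃L[ℝ] Euc d}
    {p : GrassmannBundle k d M} (hp : p.1 ∈ (chartAt (Euc d) x₀).source)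
    {L : Euc k →L[ℝ] Euc (d - k)} (hL : planeOfGraph A L = planeCoord x₀ p) :
    (graphChart x₀ A).symm (chartAt (Euc d) x₀ p.1, L) = p := by
  rw [← graphChart_apply hL]
  exact (graphChart x₀ A).left_inv (mem_graphChart_source hp hL)

theorem mem_graphChart_target {x₀ : M} {A : (Euc k × Euc (d - k)) ≃L[ℝ] Euc d}
    {q : ModelProd (Euc d) (Euc k →L[ℝ] Euc (d - k))} (hq : q.1 ∈ (chartAt (Euc d) x₀).target) :
    q ∈ (graphChart (M := M) x₀ A).target := hq

theorem exists_extChartAt_eq (z : GrassmannBundle k d M) :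
    ∃ (A : (Euc k × Euc (d - k)) ≃L[ℝ] Euc d) (L₀ : Euc k →L[ℝ] Euc (d - k)),
      planeOfGraph A L₀ = planeCoord z.1 z ∧
      ∀ p L, planeOfGraph A L = planeCoord z.1 p →
        extChartAt (grassmannModel k d) z p = (extChartAt (𝓡 d) z.1 p.1, L) := by
  obtain ⟨A, hA⟩ : ∃ A, chartAt (ModelProd (Euc d) (Euc k →L[ℝ] Euc (d - k))) z = graphChart z.1 A :=
    ⟨_, rfl⟩
  have hz : z ∈ (graphChart z.1 A).source := by rw [← hA]; exact mem_chart_source _ _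
  obtain ⟨-, L₀, hL₀⟩ := hz
  refine ⟨A, L₀, hL₀, fun p L hL => ?_⟩
  rw [extChartAt, hA]
  change (grassmannModel k d) (graphChart z.1 A p) = _
  rw [graphChart_apply hL]
  rfl

variable (g : SmoothMetric (grassmannModel k d) (GrassmannBundle k d M))

/-- Two planes over nearby points lie in one graph chart, where a ball times a space of linear maps
is convex and hence connected. -/
theorem eventually_dist_lt_top (x₀ : M) : ∀ᶠ y in 𝓝 x₀, ∀ z z' : GrassmannBundle k d M,
    z.1 = x₀ → z'.1 = y → g.dist z z' < ⊤ := by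
  obtain ⟨r, hr, hball⟩ := Metric.isOpen_iff.1 (chartAt (Euc d) x₀).open_target
    (chartAt (Euc d) x₀ x₀) (mem_chart_target _ _)
  have h1 : ∀ᶠ y in 𝓝 x₀, chartAt (Euc d) x₀ y ∈ Metric.ball (chartAt (Euc d) x₀ x₀) r :=
    ((chartAt (Euc d) x₀).continuousAt (mem_chart_source _ _)).eventually (Metric.ball_mem_nhds _ hr)
  filter_upwards [h1, chart_source_mem_nhds (Euc d) x₀] with y hy hys z z' hz hz'
  obtain ⟨A, L, L', hL, hL'⟩ := exists_common_graph (planeCoord x₀ z) (planeCoord x₀ z')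
  have hzs : z.1 ∈ (chartAt (Euc d) x₀).source := by rw [hz]; exact mem_chart_source _ _
  have hzs' : z'.1 ∈ (chartAt (Euc d) x₀).source := by rwa [hz']
  let U : Set (Euc d × (Euc k →L[ℝ] Euc (d - k))) := Metric.ball (chartAt (Euc d) x₀ x₀) r ×ˢ univ
  have hU : IsPreconnected U := ((convex_ball _ _).prod convex_univ).isPreconnected
  have : PreconnectedSpace U := isPreconnected_iff_preconnectedSpace.1 hU
  have hc : Continuous (fun q : U => (graphChart (M := M) x₀ A).symm q.1) := by
    refine (graphChart (M := M) x₀ A).continuousOn_symm.comp_continuous continuous_subtype_val ?_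
    exact fun q => mem_graphChart_target (hball q.2.1)
  have h2 := g.dist_lt_top_of_continuous hc
    ⟨(chartAt (Euc d) x₀ z.1, L), by rw [hz]; exact Metric.mem_ball_self hr, mem_univ _⟩
    ⟨(chartAt (Euc d) x₀ z'.1, L'), by rw [hz']; exact hy, mem_univ _⟩
  have e1 := graphChart_symm_apply hzs hL
  have e2 := graphChart_symm_apply hzs' hL'
  refine lt_of_eq_of_lt ?_ h2
  exact (congrArg₂ g.dist e1 e2).symm

/-- Every tangent space is the same space ℝᵈ, so a plane over one point is also a plane over any
other. -/
theorem nonempty_fibre (z : GrassmannBundle k d M) (x : M) : ∃ z' : GrassmannBundle k d M, z'.1 = x :=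
  ⟨⟨x, z.2⟩, rfl⟩

/-- Points of the Grassmann bundle over points at finite distance are at finite distance. -/
theorem dist_lt_top (g₀ : SmoothMetric (𝓡 d) M) {z z' : GrassmannBundle k d M}
    (h : g₀.dist z.1 z'.1 < ⊤) : g.dist z z' < ⊤ := by
  obtain ⟨γ, hγ, h0, h1⟩ := g₀.exists_continuous_of_dist_lt_top h
  -- The relation quantifies over all planes over the two points, so it is transitive along the
  -- curve without choosing a lift.
  let P : ℝ → ℝ → Prop := fun s t => ∀ y y' : GrassmannBundle k d M, y.1 = γ s → y'.1 = γ t →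
    g.dist y y' < ⊤
  have : Std.Symm P := ⟨fun s t hst y y' hy hy' => by
    rw [g.dist_comm]
    exact hst y' y hy' hy⟩
  have htr : IsTrans ℝ P := ⟨fun r s t hrs hst y y' hy hy' => by
    obtain ⟨y'', hy''⟩ := nonempty_fibre z (γ s)
    exact (g.dist_triangle y y'' y').trans_lt
      (ENNReal.add_lt_top.2 ⟨hrs _ _ hy hy'', hst _ _ hy'' hy'⟩)⟩
  have key : P 0 1 := PreconnectedSpace.induction₂ P
    (fun s => hγ.continuousAt.eventually (eventually_dist_lt_top g (γ s))) htr 0 1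
  exact key z z' h0.symm h1.symm

end GrassmannBundle

end HyperbolicHolder

namespace HyperbolicHolder

open Filter Topology GrassmannBundle

variable {k d : ℕ} {M : Type*} [TopologicalSpace M] [ChartedSpace (Euc d) M]
  [IsManifold (𝓡 d) ∞ M] {K : Set M}

/-! ### From locally Hölder fields of planes to Hölder sections. -/

section Sections

/-- The map to the Grassmann bundle given by a field of `k`-dimensional subspaces over `K`. -/
def planeSection (S : ∀ x : M, Submodule ℝ (TangentSpace (𝓡 d) x))
    (hS : ∀ x ∈ K, Module.finrank ℝ (S x) = k) (x : K) : GrassmannBundle k d M :=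
  ⟨x, ⟨S x, hS x x.2⟩⟩

/-- In the frame of the chart centred at `x₀`, the subspaces `S x` depend on `x` in a Hölder way. -/
def IsHolderNear (S : ∀ x : M, Submodule ℝ (TangentSpace (𝓡 d) x)) (K : Set M) (γ : ℝ) (x₀ : M) :
    Prop :=
  ∃ B : ℝ, 0 ≤ B ∧ ∀ᶠ p in 𝓝 x₀ ×ˢ 𝓝 x₀, p.1 ∈ K → p.2 ∈ K → ∀ u ∈ S p.1, ∃ w ∈ S p.2,
      ‖(frameChange (𝓡 d) x₀ p.1 u - frameChange (𝓡 d) x₀ p.2 w : Euc d)‖ ≤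
        B * ‖extChartAt (𝓡 d) x₀ p.1 - extChartAt (𝓡 d) x₀ p.2‖ ^ γ *
          ‖(frameChange (𝓡 d) x₀ p.1 u : Euc d)‖

variable {S : ∀ x : M, Submodule ℝ (TangentSpace (𝓡 d) x)}
  (hS : ∀ x ∈ K, Module.finrank ℝ (S x) = k) {γ : ℝ}

theorem IsHolderNear.exists_isNear {x₀ : M} (h : IsHolderNear S K γ x₀) : ∃ B : ℝ, 0 ≤ B ∧
    ∀ᶠ p in 𝓝 x₀ ×ˢ 𝓝 x₀, ∀ (hx : p.1 ∈ K) (hy : p.2 ∈ K),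
      IsNear (B * ‖extChartAt (𝓡 d) x₀ p.1 - extChartAt (𝓡 d) x₀ p.2‖ ^ γ)
        (planeCoord x₀ (planeSection S hS ⟨p.1, hx⟩)).space
        (planeCoord x₀ (planeSection S hS ⟨p.2, hy⟩)).space := by
  obtain ⟨B, hB, h⟩ := h
  refine ⟨B, hB, h.mono fun p hp hx hy => ?_⟩
  rintro _ ⟨u, hu, rfl⟩
  obtain ⟨w, hw, hw'⟩ := hp hx hy u hu
  exact ⟨_, ⟨w, hw, rfl⟩, hw'⟩

theorem tendsto_norm_extChartAt_sub_rpow (hγ : 0 < γ) (x₀ : M) :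
    Tendsto (fun p : M × M => ‖extChartAt (𝓡 d) x₀ p.1 - extChartAt (𝓡 d) x₀ p.2‖ ^ γ)
      (𝓝 x₀ ×ˢ 𝓝 x₀) (𝓝 0) := by
  have h3 : Tendsto (fun p : M × M => ‖extChartAt (𝓡 d) x₀ p.1 - extChartAt (𝓡 d) x₀ p.2‖)
      (𝓝 x₀ ×ˢ 𝓝 x₀) (𝓝 ‖extChartAt (𝓡 d) x₀ x₀ - extChartAt (𝓡 d) x₀ x₀‖) :=
    (((continuousAt_extChartAt x₀).tendsto.comp tendsto_fst).sub
      ((continuousAt_extChartAt x₀).tendsto.comp tendsto_snd)).norm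
  rw [sub_self, norm_zero] at h3
  have h4 := h3.rpow_const (p := γ) (Or.inr hγ.le)
  rwa [Real.zero_rpow hγ.ne'] at h4

/-- The coordinates of the section, as graphs of linear maps. -/
theorem IsHolderNear.exists_graph (hγ : 0 < γ) {x₀ : K} (h : IsHolderNear S K γ (x₀ : M))
    (A : (Euc k × Euc (d - k)) ≃L[ℝ] Euc d) (L₀ : Euc k →L[ℝ] Euc (d - k))
    (hL₀ : planeOfGraph A L₀ = planeCoord (x₀ : M) (planeSection S hS x₀)) :
    ∃ L : K → (Euc k →L[ℝ] Euc (d - k)), Tendsto L (𝓝 x₀) (𝓝 L₀) ∧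
      ∀ᶠ x in 𝓝 x₀, planeOfGraph A (L x) = planeCoord (x₀ : M) (planeSection S hS x) := by
  obtain ⟨B, hB, hnear⟩ := h.exists_isNear hS
  obtain ⟨δ, C, hδ, hC, hgraph⟩ := exists_graph_of_isNear A L₀
  have hval : Tendsto (fun x : K => ((x : M), (x₀ : M))) (𝓝 x₀) (𝓝 (x₀ : M) ×ˢ 𝓝 (x₀ : M)) :=
    continuous_subtype_val.continuousAt.tendsto.prodMk tendsto_const_nhds
  have h1 := hval.eventually hnear
  have h2 : Tendsto (fun x : K => B * ‖extChartAt (𝓡 d) (x₀ : M) x - extChartAt (𝓡 d) (x₀ : M) x₀‖ ^ γ)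
      (𝓝 x₀) (𝓝 0) := by
    have := ((tendsto_norm_extChartAt_sub_rpow (d := d) hγ (x₀ : M)).comp hval).const_mul B
    rwa [mul_zero] at this
  have h3 : ∀ᶠ x in 𝓝 x₀, ∃ L', planeOfGraph A L' = planeCoord (x₀ : M) (planeSection S hS x) ∧
      ‖L' - L₀‖ ≤ C * (B * ‖extChartAt (𝓡 d) (x₀ : M) x - extChartAt (𝓡 d) (x₀ : M) x₀‖ ^ γ) := by
    filter_upwards [h1, h2.eventually (ge_mem_nhds hδ)] with x k1 k2
    refine hgraph _ _ (by positivity) k2 ?_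
    rw [hL₀]
    exact k1 x.2 x₀.2
  classical
  obtain ⟨L, hL⟩ : ∃ L : K → (Euc k →L[ℝ] Euc (d - k)), ∀ᶠ x in 𝓝 x₀,
      planeOfGraph A (L x) = planeCoord (x₀ : M) (planeSection S hS x) ∧
      ‖L x - L₀‖ ≤ C * (B * ‖extChartAt (𝓡 d) (x₀ : M) x - extChartAt (𝓡 d) (x₀ : M) x₀‖ ^ γ) :=
    Filter.Eventually.choice h3
  refine ⟨L, ?_, hL.mono fun x hx => hx.1⟩
  rw [tendsto_iff_norm_sub_tendsto_zero]
  have h4 := h2.const_mul C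
  rw [mul_zero] at h4
  exact squeeze_zero' (Eventually.of_forall fun x => norm_nonneg _) (hL.mono fun x hx => hx.2) h4

variable (g : SmoothMetric (𝓡 d) M) (gG : SmoothMetric (grassmannModel k d) (GrassmannBundle k d M))

/-- In the chart at the value of the section, the fibre component is Hölder by the graph estimate.
The base component is only Lipschitz, whence the requirement γ ≤ 1 outside dimension 0. -/
theorem IsHolderNear.eventually_dist_le [RegularSpace M] (hγ : 0 < γ) {x₀ : K}
    (h : IsHolderNear S K γ (x₀ : M)) (hγ1 : γ ≤ 1 ∨ d = 0) :
    Tendsto (planeSection S hS) (𝓝 x₀) (𝓝 (planeSection S hS x₀)) ∧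
    ∃ C : ℝ≥0, ∀ᶠ p in 𝓝 x₀ ×ˢ 𝓝 x₀, gG.dist (planeSection S hS p.1) (planeSection S hS p.2) ≤
      C * g.dist (p.1 : M) (p.2 : M) ^ γ := by
  obtain ⟨A, L₀, hL₀, hext⟩ := exists_extChartAt_eq (planeSection S hS x₀)
  have hL₀ : planeOfGraph A L₀ = planeCoord (x₀ : M) (planeSection S hS x₀) := hL₀
  obtain ⟨L, hLt, hL⟩ := h.exists_graph hS hγ A L₀ hL₀
  have hsrc : ∀ᶠ x : K in 𝓝 x₀, (x : M) ∈ (chartAt (Euc d) (x₀ : M)).source :=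
    continuous_subtype_val.continuousAt.eventually (chart_source_mem_nhds (Euc d) (x₀ : M))
  have hcont : Tendsto (planeSection S hS) (𝓝 x₀) (𝓝 (planeSection S hS x₀)) := by
    have h1 : Tendsto (fun x : K => ((chartAt (Euc d) (x₀ : M) x, L x) :
        ModelProd (Euc d) (Euc k →L[ℝ] Euc (d - k)))) (𝓝 x₀)
        (𝓝 (chartAt (Euc d) (x₀ : M) x₀, L₀)) := by
      refine Tendsto.prodMk_nhds ?_ hLt
      exact ((chartAt (Euc d) (x₀ : M)).continuousAt (mem_chart_source _ _)).tendsto.comp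
        continuous_subtype_val.continuousAt.tendsto
    have h2 := ((graphChart (M := M) (x₀ : M) A).continuousAt_symm
      (x := (chartAt (Euc d) (x₀ : M) x₀, L₀)) (mem_graphChart_target (mem_chart_target _ _))).tendsto.comp h1
    have e : (graphChart (M := M) (x₀ : M) A).symm (chartAt (Euc d) (x₀ : M) x₀, L₀) =
        planeSection S hS x₀ := graphChart_symm_apply (p := planeSection S hS x₀) (mem_chart_source _ _) hL₀
    rw [e] at h2
    refine h2.congr' ?_
    filter_upwards [hsrc, hL] with x hx hLx
    exact graphChart_symm_apply (p := planeSection S hS x) hx hLx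
  refine ⟨hcont, ?_⟩
  obtain ⟨B, hB, hnear⟩ := h.exists_isNear hS
  obtain ⟨C₁, h₁⟩ := gG.eventually_dist_le (planeSection S hS x₀)
  obtain ⟨C₂, h₂⟩ := g.eventually_edist_extChartAt_le (x₀ : M)
  have hval : Tendsto (fun p : K × K => ((p.1 : M), (p.2 : M))) (𝓝 x₀ ×ˢ 𝓝 x₀)
      (𝓝 (x₀ : M) ×ˢ 𝓝 (x₀ : M)) :=
    continuous_subtype_val.continuousAt.tendsto.prodMap continuous_subtype_val.continuousAt.tendsto
  have hsmall := hval.eventually ((tendsto_norm_extChartAt_sub_rpow (d := d) one_pos (x₀ : M)).eventually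
    (ge_mem_nhds one_pos))
  have hbd : ∀ᶠ x in 𝓝 x₀, ‖L x‖ ≤ ‖L₀‖ + 1 :=
    hLt.norm.eventually (ge_mem_nhds (lt_add_one _))
  set s := ‖(A.symm : Euc d →L[ℝ] (Euc k × Euc (d - k)))‖ with hs
  set r := ‖(A : (Euc k × Euc (d - k)) →L[ℝ] Euc d)‖ with hr
  set R : ℝ := ‖L₀‖ + 1 with hR
  have hR0 : 0 ≤ R := by positivity
  set C₃ : ℝ := s * (1 + R) * r * (1 + R) * B with hC₃
  have hC₃0 : 0 ≤ C₃ := by positivity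
  refine ⟨C₁ * ((max 1 C₃).toNNReal * C₂ ^ γ), ?_⟩
  filter_upwards [(hcont.prodMap hcont).eventually h₁, hval.eventually h₂, hval.eventually hnear,
    hsmall, prod_mem_prod hL hL, prod_mem_prod hbd hbd] with p k₁ k₂ k₃ k₄ kL kb
  obtain ⟨x, y⟩ := p
  dsimp only at k₁ k₂ k₃ k₄ kL kb ⊢
  simp only [Prod.map_fst, Prod.map_snd] at k₁
  obtain ⟨kLx, kLy⟩ := kL
  obtain ⟨kbx, kby⟩ := kb
  dsimp only [mem_ofPred_eq] at kLx kLy kbx kby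
  have k₃' := k₃ x.2 y.2
  rw [Real.rpow_one] at k₄
  set ρ := ‖extChartAt (𝓡 d) (x₀ : M) x - extChartAt (𝓡 d) (x₀ : M) y‖ with hρ
  have hρ0 : 0 ≤ ρ := norm_nonneg _
  have hbase : ρ ≤ ρ ^ γ := by
    rcases hγ1 with hγ1 | rfl
    · exact Real.self_le_rpow_of_le_one hρ0 k₄ hγ1
    · rw [hρ, Subsingleton.elim (extChartAt (𝓡 0) (x₀ : M) x) (extChartAt (𝓡 0) (x₀ : M) y), sub_self,
        norm_zero]
      positivity
  have hLxy : ‖L x - L y‖ ≤ C₃ * ρ ^ γ := by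
    have h5 : IsNear (B * ρ ^ γ) (planeOfGraph A (L x)).space (planeOfGraph A (L y)).space := by
      rw [kLx, kLy]
      exact k₃'
    refine (norm_graph_sub_le A (by positivity) h5).trans ?_
    calc s * (1 + ‖L y‖) * r * (1 + ‖L x‖) * (B * ρ ^ γ) ≤
        s * (1 + R) * r * (1 + R) * (B * ρ ^ γ) := by gcongr
      _ = _ := by rw [hC₃]; ring
  have e1 := hext (planeSection S hS x) (L x) kLx
  have e2 := hext (planeSection S hS y) (L y) kLy
  have e3 : edist (extChartAt (grassmannModel k d) (planeSection S hS x₀) (planeSection S hS x))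
      (extChartAt (grassmannModel k d) (planeSection S hS x₀) (planeSection S hS y)) ≤
      ENNReal.ofReal (max 1 C₃ * ρ ^ γ) := by
    rw [e1, e2, Prod.edist_eq]
    refine max_le ?_ ?_
    · rw [edist_dist, dist_eq_norm]
      refine ENNReal.ofReal_le_ofReal ?_
      calc ρ ≤ 1 * ρ ^ γ := by rw [one_mul]; exact hbase
        _ ≤ _ := by gcongr; exact le_max_left _ _
    · rw [edist_dist, dist_eq_norm]
      refine ENNReal.ofReal_le_ofReal (hLxy.trans ?_)
      gcongr
      exact le_max_right _ _
  have e4 : ENNReal.ofReal (ρ ^ γ) ≤ (C₂ : ℝ≥0∞) ^ γ * g.dist (x : M) (y : M) ^ γ := by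
    rw [← ENNReal.ofReal_rpow_of_nonneg hρ0 hγ.le, ← ENNReal.mul_rpow_of_nonneg _ _ hγ.le]
    refine ENNReal.rpow_le_rpow ?_ hγ.le
    rwa [edist_dist, dist_eq_norm] at k₂
  refine k₁.trans ?_
  rw [ENNReal.coe_mul, ENNReal.coe_mul, ENNReal.coe_rpow_of_nonneg _ hγ.le, mul_assoc, mul_assoc]
  refine mul_le_mul_right (e3.trans ?_) _
  rw [ENNReal.ofReal_mul (by positivity)]
  exact mul_le_mul' le_rfl e4

/-- A field of subspaces that is locally Hölder continuous in charts over a compact set is Hölder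
continuous for the Riemannian distances. -/
theorem isHolder_planeSection [T2Space M] (hK : IsCompact K) (hγ : 0 < γ)
    (h : ∀ x ∈ K, IsHolderNear S K γ x) (hγ1 : ∀ x ∈ K, γ ≤ 1 ∨ d = 0) :
    IsHolder g gG (planeSection S hS) γ := by
  have := Manifold.locallyCompact_of_finiteDimensional (𝓡 d) (M := M)
  have hloc := fun x : K => (h x x.2).eventually_dist_le hS g gG hγ (hγ1 x x.2)
  have : CompactSpace K := isCompact_iff_compactSpace.1 hK
  obtain ⟨C, ε, hε, hC⟩ : ∃ (C : ℝ≥0) (ε : ℝ≥0), 0 < ε ∧ ∀ x y : K, g.dist (x : M) (y : M) < ε →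
      gG.dist (planeSection S hS x) (planeSection S hS y) ≤ C * g.dist (x : M) (y : M) ^ γ := by
    let := g.pseudoEMetricSpace
    refine (exists_uniform_of_eventually (X := K) isCompact_univ
      (fun C x y => gG.dist (planeSection S hS x) (planeSection S hS y) ≤
        C * g.dist (x : M) (y : M) ^ γ) ?_ ?_).imp fun C ⟨ε, hε, h⟩ =>
          ⟨ε, hε, fun x y hxy => h x (mem_univ _) y hxy⟩
    · intro C C' x y hCC h1
      refine h1.trans ?_
      gcongr
    · intro z _
      exact (hloc z).2
  obtain ⟨D, hD⟩ := exists_bound_of_locally_bounded (X := K) isCompact_univ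
    (fun x y => gG.dist (planeSection S hS x) (planeSection S hS y))
    (fun x y => gG.dist_comm _ _) (fun x y z => gG.dist_triangle _ _ _) (by
      intro z _
      refine ⟨1, mem_nhdsWithin_of_mem_nhds ?_⟩
      filter_upwards [(hloc z).1.eventually
        (gG.eventually_dist_lt (planeSection S hS z) (c := 1) one_pos)] with x hx
      simpa using hx.le)
  -- C serves pairs closer than ε, D/ε^γ the remaining pairs at finite distance; the 1 makes the
  -- bound infinite at infinite distance.
  refine ⟨max 1 (max C (D / ε ^ γ)), fun x y => ?_⟩
  by_cases h1 : g.dist (x : M) (y : M) < ε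
  · refine (hC x y h1).trans ?_
    gcongr
    exact (le_max_left _ _).trans (le_max_right _ _)
  by_cases h2 : g.dist (x : M) (y : M) = ⊤
  · rw [h2, ENNReal.top_rpow_of_pos hγ, ENNReal.mul_top]
    · exact le_top
    · exact_mod_cast (zero_lt_one.trans_le (le_max_left _ _)).ne'
  have h3 : gG.dist (planeSection S hS x) (planeSection S hS y) < ⊤ :=
    GrassmannBundle.dist_lt_top gG g (lt_top_iff_ne_top.2 h2)
  refine (hD x (mem_univ _) y (mem_univ _) h3).trans ?_
  have hεγ : (ε ^ γ : ℝ≥0) ≠ 0 := (NNReal.rpow_pos hε).ne'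
  calc (D : ℝ≥0∞) = ((D / ε ^ γ : ℝ≥0) : ℝ≥0∞) * (ε : ℝ≥0∞) ^ γ := by
        rw [← ENNReal.coe_rpow_of_nonneg _ hγ.le, ← ENNReal.coe_mul, div_mul_cancel₀ _ hεγ]
    _ ≤ _ := by
      refine mul_le_mul' ?_ (ENNReal.rpow_le_rpow (not_lt.1 h1) hγ.le)
      exact_mod_cast (le_max_right _ _).trans (le_max_right _ _)

end Sections

/-! ### Hölder continuity of the stable and unstable bundles. -/

section Hyperbolic

variable {n : ℕ∞ω} {φ : M ≃ₘ^n⟮𝓡 d, 𝓡 d⟯ M} {du ds : ℕ}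
  {Eu Es : ∀ x : M, Submodule ℝ (TangentSpace (𝓡 d) x)} {lam Lam : ℝ}

theorem IsHyperbolicOn.isHolder_stable [T2Space M] (hn0 : n ≠ 0)
    (h : IsHyperbolicOn φ K du ds Eu Es lam)
    {gT : SmoothMetric (compactifiedModel d) (CompactifiedTangentBundle d M)}
    (hL : 1 ≤ Lam) (hLip : IsLipschitzOver hn0 φ K gT Lam) (g : SmoothMetric (𝓡 d) M)
    (gs : SmoothMetric (grassmannModel ds d) (GrassmannBundle ds d M)) :
    IsHolder g gs h.stable (holderExponent lam Lam) := by
  refine isHolder_planeSection (S := Es) h.finrank_stable g gs h.isCompact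
    (holderExponent_pos h.lam_pos h.lam_lt_one hL)
    (fun x _ => h.exists_mem_stable_close hn0 hL hLip x) (fun x hx => ?_)
  by_cases hd : d = 0
  · exact Or.inr hd
  · exact Or.inl (holderExponent_le_one h.lam_pos h.lam_lt_one hL (h.one_le_mul hn0 hL hLip hx hd))

theorem map_mfderiv_symm_eq (hn0 : n ≠ 0) (S : ∀ x : M, Submodule ℝ (TangentSpace (𝓡 d) x)) {y : M}
    (h : (S y).map (mfderiv (𝓡 d) (𝓡 d) φ y).toLinearMap = S (φ y)) :
    (S (φ y)).map (mfderiv (𝓡 d) (𝓡 d) φ.symm (φ y)).toLinearMap = S (φ.symm (φ y)) := by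
  have hinv : ∀ v : TangentSpace (𝓡 d) y,
      (mfderiv (𝓡 d) (𝓡 d) φ.symm (φ y) (mfderiv (𝓡 d) (𝓡 d) φ y v) : Euc d) = v :=
    fun v => mfderiv_symm_iterate_iterate hn0 φ 1 y v
  rw [← h]
  ext u
  constructor
  · rintro ⟨_, ⟨v, hv, rfl⟩, rfl⟩
    exact IsHyperbolicOn.mem_congr S _ _ _ _ (φ.symm_apply_apply y).symm (hinv v).symm hv
  · intro hu
    have hu' := IsHyperbolicOn.mem_congr S _ _ _ _ (φ.symm_apply_apply y) (rfl : (u : Euc d) = u) hu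
    exact ⟨_, ⟨_, hu', rfl⟩, hinv _⟩

/-- Time reversal exchanges the two bundles and their contraction estimates with the same rate. -/
theorem IsHyperbolicOn.symm (hn0 : n ≠ 0) (h : IsHyperbolicOn φ K du ds Eu Es lam) :
    IsHyperbolicOn φ.symm K ds du Es Eu lam where
  isCompact := h.isCompact
  image_eq := by
    conv_lhs => rw [← h.image_eq]
    rw [← image_comp]
    have : φ.symm ∘ φ = id := funext φ.symm_apply_apply
    rw [this, image_id]
  finrank_unstable := h.finrank_stable
  finrank_stable := h.finrank_unstable
  isCompl x hx := (h.isCompl x hx).symm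
  map_unstable x hx := by
    rw [← h.image_eq] at hx
    obtain ⟨y, hy, rfl⟩ := hx
    exact map_mfderiv_symm_eq hn0 Es (h.map_stable y hy)
  map_stable x hx := by
    rw [← h.image_eq] at hx
    obtain ⟨y, hy, rfl⟩ := hx
    exact map_mfderiv_symm_eq hn0 Eu (h.map_unstable y hy)
  lam_pos := h.lam_pos
  lam_lt_one := h.lam_lt_one
  contraction := by
    obtain ⟨g, C, hC, hu, hs⟩ := h.contraction
    exact ⟨g, C, hC, hs, hu⟩

theorem IsHyperbolicOn.isHolder_unstable [T2Space M] (hn0 : n ≠ 0)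
    (h : IsHyperbolicOn φ K du ds Eu Es lam)
    {gT : SmoothMetric (compactifiedModel d) (CompactifiedTangentBundle d M)}
    (hL : 1 ≤ Lam) (hLip : IsLipschitzOver hn0 φ.symm K gT Lam) (g : SmoothMetric (𝓡 d) M)
    (gu : SmoothMetric (grassmannModel du d) (GrassmannBundle du d M)) :
    IsHolder g gu h.unstable (holderExponent lam Lam) :=
  (h.symm hn0).isHolder_stable hn0 hL hLip g gu

theorem IsLipschitzOver.mono {hn0 : n ≠ 0}
    {gT : SmoothMetric (compactifiedModel d) (CompactifiedTangentBundle d M)} {Lam' : ℝ}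
    (h : IsLipschitzOver hn0 φ K gT Lam) (hL : Lam ≤ Lam') : IsLipschitzOver hn0 φ K gT Lam' :=
  fun p q hp hq => (h p q hp hq).trans (by gcongr)

theorem exists_isLipschitzOver_symm [T2Space M] (hn : 2 ≤ n) (hn0 : n ≠ 0) (φ : M ≃ₘ^n⟮𝓡 d, 𝓡 d⟯ M)
    (hK : IsCompact K) (gT : SmoothMetric (compactifiedModel d) (CompactifiedTangentBundle d M)) :
    ∃ Lam : ℝ, 1 ≤ Lam ∧ IsLipschitzOver hn0 φ K gT Lam ∧ IsLipschitzOver hn0 φ.symm K gT Lam := by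
  obtain ⟨L₁, h₁, hL₁⟩ := exists_isLipschitzOver hn hn0 φ hK gT
  obtain ⟨L₂, -, hL₂⟩ := exists_isLipschitzOver hn hn0 φ.symm hK gT
  exact ⟨max L₁ L₂, h₁.trans (le_max_left _ _), hL₁.mono (le_max_left _ _), hL₂.mono (le_max_right _ _)⟩

end Hyperbolic

end HyperbolicHolder

end

theorem lemmal (du ds N : ℕ) (hN : 1 ≤ N) {M : Type*} [TopologicalSpace M] [T2Space M]
    [SecondCountableTopology M] [ChartedSpace (Euc (du + ds)) M] [IsManifold (𝓡 (du + ds)) ∞ M]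
    (φ : M ≃ₘ^((N : ℕ∞ω) + 1)⟮𝓡 (du + ds), 𝓡 (du + ds)⟯ M) (K : Set M)
    (Eu Es : ∀ x : M, Submodule ℝ (TangentSpace (𝓡 (du + ds)) x)) (lam : ℝ)
    (h : IsHyperbolicOn φ K du ds Eu Es lam)
    (g : SmoothMetric (𝓡 (du + ds)) M)
    (gu : SmoothMetric (grassmannModel du (du + ds)) (GrassmannBundle du (du + ds) M))
    (gs : SmoothMetric (grassmannModel ds (du + ds)) (GrassmannBundle ds (du + ds) M)) :
    (∃ γ : ℝ, 0 < γ ∧ IsHolder g gu h.unstable γ ∧ IsHolder g gs h.stable γ) ∧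
    ∀ gT : SmoothMetric (compactifiedModel (du + ds)) (CompactifiedTangentBundle (du + ds) M),
      (∃ Lam : ℝ, 1 ≤ Lam ∧ IsLipschitzOver (by simp) φ K gT Lam ∧
        IsLipschitzOver (by simp) φ.symm K gT Lam) ∧
      (∀ Lam : ℝ, 1 ≤ Lam → IsLipschitzOver (by simp) φ K gT Lam →
        0 < holderExponent lam Lam ∧ IsHolder g gs h.stable (holderExponent lam Lam)) ∧
      (∀ Lam : ℝ, 1 ≤ Lam → IsLipschitzOver (by simp) φ.symm K gT Lam →
        0 < holderExponent lam Lam ∧ IsHolder g gu h.unstable (holderExponent lam Lam)) := by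
  -- N ≥ 1 enters only here, to make φ of class C².
  have hn : (2 : ℕ∞ω) ≤ (N : ℕ∞ω) + 1 := by
    have h1 : (1 : ℕ∞ω) ≤ (N : ℕ∞ω) := by exact_mod_cast hN
    calc (2 : ℕ∞ω) = 1 + 1 := by norm_num
      _ ≤ (N : ℕ∞ω) + 1 := by gcongr
  have hn0 : (N : ℕ∞ω) + 1 ≠ 0 := by simp
  refine ⟨?_, fun gT => ⟨exists_isLipschitzOver_symm hn hn0 φ h.isCompact gT, fun Lam hL hLip => ?_,
    fun Lam hL hLip => ?_⟩⟩
  -- The first claim mentions no metric on the compactification, so one is constructed; a constant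
  -- valid for both φ and its inverse yields one exponent for both bundles.
  · obtain ⟨gT⟩ := exists_smoothMetric (compactifiedModel (du + ds))
      (CompactifiedTangentBundle (du + ds) M)
    obtain ⟨Lam, hL, h₁, h₂⟩ := exists_isLipschitzOver_symm hn hn0 φ h.isCompact gT
    exact ⟨holderExponent lam Lam, holderExponent_pos h.lam_pos h.lam_lt_one hL,
      h.isHolder_unstable hn0 hL h₂ g gu, h.isHolder_stable hn0 hL h₁ g gs⟩
  · exact ⟨holderExponent_pos h.lam_pos h.lam_lt_one hL, h.isHolder_stable hn0 hL hLip g gs⟩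
  · exact ⟨holderExponent_pos h.lam_pos h.lam_lt_one hL, h.isHolder_unstable hn0 hL hLip g gu⟩
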